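/- Notation. Let $\mathcal Z$ be a separable infinite-dimensional complex Hilbert space with a complete orthonormal system $\{e_j,\ j=0,1,\dots\}$; put $v_j:=\langle e_j|v\rangle$. For a complex Hilbert space $\mathcal X$, the symmetric Fock space over $\mathcal X$ is $\bigoplus_{n\ge 0}(\mathcal X^{\otimes n})_{\rm s}$ (Hilbert space direct sum, the term $n=0$ being $\mathbb C$), with the exponential vectors $E(f)=(1,f,\dots,\frac1{\sqrt{n!}}f^{\otimes n},\dots)$. For $g\in\mathcal X$ the Weyl operator $\mathcal W(g;1)$ is the unitary operator with $\mathcal W(g;1)E(f)=\exp\{-\frac12\|g\|^2-\langle g|f\rangle\}E(f+g)$. On the linear span of the exponential vectors, $a(g)E(f)=\langle g|f\rangle E(f)$ and $a^\dagger(g)E(f)=\frac{d}{d\varepsilon}E(f+\varepsilon g)|_{\varepsilon=0}$; the essentially selfadjoint operator $a(g)+a^\dagger(g)$ is identified with its closure. Let $\Gamma$ be the Fock space over $L^2(\mathbb R;\mathcal Z)$, $\Gamma_0$ the one over $L^2(\mathbb R_+;\mathcal Z)$ and $\Gamma_{-\infty}^0$ the one over $L^2((-\infty,0);\mathcal Z)$,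 so that $\Gamma=\Gamma_{-\infty}^0\otimes\Gamma_0$ with $E(f)=E(f|_{(-\infty,0)})\otimes E(f|_{\mathbb R_+})$. Let $\mathcal R$ be the set of the $k\in L^2_{\rm loc}(\mathbb R_+;\mathcal Z)$ with real components $k_j$. For $k\in\mathcal R$ and $t>0$ put $\mathcal W_t(ik;1):=\mathcal W(i\chi_{[0,t]}k;1)$, $A_j(t):=a(\chi_{[0,t]}e_j)$, $A_j^\dagger(t):=a^\dagger(\chi_{[0,t]}e_j)$, and let $\mathcal M(t):=\{\mathcal W_t(ik;1),\ k\in\mathcal R\}''$ (double commutant), all of these on $\Gamma_0$. Let $\Omega$ be the set of the functions $t\mapsto\omega(t)=(\omega_0(t),\omega_1(t),\dots)$ on $\mathbb R_+$ with real continuous components vanishing at $0$, $W_j(t)(\omega):=\omega_j(t)$, $\mathcal F:=\sigma\{W_j(t),\ j\ge0,\ t\ge0\}$, $\mathcal F_t:=\sigma\{W_j(s),\ j\ge0,\ s\in[0,t]\}$, let $P$ be the Wiener measure on $(\Omega,\mathcal F)$ (under which the $W_j$ are independent standard Brownian motions), and $L^2_W:=L^2(\Omega,\mathcal F,P)$.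 Theorem. There exists a unique unitary isomorphism $\mathcal I:\Gamma_0\to L^2_W$ such that $$\mathcal I E(f)=\exp\Bigl\{\sum_{j=0}^\infty\int_0^{+\infty}\bigl[f_j(t)\,dW_j(t)-\tfrac12 (f_j(t))^2dt\bigr]\Bigr\}\qquad\forall f\in L^2(\mathbb R_+;\mathcal Z),$$ where the stochastic integrals are Wiener integrals and the series converges in $L^2_W$ (the series of the Wiener integrals alone also converges in $L^2_W$). Moreover, for all $t>0$: (a) for all $k\in\mathcal R$, $\mathcal I\,\mathcal W_t(ik;1)\,\mathcal I^{-1}$ is the operator of multiplication by $\exp\{i\sum_{j=0}^\infty\int_0^tk_j(s)\,dW_j(s)\}$; (b) for all $j$, $\mathcal I\,(A_j(t)+A_j^\dagger(t))\,\mathcal I^{-1}$ is the operator of multiplication by $W_j(t)$ on its maximal domain; (c) $\mathcal I\,\mathcal M(t)\,\mathcal I^{-1}=L^\infty(\Omega,\mathcal F_t,P)$, as an algebra of multiplication operators on $L^2_W$. Here the operators $\mathcal W_t(ik;1)$ and the algebra $\mathcal M(t)$ on $\Gamma_0$ represent those on $\Gamma$: the Weyl operator $\mathcal W(i\chi_{[0,t]}k;1)$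 on $\Gamma$ is $1\otimes\mathcal W_t(ik;1)$, and the double commutant in $\mathcal L(\Gamma)$ of these operators, $k\in\mathcal R$, is $1\otimes\mathcal M(t)$. -/

import Mathlib

open MeasureTheory ProbabilityTheory
open scoped InnerProductSpace NNReal ENNReal ComplexConjugate ComplexOrder

noncomputable section

namespace FockWiener

/-! ### Hilbert tensor powers and their symmetric parts -/

section TensorPower

variable (H : Type*) [NormedAddCommGroup H] [InnerProductSpace ℂ H]

/-- The algebraic tensor power `H ⊗ ⋯ ⊗ H` (`n` factors), as a type of its own: it carries the
Hilbert space inner product, not the projective seminorm. -/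
def AlgTensorPower (n : ℕ) : Type _ := PiTensorProduct ℂ (fun _ : Fin n => H)

namespace AlgTensorPower

instance (n : ℕ) : AddCommGroup (AlgTensorPower H n) :=
  inferInstanceAs (AddCommGroup (PiTensorProduct ℂ (fun _ : Fin n => H)))

instance (n : ℕ) : Module ℂ (AlgTensorPower H n) :=
  inferInstanceAs (Module ℂ (PiTensorProduct ℂ (fun _ : Fin n => H)))

variable {H} {n : ℕ}

/-- The elementary tensor `f 0 ⊗ ⋯ ⊗ f (n - 1)`. -/
def tmul : MultilinearMap ℂ (fun _ : Fin n => H) (AlgTensorPower H n) :=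
  PiTensorProduct.tprod ℂ

/-- The linear map out of the algebraic tensor power given by a multilinear map. -/
def lift {F : Type*} [AddCommGroup F] [Module ℂ F]
    (φ : MultilinearMap ℂ (fun _ : Fin n => H) F) : AlgTensorPower H n →ₗ[ℂ] F :=
  PiTensorProduct.lift φ

theorem lift_tmul {F : Type*} [AddCommGroup F] [Module ℂ F]
    (φ : MultilinearMap ℂ (fun _ : Fin n => H) F) (f : Fin n → H) : lift φ (tmul f) = φ f :=
  PiTensorProduct.lift.tprod f

theorem hom_ext {F : Type*} [AddCommGroup F] [Module ℂ F] {φ ψ : AlgTensorPower H n →ₗ[ℂ] F}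
    (h : ∀ f, φ (tmul f) = ψ (tmul f)) : φ = ψ :=
  PiTensorProduct.ext (MultilinearMap.ext h)

theorem span_tmul : Submodule.span ℂ (Set.range (tmul : (Fin n → H) → AlgTensorPower H n)) = ⊤ :=
  PiTensorProduct.span_tprod_eq_top

@[elab_as_elim]
theorem induction {p : AlgTensorPower H n → Prop} (x : AlgTensorPower H n)
    (hs : ∀ (c : ℂ) (f : Fin n → H), p (c • tmul f)) (ha : ∀ x y, p x → p y → p (x + y)) : p x :=
  PiTensorProduct.induction_on x hs ha

/-- The multilinear form `g ↦ ∏ ⟪f i, g i⟫`. -/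
def prodInner (f : Fin n → H) : MultilinearMap ℂ (fun _ : Fin n => H) ℂ :=
  (MultilinearMap.mkPiAlgebra ℂ (Fin n) ℂ).compLinearMap (fun i => (innerSL ℂ (f i)).toLinearMap)

theorem prodInner_apply (f g : Fin n → H) : prodInner f g = ∏ i, ⟪f i, g i⟫_ℂ := by
  simp [prodInner]

theorem prodInner_conj (f g : Fin n → H) : conj (prodInner f g) = prodInner g f := by
  simp [prodInner_apply, map_prod]

/-- The conjugate-linear functional `x ↦ ⟪x, f 0 ⊗ ⋯ ⊗ f (n - 1)⟫`. -/
def innerTmul (f : Fin n → H) : AlgTensorPower H n →ₛₗ[starRingEnd ℂ] ℂ where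
  toFun x := conj (lift (prodInner f) x)
  map_add' x y := by simp
  map_smul' c x := by simp

theorem lift_prodInner_add [DecidableEq (Fin n)] (f : Fin n → H) (i : Fin n) (a b : H)
    (x : AlgTensorPower H n) :
    conj (lift (prodInner (Function.update f i (a + b))) x) =
      conj (lift (prodInner (Function.update f i a)) x) +
        conj (lift (prodInner (Function.update f i b)) x) := by
  induction x using induction with
  | hs c g =>
    simp only [map_smul, lift_tmul, smul_eq_mul, map_mul, prodInner_conj,
      MultilinearMap.map_update_add]
    ring
  | ha x y hx hy => simp only [map_add, hx, hy]; ring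

theorem lift_prodInner_smul [DecidableEq (Fin n)] (f : Fin n → H) (i : Fin n) (r : ℂ) (a : H)
    (x : AlgTensorPower H n) :
    conj (lift (prodInner (Function.update f i (r • a))) x) =
      r * conj (lift (prodInner (Function.update f i a)) x) := by
  induction x using induction with
  | hs c g =>
    simp only [map_smul, lift_tmul, smul_eq_mul, map_mul, prodInner_conj,
      MultilinearMap.map_update_smul]
    ring
  | ha x y hx hy => simp only [map_add, hx, hy]; ring

/-- The sesquilinear form on the algebraic tensor power, linear in the second variable. -/
def form : AlgTensorPower H n →ₗ[ℂ] (AlgTensorPower H n →ₛₗ[starRingEnd ℂ] ℂ) :=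
  lift
    { toFun := innerTmul
      map_update_add' := fun f i a b => by
        ext x; exact lift_prodInner_add f i a b x
      map_update_smul' := fun f i r a => by
        ext x; exact lift_prodInner_smul f i r a x }

theorem form_tmul (f g : Fin n → H) : form (tmul g) (tmul f) = ∏ i, ⟪f i, g i⟫_ℂ := by
  have h : form (tmul g) = innerTmul g := lift_tmul _ g
  rw [h]
  change conj (lift (prodInner g) (tmul f)) = _
  rw [lift_tmul, prodInner_conj, prodInner_apply]

theorem form_conj (x y : AlgTensorPower H n) : conj (form x y) = form y x := by
  induction x using induction with
  | hs c f =>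
    induction y using induction with
    | hs d g =>
      simp only [map_smul, map_smulₛₗ, LinearMap.smul_apply, smul_eq_mul, map_mul, form_tmul,
        map_prod, inner_conj_symm, Complex.conj_conj]
      ring
    | ha y z hy hz => simp only [map_add, LinearMap.add_apply, hy, hz]
  | ha x z hx hz => simp only [map_add, LinearMap.add_apply, hx, hz]

theorem posSemidef_prod_gram {ι : Type*} [Finite ι] (f : ι → Fin n → H) (s : Finset (Fin n)) :
    (Matrix.of fun a b : ι => ∏ i ∈ s, ⟪f a i, f b i⟫_ℂ).PosSemidef := by
  classical
  induction s using Finset.induction with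
  | empty =>
    have e : (Matrix.of fun a b : ι => ∏ i ∈ (∅ : Finset (Fin n)), ⟪f a i, f b i⟫_ℂ) =
        Matrix.gram ℂ (fun _ : ι => (1 : ℂ)) := by
      ext a b
      simp
    rw [e]
    exact Matrix.posSemidef_gram ℂ _
  | insert i s hi ih =>
    have e : (Matrix.of fun a b : ι => ∏ i ∈ insert i s, ⟪f a i, f b i⟫_ℂ) =
        (Matrix.gram ℂ (fun a : ι => f a i)).hadamard
          (Matrix.of fun a b : ι => ∏ i ∈ s, ⟪f a i, f b i⟫_ℂ) := by
      ext a b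
      simp [Finset.prod_insert hi]
    rw [e]
    exact (Matrix.posSemidef_gram ℂ (fun a : ι => f a i)).hadamard ih

theorem form_nonneg (x : AlgTensorPower H n) : 0 ≤ (form x x).re := by
  have hx : x ∈ Submodule.span ℂ (Set.range (tmul : (Fin n → H) → AlgTensorPower H n)) := by
    rw [span_tmul]; trivial
  obtain ⟨c, rfl⟩ := (Finsupp.mem_span_range_iff_exists_finsupp).1 hx
  have h := (posSemidef_prod_gram (fun a : c.support => (a : Fin n → H))
    Finset.univ).dotProduct_mulVec_nonneg (fun a => c a)
  have e : form (c.sum fun i a => a • tmul i) (c.sum fun i a => a • tmul i) =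
      star (fun a : c.support => c a) ⬝ᵥ
        (Matrix.of fun a b : c.support => ∏ i, ⟪(a : Fin n → H) i, (b : Fin n → H) i⟫_ℂ).mulVec
          (fun a => c a) := by
    simp only [Finsupp.sum, map_sum, LinearMap.sum_apply, map_smul, map_smulₛₗ,
      LinearMap.smul_apply, form_tmul, dotProduct, Matrix.mulVec, Matrix.of_apply]
    rw [← Finset.sum_coe_sort c.support]
    refine Finset.sum_congr rfl fun a _ => ?_
    rw [← Finset.sum_coe_sort c.support]
    simp only [smul_eq_mul, Pi.star_apply, RCLike.star_def]
    congr 1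
    exact Finset.sum_congr rfl fun b _ => mul_comm _ _
  rw [e]
  exact (Complex.le_def.1 h).1

/-- The inner product on the algebraic tensor power. -/
abbrev core (n : ℕ) : PreInnerProductSpace.Core ℂ (AlgTensorPower H n) where
  inner x y := form y x
  conj_inner_symm x y := form_conj x y
  re_inner_nonneg x := form_nonneg x
  add_left x y z := by simp
  smul_left x y r := by simp

instance (n : ℕ) : SeminormedAddCommGroup (AlgTensorPower H n) :=
  InnerProductSpace.Core.toSeminormedAddCommGroup (𝕜 := ℂ) (c := core n)

instance (n : ℕ) : InnerProductSpace ℂ (AlgTensorPower H n) :=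
  InnerProductSpace.ofCore (core n)

theorem inner_tmul (f g : Fin n → H) : ⟪tmul f, tmul g⟫_ℂ = ∏ i, ⟪f i, g i⟫_ℂ :=
  form_tmul f g

/-- The permutation of the factors, `f ↦ f ∘ σ` on elementary tensors. -/
def permₗ (σ : Equiv.Perm (Fin n)) : AlgTensorPower H n →ₗ[ℂ] AlgTensorPower H n :=
  lift (tmul.domDomCongr σ)

theorem permₗ_tmul (σ : Equiv.Perm (Fin n)) (f : Fin n → H) :
    permₗ σ (tmul f) = tmul (fun i => f (σ i)) := by
  simp [permₗ, lift_tmul]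

theorem inner_permₗ (σ : Equiv.Perm (Fin n)) (x y : AlgTensorPower H n) :
    ⟪permₗ σ x, permₗ σ y⟫_ℂ = ⟪x, y⟫_ℂ := by
  induction x using induction with
  | hs c f =>
    induction y using induction with
    | hs d g =>
      simp only [map_smul, inner_smul_left, inner_smul_right, permₗ_tmul, inner_tmul]
      rw [Equiv.prod_comp σ (fun i => ⟪f i, g i⟫_ℂ)]
    | ha y z hy hz => simp only [map_add, inner_add_right, hy, hz]
  | ha x z hx hz => simp only [map_add, inner_add_left, hx, hz]

/-- The permutation of the factors as an isometry. -/
def perm (σ : Equiv.Perm (Fin n)) : AlgTensorPower H n →ₗᵢ[ℂ] AlgTensorPower H n :=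
  { permₗ σ with
    norm_map' := fun x => by
      have h := inner_permₗ σ x x
      rw [inner_self_eq_norm_sq_to_K, inner_self_eq_norm_sq_to_K] at h
      have h' : ‖permₗ σ x‖ ^ 2 = ‖x‖ ^ 2 := by exact_mod_cast h
      exact (sq_eq_sq₀ (norm_nonneg _) (norm_nonneg _)).1 h' }

end AlgTensorPower

/-- The Hilbert space tensor power `H ⊗ ⋯ ⊗ H` (`n` factors): the completion of the algebraic one. -/
def TensorPower (n : ℕ) : Type _ := UniformSpace.Completion (AlgTensorPower H n)

instance (n : ℕ) : NormedAddCommGroup (TensorPower H n) :=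
  inferInstanceAs (NormedAddCommGroup (UniformSpace.Completion (AlgTensorPower H n)))

instance (n : ℕ) : InnerProductSpace ℂ (TensorPower H n) :=
  inferInstanceAs (InnerProductSpace ℂ (UniformSpace.Completion (AlgTensorPower H n)))

instance (n : ℕ) : CompleteSpace (TensorPower H n) :=
  inferInstanceAs (CompleteSpace (UniformSpace.Completion (AlgTensorPower H n)))

namespace TensorPower

variable {H} {n : ℕ}

/-- The canonical map of the algebraic tensor power into its completion. -/
def ofAlg : AlgTensorPower H n →ₗᵢ[ℂ] TensorPower H n :=
  UniformSpace.Completion.toComplₗᵢ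

theorem denseRange_ofAlg : DenseRange (ofAlg : AlgTensorPower H n → TensorPower H n) :=
  UniformSpace.Completion.denseRange_coe

/-- The action of a permutation of the factors on the Hilbert space tensor power. -/
def perm (σ : Equiv.Perm (Fin n)) : TensorPower H n →L[ℂ] TensorPower H n :=
  (AlgTensorPower.perm σ).toContinuousLinearMap.completion

theorem perm_ofAlg (σ : Equiv.Perm (Fin n)) (x : AlgTensorPower H n) :
    perm σ (ofAlg x) = ofAlg (AlgTensorPower.perm σ x) :=
  ContinuousLinearMap.completion_apply_coe _ x

/-- The elementary tensor `f 0 ⊗ ⋯ ⊗ f (n - 1)`. -/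
def tmul (f : Fin n → H) : TensorPower H n := ofAlg (AlgTensorPower.tmul f)

theorem inner_tmul (f g : Fin n → H) : ⟪tmul f, tmul g⟫_ℂ = ∏ i, ⟪f i, g i⟫_ℂ := by
  rw [tmul, tmul, LinearIsometry.inner_map_map, AlgTensorPower.inner_tmul]

theorem perm_tmul (σ : Equiv.Perm (Fin n)) (f : Fin n → H) :
    perm σ (tmul f) = tmul (fun i => f (σ i)) := by
  rw [tmul, perm_ofAlg]
  exact congrArg ofAlg (AlgTensorPower.permₗ_tmul σ f)

theorem inner_perm (σ : Equiv.Perm (Fin n)) (x y : TensorPower H n) :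
    ⟪perm σ x, perm σ y⟫_ℂ = ⟪x, y⟫_ℂ := by
  refine denseRange_ofAlg.induction_on₂ (p := fun x y => ⟪perm σ x, perm σ y⟫_ℂ = ⟪x, y⟫_ℂ)
    (isClosed_eq (by fun_prop) (by fun_prop)) (fun a b => ?_) x y
  rw [perm_ofAlg, perm_ofAlg, LinearIsometry.inner_map_map, LinearIsometry.inner_map_map,
    LinearIsometry.inner_map_map]

end TensorPower

/-- The symmetric part of the tensor power: the vectors that are fixed by all permutations of the
factors. -/
def symSubmodule (n : ℕ) : Submodule ℂ (TensorPower H n) where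
  carrier := {x | ∀ σ : Equiv.Perm (Fin n), TensorPower.perm σ x = x}
  add_mem' hx hy σ := by rw [map_add, hx σ, hy σ]
  zero_mem' σ := map_zero _
  smul_mem' c x hx σ := by rw [map_smul, hx σ]

/-- The `n`-particle space: the symmetric part of the `n`-fold tensor power of `H`. -/
def NParticle (n : ℕ) : Type _ := symSubmodule H n

instance (n : ℕ) : NormedAddCommGroup (NParticle H n) :=
  inferInstanceAs (NormedAddCommGroup (symSubmodule H n))

instance (n : ℕ) : InnerProductSpace ℂ (NParticle H n) :=
  inferInstanceAs (InnerProductSpace ℂ (symSubmodule H n))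

instance (n : ℕ) : CompleteSpace (NParticle H n) := by
  have h : IsClosed (symSubmodule H n : Set (TensorPower H n)) := by
    have : (symSubmodule H n : Set (TensorPower H n)) =
        ⋂ σ : Equiv.Perm (Fin n), {x | TensorPower.perm σ x = x} := by
      ext x; simp [symSubmodule]
    rw [this]
    exact isClosed_iInter fun σ => isClosed_eq (TensorPower.perm σ).continuous continuous_id
  exact h.completeSpace_coe

namespace NParticle

variable {H} {n : ℕ}

/-- The inclusion of the symmetric part into the full tensor power. -/
def incl : NParticle H n →ₗᵢ[ℂ] TensorPower H n := (symSubmodule H n).subtypeₗᵢ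

theorem perm_incl (σ : Equiv.Perm (Fin n)) (x : NParticle H n) :
    TensorPower.perm σ (incl x) = incl x := x.2 σ

/-- The vector `f^{⊗ n} = f ⊗ ⋯ ⊗ f`. -/
def diag (n : ℕ) (f : H) : NParticle H n :=
  ⟨TensorPower.tmul fun _ => f, fun σ => TensorPower.perm_tmul σ _⟩

theorem incl_diag (f : H) : incl (diag n f) = TensorPower.tmul fun _ => f := rfl

theorem inner_diag (n : ℕ) (f g : H) : ⟪diag n f, diag n g⟫_ℂ = ⟪f, g⟫_ℂ ^ n := by
  rw [← incl.inner_map_map, incl_diag, incl_diag, TensorPower.inner_tmul]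
  simp

theorem norm_diag_sq (n : ℕ) (f : H) : ‖diag n f‖ ^ 2 = (‖f‖ ^ 2) ^ n := by
  have h := inner_diag n f f
  rw [inner_self_eq_norm_sq_to_K, inner_self_eq_norm_sq_to_K] at h
  exact_mod_cast h

end NParticle

end TensorPower


/-! ### The symmetric Fock space -/

section Fock

/-- The symmetric (boson) Fock space over `H`: the Hilbert space direct sum of the symmetric parts
of the Hilbert space tensor powers `H^{⊗ n}`, `n ≥ 0` (for `n = 0` this is `ℂ`). -/
abbrev FockSpace (H : Type*) [NormedAddCommGroup H] [InnerProductSpace ℂ H] : Type _ :=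
  lp (fun n : ℕ => NParticle H n) 2

variable {H : Type*} [NormedAddCommGroup H] [InnerProductSpace ℂ H]

theorem norm_expCoeff_sq (n : ℕ) (f : H) :
    ‖(((Real.sqrt (n.factorial : ℝ))⁻¹ : ℝ) : ℂ) • NParticle.diag n f‖ ^ 2 =
      (‖f‖ ^ 2) ^ n / n.factorial := by
  rw [norm_smul, mul_pow, NParticle.norm_diag_sq, Complex.norm_real, Real.norm_eq_abs, sq_abs, inv_pow,
    Real.sq_sqrt (by positivity)]
  ring

/-- The exponential vector `E(f) = (1, f, f ⊗ f / √2!, …, f^{⊗ n} / √n!, …)`. -/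
def expVec (f : H) : FockSpace H :=
  ⟨fun n => (((Real.sqrt (n.factorial : ℝ))⁻¹ : ℝ) : ℂ) • NParticle.diag n f, by
    refine memℓp_gen ?_
    have h : Summable fun n : ℕ => (‖f‖ ^ 2) ^ n / n.factorial := Real.summable_pow_div_factorial _
    refine h.congr fun n => ?_
    rw [← norm_expCoeff_sq]
    simp⟩

theorem expVec_apply (f : H) (n : ℕ) :
    expVec f n = (((Real.sqrt (n.factorial : ℝ))⁻¹ : ℝ) : ℂ) • NParticle.diag n f := rfl

theorem inner_expVec (g f : H) : ⟪expVec g, expVec f⟫_ℂ = Complex.exp ⟪g, f⟫_ℂ := by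
  have h := lp.hasSum_inner (𝕜 := ℂ) (expVec g) (expVec f)
  refine h.unique ?_
  have h2 := NormedSpace.expSeries_div_hasSum_exp (𝔸 := ℂ) ⟪g, f⟫_ℂ
  rw [← Complex.exp_eq_exp_ℂ] at h2
  convert h2 using 1
  ext n
  rw [expVec_apply, expVec_apply, inner_smul_left, inner_smul_right, NParticle.inner_diag,
    Complex.conj_ofReal, ← mul_assoc, ← Complex.ofReal_mul, ← mul_inv,
    Real.mul_self_sqrt (by positivity)]
  push_cast
  ring

/-- The additive character `g ↦ exp ⟪f, g⟫` of `H`. -/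
def expChar (f : H) : Multiplicative H →* ℂ where
  toFun g := Complex.exp ⟪f, g.toAdd⟫_ℂ
  map_one' := by simp
  map_mul' a b := by rw [toAdd_mul, inner_add_right, Complex.exp_add]

theorem expChar_injective : Function.Injective (expChar : H → Multiplicative H →* ℂ) := by
  intro f f' h
  by_contra hne
  have h1 : ∀ g : H, Complex.exp ⟪f - f', g⟫_ℂ = 1 := fun g => by
    have := DFunLike.congr_fun h (Multiplicative.ofAdd g)
    change Complex.exp ⟪f, g⟫_ℂ = Complex.exp ⟪f', g⟫_ℂ at this
    rw [inner_sub_left, Complex.exp_sub, this, div_self (Complex.exp_ne_zero _)]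
  have hpos : 0 < ‖f - f'‖ ^ 2 := by
    have := norm_pos_iff.2 (sub_ne_zero.2 hne)
    positivity
  have h2 := h1 ((((‖f - f'‖ ^ 2)⁻¹ : ℝ) : ℂ) • (f - f'))
  rw [inner_smul_right, inner_self_eq_norm_sq_to_K] at h2
  have h3 : (((‖f - f'‖ ^ 2)⁻¹ : ℝ) : ℂ) * ((‖f - f'‖ : ℝ) : ℂ) ^ 2 = ((1 : ℝ) : ℂ) := by
    rw [← Complex.ofReal_pow, ← Complex.ofReal_mul, inv_mul_cancel₀ hpos.ne']
  erw [h3] at h2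
  rw [← Complex.ofReal_exp] at h2
  have h4 : Real.exp 1 = 1 := by exact_mod_cast h2
  have := Real.add_one_lt_exp (one_ne_zero (α := ℝ))
  linarith

theorem linearIndependent_expVec : LinearIndependent ℂ (expVec : H → FockSpace H) := by
  have h := (linearIndependent_monoidHom (Multiplicative H) ℂ).comp
    (fun f : H => (expChar f)) expChar_injective
  rw [linearIndependent_iff'] at h ⊢
  intro s c hc f hf
  have key : ∑ i ∈ s, conj (c i) • (expChar i : Multiplicative H → ℂ) = 0 := by
    ext g
    have h1 : ⟪∑ i ∈ s, c i • expVec i, expVec g.toAdd⟫_ℂ = 0 := by rw [hc, inner_zero_left]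
    rw [sum_inner (𝕜 := ℂ)] at h1
    simp only [inner_smul_left, inner_expVec] at h1
    simpa [expChar] using h1
  have := h s (fun i => conj (c i)) key f hf
  simpa using this


/-- The continuous multilinear form `h ↦ ⟪x, h 0 ⊗ ⋯ ⊗ h (n - 1)⟫`. -/
def innerTmulForm {n : ℕ} (x : TensorPower H n) :
    ContinuousMultilinearMap ℂ (fun _ : Fin n => H) ℂ :=
  MultilinearMap.mkContinuous
    { toFun := fun h => ⟪x, TensorPower.tmul h⟫_ℂ
      map_update_add' := fun f i a b => by
        simp only [TensorPower.tmul, MultilinearMap.map_update_add, map_add, inner_add_right]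
      map_update_smul' := fun f i c a => by
        simp only [TensorPower.tmul, MultilinearMap.map_update_smul, map_smul, inner_smul_right,
          smul_eq_mul] }
    ‖x‖ fun h => by
      refine (norm_inner_le_norm (𝕜 := ℂ) x (TensorPower.tmul h)).trans (le_of_eq ?_)
      congr 1
      have h1 := TensorPower.inner_tmul h h
      simp only [inner_self_eq_norm_sq_to_K] at h1
      have h2 : ‖TensorPower.tmul h‖ ^ 2 = (∏ i, ‖h i‖) ^ 2 := by
        rw [← Finset.prod_pow]
        exact_mod_cast h1
      exact (sq_eq_sq₀ (norm_nonneg _) (Finset.prod_nonneg fun i _ => norm_nonneg _)).1 h2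

theorem innerTmulForm_apply {n : ℕ} (x : TensorPower H n) (h : Fin n → H) :
    innerTmulForm x h = ⟪x, TensorPower.tmul h⟫_ℂ := rfl

theorem NParticle.eq_zero_of_inner_diag {n : ℕ} (x : NParticle H n)
    (hx : ∀ f : H, ⟪x, NParticle.diag n f⟫_ℂ = 0) : x = 0 := by
  have hd : (fun f : H => innerTmulForm (NParticle.incl x) (fun _ => f)) = fun _ => 0 := by
    ext f
    rw [innerTmulForm_apply, ← NParticle.incl_diag, LinearIsometry.inner_map_map]
    exact hx f
  have hall : ∀ h : Fin n → H, ⟪NParticle.incl x, TensorPower.tmul h⟫_ℂ = 0 := by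
    intro h
    have h1 := (innerTmulForm (NParticle.incl x)).iteratedFDeriv_comp_diagonal 0 h
    rw [hd] at h1
    have h2 : ∀ σ : Equiv.Perm (Fin n), innerTmulForm (NParticle.incl x) (fun i => h (σ i)) =
        ⟪NParticle.incl x, TensorPower.tmul h⟫_ℂ := by
      intro σ
      rw [innerTmulForm_apply, ← TensorPower.perm_tmul, ← TensorPower.inner_perm σ _
        (TensorPower.tmul h), NParticle.perm_incl]
    have h3 : iteratedFDeriv ℂ n (fun _ : H => (0 : ℂ)) 0 = 0 := by
      rw [iteratedFDeriv_fun_zero]; rfl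
    simp only [h2, h3, zero_apply, Finset.sum_const, Finset.card_univ, nsmul_eq_mul] at h1
    rcases mul_eq_zero.1 h1.symm with h4 | h4
    · exact absurd h4 (by exact_mod_cast Fintype.card_ne_zero)
    · exact h4
  have hz : NParticle.incl x = 0 := by
    refine (TensorPower.denseRange_ofAlg (H := H) (n := n)).eq_zero_of_inner_left (𝕜 := ℂ)
      fun a => ?_
    induction a using AlgTensorPower.induction with
    | hs c f => rw [map_smul, inner_smul_right]; exact mul_eq_zero_of_right _ (hall f)
    | ha a b ha hb => rw [map_add, inner_add_right, ha, hb, add_zero]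
  exact NParticle.incl.injective (by rw [hz, map_zero])

theorem expVec_eq_zero_of_inner (x : FockSpace H) (hx : ∀ f : H, ⟪x, expVec f⟫_ℂ = 0) : x = 0 := by
  have hdiag : ∀ (m : ℕ) (z : ℂ) (f : H),
      ⟪x m, expVec (z • f) m⟫_ℂ = z ^ m * ⟪x m, expVec f m⟫_ℂ := by
    intro m z f
    have h1 : NParticle.diag m (z • f) = z ^ m • NParticle.diag m f := by
      apply NParticle.incl.injective
      rw [map_smul, NParticle.incl_diag, NParticle.incl_diag, TensorPower.tmul, TensorPower.tmul,
        ← map_smul]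
      congr 1
      have := (AlgTensorPower.tmul (H := H) (n := m)).map_smul_univ (fun _ => z) (fun _ => f)
      simpa using this
    rw [expVec_apply, expVec_apply, h1, smul_comm, inner_smul_right]
  have key : ∀ (n : ℕ) (f : H), ⟪x n, NParticle.diag n f⟫_ℂ = 0 := by
    intro n f
    have hs : ∀ z : ℂ, HasSum (fun m : ℕ => z ^ m • ⟪x m, expVec f m⟫_ℂ) 0 := by
      intro z
      have h := lp.hasSum_inner (𝕜 := ℂ) x (expVec (z • f))
      rw [hx] at h
      simpa only [hdiag, smul_eq_mul] using h
    have hp : HasFPowerSeriesAt (0 : ℂ → ℂ)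
        (FormalMultilinearSeries.ofScalars ℂ fun m => ⟪x m, expVec f m⟫_ℂ) 0 := by
      rw [hasFPowerSeriesAt_iff]
      refine Filter.Eventually.of_forall fun z => ?_
      simpa using hs z
    have h0 := congrFun ((FormalMultilinearSeries.ofScalars_series_eq_zero ℂ).1 hp.eq_zero) n
    simp only [expVec_apply, inner_smul_right, Pi.zero_apply] at h0
    refine (mul_eq_zero.1 h0).resolve_left ?_
    exact Complex.ofReal_ne_zero.2 (by positivity)
  ext n : 2
  exact NParticle.eq_zero_of_inner_diag _ fun f => key n f

theorem dense_span_expVec :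
    Dense (Submodule.span ℂ (Set.range (expVec : H → FockSpace H)) : Set (FockSpace H)) := by
  rw [Submodule.dense_iff_topologicalClosure_eq_top, Submodule.topologicalClosure_eq_top_iff,
    Submodule.eq_bot_iff]
  intro x hx
  refine expVec_eq_zero_of_inner x fun f => ?_
  exact (Submodule.mem_orthogonal' _ _).1 hx _ (Submodule.subset_span ⟨f, rfl⟩)

end Fock

/-! ### Isometries given on total families -/

section Gram

variable {ι E F : Type*} [NormedAddCommGroup E] [InnerProductSpace ℂ E]
  [NormedAddCommGroup F] [InnerProductSpace ℂ F]

theorem norm_linearCombination_eq {v : ι → E} {w : ι → F}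
    (h : ∀ i j, ⟪w i, w j⟫_ℂ = ⟪v i, v j⟫_ℂ) (c : ι →₀ ℂ) :
    ‖Finsupp.linearCombination ℂ w c‖ = ‖Finsupp.linearCombination ℂ v c‖ := by
  have h1 : ⟪Finsupp.linearCombination ℂ w c, Finsupp.linearCombination ℂ w c⟫_ℂ =
      ⟪Finsupp.linearCombination ℂ v c, Finsupp.linearCombination ℂ v c⟫_ℂ := by
    simp only [Finsupp.linearCombination_apply, Finsupp.sum, sum_inner, inner_sum, inner_smul_left,
      inner_smul_right, h]
  rw [inner_self_eq_norm_sq_to_K, inner_self_eq_norm_sq_to_K] at h1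
  have h2 : ‖Finsupp.linearCombination ℂ w c‖ ^ 2 = ‖Finsupp.linearCombination ℂ v c‖ ^ 2 := by
    exact_mod_cast h1
  exact (sq_eq_sq₀ (norm_nonneg _) (norm_nonneg _)).1 h2

theorem denseRange_linearCombination {v : ι → E}
    (hv : Dense (Submodule.span ℂ (Set.range v) : Set E)) :
    DenseRange (Finsupp.linearCombination ℂ v) := by
  rw [DenseRange, ← LinearMap.coe_range, Finsupp.range_linearCombination]
  exact hv

/-- The linear isometry that maps `v i` to `w i`, where `v` is total and has the same inner products
as `w`. -/
def gramIsometry [CompleteSpace F] (v : ι → E) (w : ι → F)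
    (hv : Dense (Submodule.span ℂ (Set.range v) : Set E))
    (h : ∀ i j, ⟪w i, w j⟫_ℂ = ⟪v i, v j⟫_ℂ) : E →ₗᵢ[ℂ] F where
  toLinearMap := ((Finsupp.linearCombination ℂ w).extendOfNorm
    (Finsupp.linearCombination ℂ v)).toLinearMap
  norm_map' := by
    refine (denseRange_linearCombination hv).induction ?_
      (isClosed_eq (by simp only [ContinuousLinearMap.coe_coe]; fun_prop) continuous_norm)
    rintro _ ⟨c, rfl⟩
    rw [ContinuousLinearMap.coe_coe, LinearMap.extendOfNorm_eq (denseRange_linearCombination hv)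
      ⟨1, fun c => by rw [norm_linearCombination_eq h, one_mul]⟩]
    exact norm_linearCombination_eq h c

theorem gramIsometry_apply [CompleteSpace F] (v : ι → E) (w : ι → F)
    (hv : Dense (Submodule.span ℂ (Set.range v) : Set E))
    (h : ∀ i j, ⟪w i, w j⟫_ℂ = ⟪v i, v j⟫_ℂ) (i : ι) : gramIsometry v w hv h (v i) = w i := by
  have h1 := LinearMap.extendOfNorm_eq (f := Finsupp.linearCombination ℂ w)
    (denseRange_linearCombination hv)
    ⟨1, fun c => by rw [norm_linearCombination_eq h, one_mul]⟩ (Finsupp.single i 1)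
  simp only [Finsupp.linearCombination_single, one_smul] at h1
  exact h1

/-- The unitary operator that maps `v i` to `w i`, where `v` and `w` are total and have the same
inner products. -/
def gramUnitary [CompleteSpace E] [CompleteSpace F] (v : ι → E) (w : ι → F)
    (hv : Dense (Submodule.span ℂ (Set.range v) : Set E))
    (hw : Dense (Submodule.span ℂ (Set.range w) : Set F))
    (h : ∀ i j, ⟪w i, w j⟫_ℂ = ⟪v i, v j⟫_ℂ) : E ≃ₗᵢ[ℂ] F :=
  (LinearEquiv.refl ℂ (ι →₀ ℂ)).extendOfIsometry (Finsupp.linearCombination ℂ v)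
    (Finsupp.linearCombination ℂ w) (denseRange_linearCombination hv)
    (denseRange_linearCombination hw) (norm_linearCombination_eq h)

theorem gramUnitary_apply [CompleteSpace E] [CompleteSpace F] (v : ι → E) (w : ι → F)
    (hv : Dense (Submodule.span ℂ (Set.range v) : Set E))
    (hw : Dense (Submodule.span ℂ (Set.range w) : Set F))
    (h : ∀ i j, ⟪w i, w j⟫_ℂ = ⟪v i, v j⟫_ℂ) (i : ι) : gramUnitary v w hv hw h (v i) = w i := by
  have h1 := LinearEquiv.extendOfIsometry_eq (LinearEquiv.refl ℂ (ι →₀ ℂ))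
    (Finsupp.linearCombination ℂ v) (Finsupp.linearCombination ℂ w)
    (denseRange_linearCombination hv) (denseRange_linearCombination hw)
    (norm_linearCombination_eq h) (Finsupp.single i 1)
  simp only [LinearEquiv.refl_apply, Finsupp.linearCombination_single, one_smul] at h1
  exact h1

end Gram

/-! ### Weyl, annihilation and creation operators -/

section Operators

variable {H : Type*} [NormedAddCommGroup H] [InnerProductSpace ℂ H]

/-- The vector `exp (-‖g‖² / 2 - ⟪g, V f⟫) E(V f + g)`. -/
def weylVec (g : H) (V : H ≃ₗᵢ[ℂ] H) (f : H) : FockSpace H :=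
  Complex.exp (-(1 / 2) * (‖g‖ : ℂ) ^ 2 - ⟪g, V f⟫_ℂ) • expVec (V f + g)

theorem inner_weylVec (g : H) (V : H ≃ₗᵢ[ℂ] H) (f f' : H) :
    ⟪weylVec g V f, weylVec g V f'⟫_ℂ = ⟪expVec f, expVec f'⟫_ℂ := by
  rw [weylVec, weylVec, inner_smul_left, inner_smul_right, inner_expVec, inner_expVec,
    ← Complex.exp_conj, ← Complex.exp_add, ← Complex.exp_add]
  congr 1
  simp only [map_sub, map_mul, map_neg, map_pow, map_div₀, map_one, map_ofNat, Complex.conj_ofReal,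
    inner_conj_symm, inner_add_left, inner_add_right, LinearIsometryEquiv.inner_map_map,
    inner_self_eq_norm_sq_to_K (𝕜 := ℂ) g]
  simp only [RCLike.ofReal_eq_complex_ofReal]
  ring

theorem dense_span_weylVec (g : H) (V : H ≃ₗᵢ[ℂ] H) :
    Dense (Submodule.span ℂ (Set.range (weylVec g V)) : Set (FockSpace H)) := by
  refine dense_span_expVec.mono (Submodule.span_le.2 ?_)
  rintro _ ⟨f, rfl⟩
  have h : expVec f = (Complex.exp (-(1 / 2) * (‖g‖ : ℂ) ^ 2 - ⟪g, V (V.symm (f - g))⟫_ℂ))⁻¹ •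
      weylVec g V (V.symm (f - g)) := by
    rw [weylVec, inv_smul_smul₀ (Complex.exp_ne_zero _)]
    simp
  rw [h]
  exact Submodule.smul_mem _ _ (Submodule.subset_span ⟨_, rfl⟩)

/-- The Weyl operator `𝒲(g; V)`: the unitary operator with
`𝒲(g; V) E(f) = exp (-‖g‖² / 2 - ⟪g, V f⟫) E(V f + g)` for all `f`. -/
def weyl (g : H) (V : H ≃ₗᵢ[ℂ] H) : FockSpace H ≃ₗᵢ[ℂ] FockSpace H :=
  gramUnitary expVec (weylVec g V) dense_span_expVec (dense_span_weylVec g V) (inner_weylVec g V)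

theorem weyl_expVec (g : H) (V : H ≃ₗᵢ[ℂ] H) (f : H) :
    weyl g V (expVec f) =
      Complex.exp (-(1 / 2) * (‖g‖ : ℂ) ^ 2 - ⟪g, V f⟫_ℂ) • expVec (V f + g) :=
  gramUnitary_apply _ _ _ _ _ f

/-- The operator with domain the linear span of the exponential vectors that maps `E(f)` to `φ f`.
(The exponential vectors are linearly independent.) -/
def onExpVec (φ : H → FockSpace H) : FockSpace H →ₗ.[ℂ] FockSpace H where
  domain := Submodule.span ℂ (Set.range expVec)
  toFun := (Module.Basis.span linearIndependent_expVec).constr ℂ φ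

theorem onExpVec_apply (φ : H → FockSpace H) (f : H) :
    onExpVec φ ⟨expVec f, Submodule.subset_span ⟨f, rfl⟩⟩ = φ f := by
  have h : (⟨expVec f, Submodule.subset_span ⟨f, rfl⟩⟩ :
      Submodule.span ℂ (Set.range (expVec : H → FockSpace H))) =
      Module.Basis.span linearIndependent_expVec f := by
    ext1
    rw [Module.Basis.span_apply]
  exact (congrArg ((Module.Basis.span linearIndependent_expVec).constr ℂ φ) h).trans
    (Module.Basis.constr_basis _ _ _ _)

/-- The annihilation operator `a(g)`, on the linear span of the exponential vectors:
`a(g) E(f) = ⟪g, f⟫ E(f)`. -/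
def annihilation (g : H) : FockSpace H →ₗ.[ℂ] FockSpace H :=
  onExpVec fun f => ⟪g, f⟫_ℂ • expVec f

/-- The creation operator `a†(g)`, on the linear span of the exponential vectors:
`a†(g) E(f) = d/dε E(f + ε g)` at `ε = 0`. -/
def creation (g : H) : FockSpace H →ₗ.[ℂ] FockSpace H :=
  onExpVec fun f => deriv (fun ε : ℝ => expVec (f + (ε : ℂ) • g)) 0

/-- The closure of `a(g) + a†(g)`, i.e. the selfadjoint extension of this essentially selfadjoint
operator. -/
def fieldOp (g : H) : FockSpace H →ₗ.[ℂ] FockSpace H :=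
  (annihilation g + creation g).closure

end Operators

/-! ### Wiener space -/

section Wiener

/-- The path space `Ω`: the functions `ω : ℝ₊ → ℝ^ℕ`, `ω t = (ω₀ t, ω₁ t, …)`, with continuous
coordinates that vanish at `0`. -/
def WienerPath : Type := {ω : ℝ≥0 → ℕ → ℝ // ∀ j, ω 0 j = 0 ∧ Continuous fun t => ω t j}

/-- The canonical projections `W j t ω = ω_j(t)`. -/
def W (j : ℕ) (t : ℝ≥0) (ω : WienerPath) : ℝ := ω.1 t j

/-- The σ-algebra generated by all canonical projections. -/
instance : MeasurableSpace WienerPath :=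
  ⨆ (j : ℕ) (t : ℝ≥0), MeasurableSpace.comap (W j t) inferInstance

/-- The σ-algebra `𝓕_t` generated by the projections `W j s`, `s ∈ [0, t]`. -/
abbrev sigmaAlg (t : ℝ≥0) : MeasurableSpace WienerPath :=
  ⨆ (j : ℕ) (s : Set.Iic t), MeasurableSpace.comap (W j s) inferInstance

/-- `P` is the Wiener measure on the path space: the canonical projections are independent standard
Brownian motions. -/
structure IsWienerMeasure (P : Measure WienerPath) : Prop where
  brownian : ∀ j, IsBrownianReal (W j) P
  indep : iIndepFun (fun j ω (t : ℝ≥0) => W j t ω) P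

/-- Wiener space `L²(Ω, 𝓕, P)` (complex valued). -/
abbrev WienerSpace (P : Measure WienerPath) : Type := Lp ℂ 2 P

theorem IsWienerMeasure.isProbabilityMeasure {P : Measure WienerPath} (hP : IsWienerMeasure P) :
    IsProbabilityMeasure P :=
  ((hP.brownian 0).hasLaw_eval 0).isProbabilityMeasure

theorem memLp_W {P : Measure WienerPath} (hP : IsWienerMeasure P) (j : ℕ) (t : ℝ≥0) : MemLp (fun ω => (W j t ω : ℂ)) 2 P :=
  ((hP.brownian j).hasLaw_eval t).hasGaussianLaw.memLp_two.ofReal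

variable {P : Measure WienerPath} (hP : IsWienerMeasure P)

/-- `W j t` as an element of Wiener space. -/
def wienerVec (j : ℕ) (t : ℝ≥0) : WienerSpace P := (memLp_W hP j t).toLp

theorem inner_wienerVec (j : ℕ) (s t : ℝ≥0) :
    ⟪wienerVec hP j s, wienerVec hP j t⟫_ℂ = ((min s t : ℝ≥0) : ℝ) := by
  have := hP.isProbabilityMeasure
  rw [L2.inner_def]
  have h1 : ∫ ω, ⟪wienerVec hP j s ω, wienerVec hP j t ω⟫_ℂ ∂P =
      ∫ ω, ((W j s ω * W j t ω : ℝ) : ℂ) ∂P := by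
    refine integral_congr_ae ?_
    filter_upwards [(memLp_W hP j s).coeFn_toLp, (memLp_W hP j t).coeFn_toLp] with ω h2 h3
    rw [wienerVec, wienerVec, h2, h3]
    simp [mul_comm]
  have h2 := (hP.brownian j).covariance_eval s t
  rw [covariance_eq_sub ((hP.brownian j).hasLaw_eval s).hasGaussianLaw.memLp_two
    ((hP.brownian j).hasLaw_eval t).hasGaussianLaw.memLp_two,
    (hP.brownian j).integral_eval, zero_mul, sub_zero] at h2
  rw [h1, integral_complex_ofReal]
  exact_mod_cast h2

/-- The one-particle space `L²(S; Z)` for `S ⊆ ℝ` (with Lebesgue measure). -/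
abbrev OneParticle (Z : Type*) [NormedAddCommGroup Z] (S : Set ℝ) : Type _ :=
  Lp Z 2 ((volume : Measure ℝ).restrict S)

theorem measure_Icc_ne_top (S : Set ℝ) (t : ℝ≥0) :
    (volume : Measure ℝ).restrict S (Set.Icc 0 (t : ℝ)) ≠ ∞ :=
  ((Measure.restrict_apply_le _ _).trans_lt measure_Icc_lt_top).ne

/-- The vector `χ_{[0, t]} z` of `L²(S; Z)`, for `z ∈ Z`. -/
def stepVec {Z : Type*} [NormedAddCommGroup Z] (S : Set ℝ) (t : ℝ≥0) (z : Z) : OneParticle Z S :=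
  indicatorConstLp 2 measurableSet_Icc (measure_Icc_ne_top S t) z

theorem inner_stepVec (s t : ℝ≥0) :
    ⟪stepVec (Set.Ici 0) s (1 : ℂ), stepVec (Set.Ici 0) t (1 : ℂ)⟫_ℂ =
      ((min s t : ℝ≥0) : ℝ) := by
  rw [stepVec, stepVec, L2.inner_indicatorConstLp_one_indicatorConstLp_one measurableSet_Icc measurableSet_Icc
    (measure_Icc_ne_top _ s) (measure_Icc_ne_top _ t)]
  have h : (volume : Measure ℝ).restrict (Set.Ici 0) (Set.Icc 0 (s : ℝ) ∩ Set.Icc 0 (t : ℝ)) =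
      ENNReal.ofReal (min (s : ℝ) t) := by
    rw [Measure.restrict_apply (measurableSet_Icc.inter measurableSet_Icc), Set.Icc_inter_Icc,
      Set.inter_eq_left.2 (fun x hx => by simpa using hx.1)]
    simp
  rw [measureReal_def, h, ENNReal.toReal_ofReal (by positivity)]
  simp

theorem dense_span_stepVec :
    Dense (Submodule.span ℂ (Set.range fun t : ℝ≥0 => stepVec (Set.Ici 0) t (1 : ℂ)) :
      Set (OneParticle ℂ (Set.Ici 0))) := by
  rw [Submodule.dense_iff_topologicalClosure_eq_top, Submodule.topologicalClosure_eq_top_iff,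
    Submodule.eq_bot_iff]
  intro h hh
  have h1 : ∀ t : ℝ≥0, ∫ x in Set.Icc 0 (t : ℝ), (Set.Ici (0 : ℝ)).indicator h x = 0 := by
    intro t
    have h2 := (Submodule.mem_orthogonal _ _).1 hh _ (Submodule.subset_span ⟨t, rfl⟩)
    simp only [stepVec] at h2
    rw [L2.inner_indicatorConstLp_one] at h2
    rw [Measure.restrict_restrict measurableSet_Icc, Set.inter_eq_left.2 (fun x hx => hx.1)] at h2
    rw [← h2]
    exact setIntegral_congr_fun measurableSet_Icc fun x hx => Set.indicator_of_mem hx.1 _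
  have hloc : LocallyIntegrable ((Set.Ici (0 : ℝ)).indicator h) volume :=
    ((memLp_indicator_iff_restrict measurableSet_Ici).2 (Lp.memLp h)).locallyIntegrable (by norm_num)
  have h3 : ∀ᵐ x ∂(volume.restrict (Set.Ici (0 : ℝ))), h x = 0 := by
    rw [ae_restrict_iff' measurableSet_Ici]
    have h0 : ∀ᵐ x : ℝ, x ≠ 0 := by simp [ae_iff]
    filter_upwards [LocallyIntegrable.ae_hasDerivAt_integral hloc, h0] with x hx hx0 hx1
    have hpos : 0 < x := lt_of_le_of_ne hx1 (Ne.symm hx0)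
    have h4 := hx 0
    rw [Set.indicator_of_mem hx1] at h4
    refine h4.unique ((hasDerivAt_const x (0 : ℂ)).congr_of_eventuallyEq ?_)
    filter_upwards [lt_mem_nhds hpos] with y hy
    rw [intervalIntegral.integral_of_le hy.le, ← integral_Icc_eq_integral_Ioc]
    exact h1 ⟨y, hy.le⟩
  exact Lp.eq_zero_iff_ae_eq_zero.2 h3

/-- The Wiener integral `f ↦ ∫₀^∞ f dW_j`: the linear isometry of `L²(ℝ₊)` into Wiener space that
maps `χ_{[0, t]}` to `W_j(t)` for all `t`. -/
def wienerIntegral (j : ℕ) : OneParticle ℂ (Set.Ici 0) →ₗᵢ[ℂ] WienerSpace P :=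
  gramIsometry (fun t => stepVec (Set.Ici 0) t 1) (wienerVec hP j) dense_span_stepVec
    fun s t => by rw [inner_wienerVec, inner_stepVec]

theorem wienerIntegral_stepVec (j : ℕ) (t : ℝ≥0) :
    wienerIntegral hP j (stepVec (Set.Ici 0) t 1) = wienerVec hP j t :=
  gramIsometry_apply _ _ _ _ t

end Wiener

/-! ### Fock space over `L²(S; Z)`, stochastic exponentials, generated algebras -/

section FockSpaceOverL2

variable {Z : Type*} [NormedAddCommGroup Z] [InnerProductSpace ℂ Z] (e : HilbertBasis ℕ ℂ Z)

/-- The component `f_j = ⟪e_j, f⟫` of `f ∈ L²(S; Z)`. -/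
def coord {S : Set ℝ} (j : ℕ) (f : OneParticle Z S) : OneParticle ℂ S :=
  (innerSL ℂ (e j)).compLp f

/-- The terms of the series `∑_j ∫₀^∞ [f_j dW_j - ½ f_j² dt]`, as elements of Wiener space. -/
def expTerm {P : Measure WienerPath} (hP : IsWienerMeasure P) (f : OneParticle Z (Set.Ici 0))
    (j : ℕ) : WienerSpace P :=
  haveI := hP.isProbabilityMeasure
  wienerIntegral hP j (coord e j f) -
    Lp.const 2 P ((1 / 2) * ∫ t in Set.Ici (0 : ℝ), (⟪e j, f t⟫_ℂ) ^ 2)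

/-- The stochastic exponential `E_W(f) = exp {∑_j ∫₀^∞ [f_j dW_j - ½ f_j² dt]}`; the series
converges in Wiener space. -/
def stochExp {P : Measure WienerPath} (hP : IsWienerMeasure P) (f : OneParticle Z (Set.Ici 0))
    (ω : WienerPath) : ℂ :=
  Complex.exp ((∑' j, expTerm e hP f j : WienerSpace P) ω)

/-- The set `ℛ` of the functions `k ∈ L²_loc(ℝ₊; Z)` with real components `k_j = ⟪e_j, k⟫`
(the values on `(-∞, 0)` are irrelevant). -/
structure RealLocL2 where
  /-- The function. -/
  toFun : ℝ → Z
  memLp : ∀ t : ℝ≥0, MemLp toFun 2 (volume.restrict (Set.Icc 0 (t : ℝ)))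
  real : ∀ᵐ s ∂(volume.restrict (Set.Ici (0 : ℝ))), ∀ j, (⟪e j, toFun s⟫_ℂ).im = 0

variable {e} in
/-- The vector `χ_{[0, t]} k` of `L²(S; Z)`. -/
def RealLocL2.cut (k : RealLocL2 e) (S : Set ℝ) (t : ℝ≥0) : OneParticle Z S :=
  (((memLp_indicator_iff_restrict measurableSet_Icc).2 (k.memLp t)).mono_measure
    Measure.restrict_le_self : MemLp ((Set.Icc 0 (t : ℝ)).indicator k.toFun) 2
      (volume.restrict S)).toLp

variable {e} in
/-- The Weyl operator `𝒲_t(ik; 1) = 𝒲(i χ_{[0, t]} k; 1)` on the Fock space over `L²(S; Z)`. -/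
def weylAt (S : Set ℝ) (k : RealLocL2 e) (t : ℝ≥0) :
    FockSpace (OneParticle Z S) ≃ₗᵢ[ℂ] FockSpace (OneParticle Z S) :=
  weyl (Complex.I • k.cut S t) (LinearIsometryEquiv.refl ℂ _)

/-- The von Neumann algebra `ℳ(t)` generated by the operators `𝒲_t(ik; 1)`, `k ∈ ℛ` (double
commutant), on the Fock space over `L²(S; Z)`. -/
def weylAlgebra (S : Set ℝ) (t : ℝ≥0) :
    Set (FockSpace (OneParticle Z S) →L[ℂ] FockSpace (OneParticle Z S)) :=
  Set.centralizer (Set.centralizer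
    {T | ∃ k : RealLocL2 e, T = (weylAt S k t).toContinuousLinearEquiv.toContinuousLinearMap})

/-- The operator `A_j(t) + A_j†(t)`, with `A_j(t) = a(χ_{[0, t]} e_j)` and
`A_j†(t) = a†(χ_{[0, t]} e_j)` (selfadjoint extension), on the Fock space over `L²(S; Z)`. -/
def quadrature (S : Set ℝ) (j : ℕ) (t : ℝ≥0) :
    FockSpace (OneParticle Z S) →ₗ.[ℂ] FockSpace (OneParticle Z S) :=
  fieldOp (stepVec S t (e j))

/-- The restriction map `L²(ℝ; Z) → L²(S; Z)`. -/
def restrictTo (S : Set ℝ) (f : OneParticle Z Set.univ) : OneParticle Z S :=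
  ((Lp.memLp f).mono_measure (Measure.restrict_mono (Set.subset_univ S) le_rfl)).toLp

/-- The operator `T` on the Fock space `Γ` over `L²(ℝ; Z)` is `1 ⊗ B` in the factorization
`Γ = Γ_{-∞}^0 ⊗ Γ_0`, `E(f) = E(f|₍₋∞,₀₎) ⊗ E(f|₍₀,∞₎)`, where `Γ_{-∞}^0` and `Γ_0` are the Fock
spaces over `L²((-∞, 0); Z)` and `L²(ℝ₊; Z)`. -/
def IsAmpliation
    (B : FockSpace (OneParticle Z (Set.Ici 0)) →L[ℂ] FockSpace (OneParticle Z (Set.Ici 0)))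
    (T : FockSpace (OneParticle Z Set.univ) →L[ℂ] FockSpace (OneParticle Z Set.univ)) : Prop :=
  ∀ g f : OneParticle Z Set.univ,
    ⟪expVec g, T (expVec f)⟫_ℂ =
      ⟪expVec (restrictTo (Set.Iio 0) g), expVec (restrictTo (Set.Iio 0) f)⟫_ℂ *
        ⟪expVec (restrictTo (Set.Ici 0) g), B (expVec (restrictTo (Set.Ici 0) f))⟫_ℂ

/-- The operator `U B U⁻¹`. -/
def conjBy {H K : Type*} [NormedAddCommGroup H] [InnerProductSpace ℂ H] [NormedAddCommGroup K]
    [InnerProductSpace ℂ K] (U : H ≃ₗᵢ[ℂ] K) (B : H →L[ℂ] H) : K →L[ℂ] K :=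
  U.toContinuousLinearEquiv.toContinuousLinearMap ∘L B ∘L
    U.symm.toContinuousLinearEquiv.toContinuousLinearMap

/-- `L^∞(Ω, 𝓕_t, P)` as an algebra of multiplication operators on Wiener space. -/
def mulLinfty (P : Measure WienerPath) (t : ℝ≥0) : Set (WienerSpace P →L[ℂ] WienerSpace P) :=
  {T | ∃ φ : WienerPath → ℂ, Measurable[sigmaAlg t] φ ∧ MemLp φ ∞ P ∧
    ∀ u : WienerSpace P, T u =ᵐ[P] fun ω => φ ω * u ω}

end FockSpaceOverL2

end FockWiener

end

noncomputable section

namespace FockWiener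

/-! ### Real structures on complex Hilbert spaces -/

section RealSpan

variable {ι H : Type*} [NormedAddCommGroup H] [InnerProductSpace ℂ H]

/-! Exponential vectors and stochastic exponentials are total families with the same Gram matrix
`exp ⟪g, f⟫`, so exactly one unitary matches them. To compute on the Wiener side, write `f = x + i
y` with `x`, `y` in the real Hilbert space `realVec` (`exists_realVec`). The Wiener integrals of
real vectors are centered real Gaussian variables `X` with variance `‖x‖²` (`map_wienerReal`), and
orthogonal real vectors give independent ones (`indepFun_wienerReal`). Hence the formula
`integral_exp_wienerReal_add` for the expectation of `exp (X + i Y)`, and from it the Gram matrix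
(`inner_stochVec`). Totality (`dense_span_stochVec`) is Fourier uniqueness: up to nonzero factors,
the stochastic exponentials of the vectors `i x` are the characters `exp (i X)`, and an integrable
function whose products with all characters have expectation zero vanishes
(`setIntegral_eq_zero_of_charFun`).

(a) Multiplication by `exp (i X)` sends the stochastic exponential of `f` to a multiple of that of
`f + i x`, with the scalar that defines the Weyl operator (`expMul_stochVec`).

(b) The derivative of `z ↦ exp (z X) E_W(f)` at `0` shows that `a(g) + a†(g)` acts on exponential
vectors as multiplication by the Wiener integral `X` of `g` (`deriv_expVec`). The closure is
multiplication on the maximal domain because the vectors `(X + i) E_W(f)` are dense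
(`dense_span_mulStochVec_add`) and the bounded multiplications by `(X + i)⁻¹` and `X (X + i)⁻¹`
recover the pair `(u, X u)` from `(X + i) u`.

(c) Conjugation by the unitary carries double commutants to double commutants, so
`centralizer_centralizer_expMul` is the point. An operator in the double commutant commutes with
every bounded multiplication, hence is one, by its value at `1`; it also commutes with the
conditional expectation given `𝓕_t`, so this value is `𝓕_t`-measurable. Conversely, by Fourier
uniqueness on `𝓕_t`, whatever commutes with the characters up to time `t` commutes with
multiplication by all bounded `𝓕_t`-measurable functions.

The statement about `L²(ℝ; Z)` rests on the maps `V a : y ↦ E(a) ⊗ y`. They turn `T = 1 ⊗ B` into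
the relations `T V a = V a B`, from which the double commutant of the ampliations is found
(`mem_centralizer_centralizer_tensor`). Of the two restriction maps only the additivity of inner
products and joint surjectivity are needed. -/

/-- The closed real linear span of a family of vectors of a complex Hilbert space. -/
def realSpan (v : ι → H) : Submodule ℝ H := (Submodule.span ℝ (Set.range v)).topologicalClosure

theorem mem_realSpan (v : ι → H) (i : ι) : v i ∈ realSpan v :=
  Submodule.le_topologicalClosure _ (Submodule.subset_span ⟨i, rfl⟩)

theorem isClosed_realSpan (v : ι → H) : IsClosed (realSpan v : Set H) :=
  Submodule.isClosed_topologicalClosure _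

theorem smul_mem_realSpan {v : ι → H} (r : ℝ) {x : H} (hx : x ∈ realSpan v) :
    (r : ℂ) • x ∈ realSpan v := by
  rw [Complex.coe_smul]
  exact Submodule.smul_mem _ _ hx

theorem realSpan_le {v : ι → H} {S : Submodule ℝ H} (hS : IsClosed (S : Set H))
    (h : ∀ i, v i ∈ S) : realSpan v ≤ S :=
  Submodule.topologicalClosure_minimal _ (Submodule.span_le.2 (by rintro _ ⟨i, rfl⟩; exact h i)) hS

/-- A closed property of finite real linear combinations holds on the closed real span. -/
theorem realSpan_induction {v : ι → H} {p : H → Prop} (hp : IsClosed {x | p x})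
    (h : ∀ c : ι →₀ ℝ, p (c.sum fun i a => (a : ℂ) • v i)) {x : H} (hx : x ∈ realSpan v) : p x := by
  have h1 : (Submodule.span ℝ (Set.range v) : Set H) ⊆ {x | p x} := by
    intro y hy
    obtain ⟨c, rfl⟩ := (Finsupp.mem_span_range_iff_exists_finsupp).1 hy
    have h2 := h c
    simp only [Complex.coe_smul] at h2
    exact h2
  exact closure_minimal h1 hp hx

theorem im_inner_realSpan_of_right {v : ι → H} {y : H} (h : ∀ i, (⟪v i, y⟫_ℂ).im = 0) {x : H}
    (hx : x ∈ realSpan v) : (⟪x, y⟫_ℂ).im = 0 := by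
  refine realSpan_induction (p := fun x => (⟪x, y⟫_ℂ).im = 0)
    (isClosed_eq (by fun_prop) (by fun_prop)) (fun c => ?_) hx
  simp [Finsupp.sum, h]

theorem im_inner_realSpan {v : ι → H} (h : ∀ i j, (⟪v i, v j⟫_ℂ).im = 0) {x y : H}
    (hx : x ∈ realSpan v) (hy : y ∈ realSpan v) : (⟪x, y⟫_ℂ).im = 0 := by
  refine im_inner_realSpan_of_right (fun i => ?_) hx
  rw [← inner_conj_symm, Complex.conj_im, im_inner_realSpan_of_right (fun j => h j i) hy, neg_zero]

/-- The real part of `⟪x, i y⟫` is `-Im ⟪x, y⟫`, so `x` and `i y` are orthogonal in the underlying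
real Hilbert space. -/
theorem norm_add_I_smul_sq {x y : H} (h : (⟪x, y⟫_ℂ).im = 0) :
    ‖x + Complex.I • y‖ ^ 2 = ‖x‖ ^ 2 + ‖y‖ ^ 2 := by
  rw [@norm_add_sq ℂ, inner_smul_right, norm_smul]
  simp [h]

/-- If a total family has real inner products, then every vector is `x + i y` with `x` and `y` in
its closed real span. -/
theorem exists_add_I_smul [CompleteSpace H] {v : ι → H} (h : ∀ i j, (⟪v i, v j⟫_ℂ).im = 0)
    (hv : Dense (Submodule.span ℂ (Set.range v) : Set H)) (f : H) :
    ∃ x ∈ realSpan v, ∃ y ∈ realSpan v, f = x + Complex.I • y := by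
  let K := realSpan v
  have hK : IsClosed (K : Set H) := Submodule.isClosed_topologicalClosure _
  have : CompleteSpace K := hK.completeSpace_coe
  let φ : K × K →ₗ[ℝ] H :=
    { toFun := fun p => (p.1 : H) + Complex.I • (p.2 : H)
      map_add' := fun p q => by
        simp only [Prod.fst_add, Prod.snd_add, Submodule.coe_add, smul_add]
        abel
      map_smul' := fun r p => by
        simp only [Prod.smul_fst, Prod.smul_snd, Submodule.coe_smul, RingHom.id_apply, smul_add]
        rw [smul_comm] }
  -- By Pythagoras `φ` is bounded below. As `K × K` is complete, its range is closed.
  have hanti : AntilipschitzWith 1 φ := by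
    refine AddMonoidHomClass.antilipschitz_of_bound φ fun p => ?_
    have h2 := norm_add_I_smul_sq (im_inner_realSpan h p.1.2 p.2.2)
    change ‖p‖ ≤ 1 * ‖(p.1 : H) + Complex.I • (p.2 : H)‖
    rw [one_mul]
    refine max_le ?_ ?_
    · refine abs_le_of_sq_le_sq' ?_ (norm_nonneg _) |>.2
      rw [h2]; change ‖(p.1 : H)‖ ^ 2 ≤ _; nlinarith [sq_nonneg ‖(p.2 : H)‖]
    · refine abs_le_of_sq_le_sq' ?_ (norm_nonneg _) |>.2
      rw [h2]; change ‖(p.2 : H)‖ ^ 2 ≤ _; nlinarith [sq_nonneg ‖(p.1 : H)‖]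
  have hcont : UniformContinuous φ := by
    have h1 : Continuous φ := by
      change Continuous fun p : K × K => (p.1 : H) + Complex.I • (p.2 : H)
      fun_prop
    exact (⟨φ, h1⟩ : K × K →L[ℝ] H).uniformContinuous
  have hcl := hanti.isClosed_range hcont
  -- Although `φ` is only real linear, its range is a complex subspace, so it contains the dense
  -- complex span of `v`.
  let R : Submodule ℂ H :=
    { carrier := Set.range φ
      add_mem' := by rintro _ _ ⟨p, rfl⟩ ⟨q, rfl⟩; exact ⟨p + q, map_add _ _ _⟩
      zero_mem' := ⟨0, map_zero _⟩
      smul_mem' := by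
        rintro c _ ⟨p, rfl⟩
        refine ⟨(c.re • p.1 - c.im • p.2, c.re • p.2 + c.im • p.1), ?_⟩
        change ((c.re • p.1 - c.im • p.2 : K) : H) +
          Complex.I • ((c.re • p.2 + c.im • p.1 : K) : H) =
          c • ((p.1 : H) + Complex.I • (p.2 : H))
        conv_rhs => rw [← Complex.re_add_im c]
        simp only [Submodule.coe_sub, Submodule.coe_add, Submodule.coe_smul, ← Complex.coe_smul,
          add_smul, smul_add, smul_smul, add_mul]
        have e1 : (c.im : ℂ) * Complex.I * Complex.I = -c.im := by
          rw [mul_assoc, Complex.I_mul_I]; ring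
        rw [e1, mul_comm Complex.I, mul_comm Complex.I, neg_smul]
        abel }
  have hle : Submodule.span ℂ (Set.range v) ≤ R := by
    refine Submodule.span_le.2 ?_
    rintro _ ⟨i, rfl⟩
    exact ⟨(⟨v i, mem_realSpan v i⟩, 0), by simp [φ]⟩
  have hf : f ∈ Set.range φ := by
    have : closure (Submodule.span ℂ (Set.range v) : Set H) ⊆ Set.range φ := closure_minimal hle hcl
    exact this (hv f)
  obtain ⟨p, rfl⟩ := hf
  exact ⟨p.1, p.1.2, p.2, p.2.2, rfl⟩

end RealSpan

/-! ### Centralizers -/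

theorem image_centralizer {M N : Type*} [Mul M] [Mul N] (φ : M ≃* N) (S : Set M) :
    φ '' Set.centralizer S = Set.centralizer (φ '' S) := by
  ext y
  simp only [Set.mem_image, Set.mem_centralizer_iff]
  constructor
  · rintro ⟨x, hx, rfl⟩ _ ⟨s, hs, rfl⟩
    rw [← map_mul, ← map_mul, hx s hs]
  · intro h
    refine ⟨φ.symm y, fun s hs => φ.injective ?_, φ.apply_symm_apply y⟩
    simpa using h (φ s) ⟨s, hs, rfl⟩

/-! ### Fourier uniqueness for integrable functions -/

section Fourier

variable {Ω ι : Type*} {m0 : MeasurableSpace Ω} {μ : Measure Ω}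

/-- Finite measures with the same characteristic functions of all finite-dimensional marginals agree
on the σ-algebra generated by the process. -/
theorem measure_eq_of_charFun {μ₁ μ₂ : Measure Ω} [IsFiniteMeasure μ₁] [IsFiniteMeasure μ₂]
    {X : ι → Ω → ℝ} (hX : ∀ i, Measurable (X i))
    (h : ∀ c : ι →₀ ℝ, ∫ ω, Complex.exp (Complex.I * (c.sum fun i a => a * X i ω : ℝ)) ∂μ₁ =
      ∫ ω, Complex.exp (Complex.I * (c.sum fun i a => a * X i ω : ℝ)) ∂μ₂)
    {A : Set Ω} (hA : MeasurableSet[⨆ i, MeasurableSpace.comap (X i) inferInstance] A) :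
    μ₁ A = μ₂ A := by
  classical
  have hΦ : Measurable (fun ω i => X i ω) := measurable_pi_lambda _ hX
  have hmarg : ∀ I : Finset ι, (μ₁.map (fun ω i => X i ω)).map I.restrict =
      (μ₂.map (fun ω i => X i ω)).map I.restrict := by
    intro I
    rw [Measure.map_map (by fun_prop) hΦ, Measure.map_map (by fun_prop) hΦ]
    refine Measure.ext_of_charFunDual ?_
    funext L
    have hm : Measurable (I.restrict ∘ fun ω i => X i ω) := (Finset.measurable_restrict I).comp hΦ
    rw [charFunDual_apply, charFunDual_apply, integral_map hm.aemeasurable (by fun_prop),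
      integral_map hm.aemeasurable (by fun_prop)]
    -- The coefficients of the functional `L` on the coordinate vectors, extended by zero outside
    -- `I`.
    let c : ι →₀ ℝ := Finsupp.onFinset I
      (fun i => if hi : i ∈ I then L (Pi.single ⟨i, hi⟩ 1) else 0) (by
        intro i hi
        by_contra hn
        simp [hn] at hi)
    have key : ∀ ω, Complex.exp (L ((I.restrict ∘ fun ω i => X i ω) ω) * Complex.I) =
        Complex.exp (Complex.I * (c.sum fun i a => a * X i ω : ℝ)) := by
      intro ω
      have e : L ((I.restrict ∘ fun ω i => X i ω) ω) = c.sum fun i a => a * X i ω := by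
        rw [Finsupp.onFinset_sum _ (by simp), ← Finset.sum_attach I]
        conv_lhs => rw [← ContinuousLinearMap.coe_coe, LinearMap.pi_apply_eq_sum_univ]
        refine Finset.sum_congr rfl fun i _ => ?_
        rw [dif_pos i.2, smul_eq_mul, mul_comm]
        refine congrArg (fun z => L z * _) (funext fun j => ?_)
        simp [Pi.single_apply, eq_comm]
      rw [e, mul_comm]
    simp only [key]
    exact h c
  -- A finite measure on a product is determined by its finite-dimensional marginals.
  have hmap : μ₁.map (fun ω i => X i ω) = μ₂.map (fun ω i => X i ω) :=
    IsProjectiveLimit.unique (P := fun I => (μ₁.map (fun ω i => X i ω)).map I.restrict)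
      (fun I => rfl) (fun I => (hmarg I).symm)
  have hA' : MeasurableSet[MeasurableSpace.comap (fun ω i => X i ω) MeasurableSpace.pi] A := by
    rw [MeasurableSpace.pi, MeasurableSpace.comap_iSup]
    have e : (⨆ i, (MeasurableSpace.comap (fun b : ι → ℝ => b i) inferInstance).comap
        fun ω i => X i ω) = ⨆ i, MeasurableSpace.comap (X i) inferInstance :=
      iSup_congr fun i => MeasurableSpace.comap_comp
    exact e ▸ hA
  obtain ⟨B, hB, rfl⟩ := hA'
  rw [← Measure.map_apply hΦ hB, ← Measure.map_apply hΦ hB, hmap]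

/-- The positive and negative parts of `w` are densities of two finite measures. The hypothesis says
that these have the same characteristic functions, so they agree on the generated σ-algebra. -/
theorem setIntegral_eq_zero_of_charFun_real {X : ι → Ω → ℝ} (hX : ∀ i, Measurable (X i))
    {w : Ω → ℝ} (hw : Integrable w μ)
    (h : ∀ c : ι →₀ ℝ,
      ∫ ω, (w ω : ℂ) * Complex.exp (Complex.I * (c.sum fun i a => a * X i ω : ℝ)) ∂μ = 0)
    {A : Set Ω} (hA : MeasurableSet[⨆ i, MeasurableSpace.comap (X i) inferInstance] A) :
    ∫ ω in A, w ω ∂μ = 0 := by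
  have hle : (⨆ i, MeasurableSpace.comap (X i) inferInstance) ≤ m0 :=
    iSup_le fun i => (hX i).comap_le
  let μ₁ := μ.withDensity fun ω => ENNReal.ofReal (w ω)
  let μ₂ := μ.withDensity fun ω => ENNReal.ofReal (-w ω)
  have f1 : IsFiniteMeasure μ₁ := isFiniteMeasure_withDensity_ofReal hw.2
  have f2 : IsFiniteMeasure μ₂ := isFiniteMeasure_withDensity_ofReal hw.neg.2
  have hE : ∀ c : ι →₀ ℝ, Measurable fun ω =>
      Complex.exp (Complex.I * (c.sum fun i a => a * X i ω : ℝ)) := by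
    intro c
    have : Measurable fun ω => (c.sum fun i a => a * X i ω : ℝ) :=
      Finset.measurable_fun_sum _ fun i _ => (hX i).const_mul _
    fun_prop
  have hn : ∀ (c : ι →₀ ℝ) ω,
      ‖Complex.exp (Complex.I * (c.sum fun i a => a * X i ω : ℝ))‖ ≤ 1 := by
    intro c ω
    rw [mul_comm, Complex.norm_exp_ofReal_mul_I]
  have hi : ∀ (v : Ω → ℝ) (_ : Integrable v μ) (c : ι →₀ ℝ), Integrable (fun ω =>
      (v ω : ℂ) * Complex.exp (Complex.I * (c.sum fun i a => a * X i ω : ℝ))) μ := fun v hv c =>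
    hv.ofReal.mul_bdd (hE c).aestronglyMeasurable (ae_of_all _ (hn c))
  have h12 : μ₁ A = μ₂ A := by
    refine measure_eq_of_charFun hX (fun c => ?_) hA
    rw [integral_withDensity_eq_integral_toReal_smul₀ hw.1.aemeasurable.ennreal_ofReal
        (ae_of_all _ fun _ => ENNReal.ofReal_lt_top),
      integral_withDensity_eq_integral_toReal_smul₀
        (f := fun ω => ENNReal.ofReal (-w ω)) hw.1.aemeasurable.neg.ennreal_ofReal
        (ae_of_all _ fun _ => ENNReal.ofReal_lt_top), ← sub_eq_zero, ← integral_sub]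
    · rw [← h c]
      refine integral_congr_ae (ae_of_all _ fun ω => ?_)
      simp only [← Complex.coe_smul, smul_eq_mul, ← sub_mul, ← Complex.ofReal_sub,
        ENNReal.toReal_ofReal', max_zero_sub_max_neg_zero_eq_self]
    · simpa only [← Complex.coe_smul, smul_eq_mul, ENNReal.toReal_ofReal'] using hi _ hw.pos_part c
    · simpa only [← Complex.coe_smul, smul_eq_mul, ENNReal.toReal_ofReal'] using hi _ hw.neg_part c
  have hA0 := hle _ hA
  rw [withDensity_apply _ hA0, withDensity_apply _ hA0] at h12
  rw [integral_eq_lintegral_pos_part_sub_lintegral_neg_part hw.integrableOn, h12, sub_self]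

/-- An integrable function whose products with all characters of a process have integral zero has
integral zero over all sets of the σ-algebra generated by the process. -/
theorem setIntegral_eq_zero_of_charFun {X : ι → Ω → ℝ} (hX : ∀ i, Measurable (X i))
    {w : Ω → ℂ} (hw : Integrable w μ)
    (h : ∀ c : ι →₀ ℝ,
      ∫ ω, w ω * Complex.exp (Complex.I * (c.sum fun i a => a * X i ω : ℝ)) ∂μ = 0)
    {A : Set Ω} (hA : MeasurableSet[⨆ i, MeasurableSpace.comap (X i) inferInstance] A) :
    ∫ ω in A, w ω ∂μ = 0 := by
  have hE : ∀ c : ι →₀ ℝ, Measurable fun ω =>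
      Complex.exp (Complex.I * (c.sum fun i a => a * X i ω : ℝ)) := by
    intro c
    have : Measurable fun ω => (c.sum fun i a => a * X i ω : ℝ) :=
      Finset.measurable_fun_sum _ fun i _ => (hX i).const_mul _
    fun_prop
  have hi : ∀ c : ι →₀ ℝ, Integrable (fun ω =>
      w ω * Complex.exp (Complex.I * (c.sum fun i a => a * X i ω : ℝ))) μ := fun c =>
    hw.mul_bdd (c := 1) (hE c).aestronglyMeasurable (ae_of_all _ fun ω => by
      rw [mul_comm, Complex.norm_exp_ofReal_mul_I])
  -- Conjugation changes `c` into `-c`, so `conj w` inherits the hypothesis; hence so do the real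
  -- and imaginary parts of `w`.
  have hconj : ∀ c : ι →₀ ℝ,
      ∫ ω, conj (w ω) * Complex.exp (Complex.I * (c.sum fun i a => a * X i ω : ℝ)) ∂μ = 0 := by
    intro c
    have h1 := congrArg conj (h (-c))
    rw [← integral_conj, map_zero] at h1
    rw [← h1]
    refine integral_congr_ae (ae_of_all _ fun ω => ?_)
    have e : ((-c).sum fun i a => a * X i ω : ℝ) = -(c.sum fun i a => a * X i ω : ℝ) := by
      rw [Finsupp.sum_neg_index (by simp)]
      simp [Finsupp.sum]
    simp only [e, map_mul, ← Complex.exp_conj, Complex.conj_I, Complex.conj_ofReal,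
      Complex.ofReal_neg, map_neg]
    congr 2
    ring
  have hi' : ∀ c : ι →₀ ℝ, Integrable (fun ω =>
      conj (w ω) * Complex.exp (Complex.I * (c.sum fun i a => a * X i ω : ℝ))) μ := fun c =>
    (Complex.conjCLE.toContinuousLinearMap.integrable_comp hw).mul_bdd (c := 1)
      (hE c).aestronglyMeasurable (ae_of_all _ fun ω => by
        rw [mul_comm, Complex.norm_exp_ofReal_mul_I])
  have hre : ∫ ω in A, (w ω).re ∂μ = 0 := by
    refine setIntegral_eq_zero_of_charFun_real (w := fun ω => (w ω).re) hX hw.re (fun c => ?_) hA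
    have h1 : ∫ ω, ((w ω * Complex.exp (Complex.I * (c.sum fun i a => a * X i ω : ℝ))) +
        (conj (w ω) * Complex.exp (Complex.I * (c.sum fun i a => a * X i ω : ℝ)))) / 2 ∂μ = 0 := by
      rw [integral_div, integral_add (hi c) (hi' c), h c, hconj c]
      simp
    rw [← h1]
    refine integral_congr_ae (ae_of_all _ fun ω => ?_)
    simp only [Complex.re_eq_add_conj]
    ring
  have him : ∫ ω in A, (w ω).im ∂μ = 0 := by
    refine setIntegral_eq_zero_of_charFun_real (w := fun ω => (w ω).im) hX hw.im (fun c => ?_) hA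
    have h1 : ∫ ω, ((w ω * Complex.exp (Complex.I * (c.sum fun i a => a * X i ω : ℝ))) -
        (conj (w ω) * Complex.exp (Complex.I * (c.sum fun i a => a * X i ω : ℝ)))) /
          (2 * Complex.I) ∂μ = 0 := by
      rw [integral_div, integral_sub (hi c) (hi' c), h c, hconj c]
      simp
    rw [← h1]
    refine integral_congr_ae (ae_of_all _ fun ω => ?_)
    simp only [Complex.im_eq_sub_conj]
    field_simp
  have h3 := integral_re_add_im (𝕜 := ℂ) (hw.integrableOn (s := A))
  simp only [RCLike.re_eq_complex_re, RCLike.im_eq_complex_im, hre, him] at h3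
  rw [← h3]
  simp

end Fourier

/-! ### Multiplication operators -/

section MulOp

variable {α E : Type*} {m : MeasurableSpace α} {μ : Measure α} [NormedAddCommGroup E]
  [NormedSpace ℂ E]

/-- The operator of multiplication by a bounded function on `L²`. -/
def mulOp (φ : Lp ℂ ∞ μ) : Lp E 2 μ →L[ℂ] Lp E 2 μ :=
  (ContinuousLinearMap.lsmul ℂ ℂ).holderL μ ∞ 2 2 φ

theorem coeFn_mulOp (φ : Lp ℂ ∞ μ) (f : Lp E 2 μ) : mulOp φ f =ᵐ[μ] fun x => φ x • f x :=
  ContinuousLinearMap.coeFn_holder (r := 2) (ContinuousLinearMap.lsmul ℂ ℂ) φ f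

theorem coeFn_mulOp_toLp {φ : α → ℂ} (hφ : MemLp φ ∞ μ) (f : Lp E 2 μ) :
    mulOp hφ.toLp f =ᵐ[μ] fun x => φ x • f x := by
  filter_upwards [coeFn_mulOp hφ.toLp f, hφ.coeFn_toLp] with x h1 h2
  rw [h1, h2]

end MulOp

/-! ### Almost everywhere real functions -/

section AeReal

variable {α ι H : Type*} {m : MeasurableSpace α} {μ : Measure α} [NormedAddCommGroup H]
  [InnerProductSpace ℂ H]

/-- The set is the kernel of the continuous map on `L²` that takes imaginary parts. -/
theorem isClosed_ae_im_eq_zero : IsClosed {g : Lp ℂ 2 μ | ∀ᵐ t ∂μ, (g t).im = 0} := by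
  have h : {g : Lp ℂ 2 μ | ∀ᵐ t ∂μ, (g t).im = 0} =
      {g | Complex.imCLM.compLpL 2 μ g = 0} := by
    ext g
    change (∀ᵐ t ∂μ, (g t).im = 0) ↔ Complex.imCLM.compLpL 2 μ g = 0
    rw [Lp.eq_zero_iff_ae_eq_zero]
    have h1 := Complex.imCLM.coeFn_compLpL g
    constructor
    · intro h2
      filter_upwards [h1, h2] with t h3 h4
      rw [h3]; exact h4
    · intro h2
      filter_upwards [h1, h2] with t h3 h4
      rw [h3] at h4; exact h4
  rw [h]
  exact isClosed_eq (Complex.imCLM.compLpL 2 μ).continuous continuous_const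

/-- A continuous linear map that maps a family to real functions maps its closed real span to real
functions. -/
theorem ae_im_eq_zero_of_mem_realSpan (L : H →L[ℂ] Lp ℂ 2 μ) {v : ι → H}
    (hv : ∀ i, ∀ᵐ t ∂μ, (L (v i) t).im = 0) {x : H} (hx : x ∈ realSpan v) :
    ∀ᵐ t ∂μ, (L x t).im = 0 := by
  refine realSpan_induction (p := fun x => ∀ᵐ t ∂μ, (L x t).im = 0)
    (isClosed_ae_im_eq_zero.preimage L.continuous) (fun c => ?_) hx
  classical
  rw [Finsupp.sum]
  induction c.support using Finset.induction with
  | empty =>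
    rw [Finset.sum_empty, map_zero]
    filter_upwards [Lp.coeFn_zero ℂ 2 μ] with t ht
    rw [ht]; rfl
  | insert i s hi ih =>
    rw [Finset.sum_insert hi, map_add, map_smul]
    filter_upwards [ih, hv i,
      Lp.coeFn_add (((c i : ℝ) : ℂ) • L (v i)) (L (∑ i ∈ s, (c i : ℂ) • v i)),
      Lp.coeFn_smul ((c i : ℝ) : ℂ) (L (v i))] with t h1 h2 h3 h4
    rw [h3, Pi.add_apply, h4, Pi.smul_apply, smul_eq_mul, Complex.add_im, h1]
    simp [h2]

end AeReal

/-! ### Coordinates in `L²(S; Z)` -/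

section Coordinates

variable {Z : Type*} [NormedAddCommGroup Z] [InnerProductSpace ℂ Z] (e : HilbertBasis ℕ ℂ Z)
  {S : Set ℝ}

theorem coeFn_coord (j : ℕ) (f : OneParticle Z S) :
    coord e j f =ᵐ[volume.restrict S] fun t => ⟪e j, f t⟫_ℂ :=
  ContinuousLinearMap.coeFn_compLp _ f

/-- `coord` as a continuous linear map. -/
def coordL (j : ℕ) : OneParticle Z S →L[ℂ] OneParticle ℂ S :=
  (innerSL ℂ (e j)).compLpL 2 (volume.restrict S)

theorem coordL_apply (j : ℕ) (f : OneParticle Z S) : coordL e j f = coord e j f := rfl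

/-- The isometry `g ↦ g e_j` of `L²(S; ℂ)` into `L²(S; Z)`. -/
def emb (j : ℕ) : OneParticle ℂ S →ₗᵢ[ℂ] OneParticle Z S where
  toLinearMap := ((ContinuousLinearMap.toSpanSingleton ℂ (e j)).compLpL 2
    (volume.restrict S)).toLinearMap
  norm_map' g := by
    have h := (ContinuousLinearMap.toSpanSingleton ℂ (e j)).coeFn_compLp g
    refine le_antisymm (Lp.norm_le_norm_of_ae_le ?_) (Lp.norm_le_norm_of_ae_le ?_)
    all_goals
      filter_upwards [h] with t ht
      refine le_of_eq ?_
    · exact (congrArg norm ht).trans (by simp [norm_smul, e.orthonormal.1 j])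
    · exact ((congrArg norm ht).trans (by simp [norm_smul, e.orthonormal.1 j])).symm

theorem coeFn_emb (j : ℕ) (g : OneParticle ℂ S) :
    emb e j g =ᵐ[volume.restrict S] fun t => g t • e j :=
  (ContinuousLinearMap.toSpanSingleton ℂ (e j)).coeFn_compLp g

theorem emb_stepVec (j : ℕ) (t : ℝ≥0) : emb e j (stepVec S t 1) = stepVec S t (e j) := by
  refine Lp.ext ?_
  filter_upwards [coeFn_emb e j (stepVec S t 1), indicatorConstLp_coeFn (p := 2)
    (hs := measurableSet_Icc) (hμs := measure_Icc_ne_top S t) (c := (1 : ℂ)),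
    indicatorConstLp_coeFn (p := 2) (hs := measurableSet_Icc) (hμs := measure_Icc_ne_top S t)
      (c := e j)] with x h1 h2 h3
  rw [h1, stepVec, h2, stepVec, h3]
  by_cases hx : x ∈ Set.Icc 0 (t : ℝ) <;> simp [hx]

theorem inner_emb (j : ℕ) (g : OneParticle ℂ S) (f : OneParticle Z S) :
    ⟪emb e j g, f⟫_ℂ = ⟪g, coord e j f⟫_ℂ := by
  rw [L2.inner_def, L2.inner_def]
  refine integral_congr_ae ?_
  filter_upwards [coeFn_emb e j g, coeFn_coord e j f] with t h1 h2
  rw [h1, h2, inner_smul_left]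
  simp [mul_comm]

theorem coord_emb (i j : ℕ) (g : OneParticle ℂ S) :
    coord e i (emb e j g) = if i = j then g else 0 := by
  refine Lp.ext ?_
  filter_upwards [coeFn_coord e i (emb e j g), coeFn_emb e j g,
    Lp.coeFn_zero ℂ 2 (volume.restrict S)] with t h1 h2 h3
  rw [h1, h2, inner_smul_right, orthonormal_iff_ite.1 e.orthonormal i j]
  split_ifs
  · simp
  · rw [h3]; simp

theorem orthogonalFamily_emb :
    OrthogonalFamily ℂ (fun _ : ℕ => OneParticle ℂ S) (fun j => emb e j) := by
  intro i j hij f g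
  rw [inner_emb, coord_emb, if_neg hij, inner_zero_right]

/-- There are countably many components, so one null set serves for all of them. -/
theorem eq_zero_of_coord_eq_zero {f : OneParticle Z S} (h : ∀ j, coord e j f = 0) : f = 0 := by
  rw [Lp.eq_zero_iff_ae_eq_zero]
  have h1 : ∀ᵐ t ∂(volume.restrict S), ∀ j, ⟪e j, f t⟫_ℂ = 0 := by
    rw [ae_all_iff]
    intro j
    filter_upwards [coeFn_coord e j f, Lp.coeFn_zero ℂ 2 (volume.restrict S)] with t h2 h3
    rw [← h2, h j, h3]
    rfl
  filter_upwards [h1] with t ht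
  refine e.repr.injective ?_
  ext j
  simp [e.repr_apply_apply, ht j]

theorem isHilbertSum_emb [CompleteSpace Z] :
    IsHilbertSum ℂ (fun _ : ℕ => OneParticle ℂ S) (fun j => emb e j) := by
  refine IsHilbertSum.mk (orthogonalFamily_emb e) ?_
  rw [top_le_iff, Submodule.topologicalClosure_eq_top_iff, Submodule.eq_bot_iff]
  intro f hf
  refine eq_zero_of_coord_eq_zero e fun j => ?_
  rw [← inner_self_eq_zero (𝕜 := ℂ), ← inner_emb]
  exact (Submodule.mem_orthogonal _ _).1 hf _
    (Submodule.mem_iSup_of_mem j ⟨coord e j f, rfl⟩)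

/-- Applying the `j`-th component to the Hilbert sum expansion of `f` leaves only the `j`-th term.
This makes the abstract isomorphism explicit. -/
theorem linearIsometryEquiv_apply [CompleteSpace Z] (f : OneParticle Z S) (j : ℕ) :
    (isHilbertSum_emb e).linearIsometryEquiv f j = coord e j f := by
  have h1 := (isHilbertSum_emb e).hasSum_linearIsometryEquiv_symm
    ((isHilbertSum_emb e).linearIsometryEquiv f)
  rw [LinearIsometryEquiv.symm_apply_apply] at h1
  have h2 := (coordL e j).hasSum h1
  simp only [coordL_apply, coord_emb] at h2
  refine HasSum.unique ?_ h2
  convert hasSum_ite_eq j ((isHilbertSum_emb e).linearIsometryEquiv f j) using 2 with i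
  split_ifs with h3 h4 h4
  · rw [h3]
  · exact absurd h3.symm h4
  · exact absurd h4.symm h3
  · rfl

theorem hasSum_emb_coord [CompleteSpace Z] (f : OneParticle Z S) :
    HasSum (fun j => emb e j (coord e j f)) f := by
  have h1 := (isHilbertSum_emb e).hasSum_linearIsometryEquiv_symm
    ((isHilbertSum_emb e).linearIsometryEquiv f)
  rw [LinearIsometryEquiv.symm_apply_apply] at h1
  simpa only [linearIsometryEquiv_apply] using h1

theorem hasSum_inner_coord [CompleteSpace Z] (f g : OneParticle Z S) :
    HasSum (fun j => ⟪coord e j f, coord e j g⟫_ℂ) ⟪f, g⟫_ℂ := by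
  have h1 := (innerSL ℂ f).hasSum (hasSum_emb_coord e g)
  have h2 : ∀ j, ⟪f, emb e j (coord e j g)⟫_ℂ = ⟪coord e j f, coord e j g⟫_ℂ := fun j => by
    rw [← inner_conj_symm, inner_emb, inner_conj_symm]
  simpa only [innerSL_apply_apply, h2] using h1

/-- The vectors `χ_{[0, t]} e_j`. -/
def stepFamily (S : Set ℝ) (p : ℕ × ℝ≥0) : OneParticle Z S := stepVec S p.2 (e p.1)

theorem inner_stepFamily (p q : ℕ × ℝ≥0) :
    ⟪stepFamily e (Set.Ici 0) p, stepFamily e (Set.Ici 0) q⟫_ℂ =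
      (if p.1 = q.1 then ((min p.2 q.2 : ℝ≥0) : ℝ) else 0 : ℝ) := by
  rw [stepFamily, stepFamily, ← emb_stepVec, ← emb_stepVec, inner_emb, coord_emb]
  split_ifs
  · rw [inner_stepVec]
  · simp

theorem dense_span_stepFamily [CompleteSpace Z] :
    Dense (Submodule.span ℂ (Set.range (stepFamily e (Set.Ici 0))) :
      Set (OneParticle Z (Set.Ici 0))) := by
  rw [Submodule.dense_iff_topologicalClosure_eq_top, Submodule.topologicalClosure_eq_top_iff,
    Submodule.eq_bot_iff]
  intro f hf
  refine eq_zero_of_coord_eq_zero e fun j => ?_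
  -- Orthogonality to `χ_{[0, t]} e_j` for all `t` makes this functional vanish on the total family
  -- of step functions.
  have h1 : innerSL ℂ (coord e j f) = 0 := by
    refine ContinuousLinearMap.ext_on dense_span_stepVec ?_
    rintro _ ⟨t, rfl⟩
    have h2 := (Submodule.mem_orthogonal _ _).1 hf _ (Submodule.subset_span ⟨(j, t), rfl⟩)
    rw [stepFamily, ← emb_stepVec, inner_emb] at h2
    rw [innerSL_apply_apply, ← inner_conj_symm, h2, map_zero, zero_apply]
  exact inner_self_eq_zero.1 (DFunLike.congr_fun h1 (coord e j f))

end Coordinates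

/-! ### The Wiener integral of `Z`-valued functions -/

section WienerIsometry

variable {Z : Type*} [NormedAddCommGroup Z] [InnerProductSpace ℂ Z] [CompleteSpace Z]
  (e : HilbertBasis ℕ ℂ Z) {P : Measure WienerPath} (hP : IsWienerMeasure P)

theorem measurable_W (j : ℕ) (t : ℝ≥0) : Measurable (W j t) :=
  measurable_iff_comap_le.2 (le_iSup₂
    (f := fun j t => MeasurableSpace.comap (W j t) inferInstance) j t)

theorem inner_wienerVec_of_ne {i j : ℕ} (hij : i ≠ j) (s t : ℝ≥0) :
    ⟪wienerVec hP i s, wienerVec hP j t⟫_ℂ = 0 := by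
  rw [L2.inner_def]
  have h1 : ∫ ω, ⟪wienerVec hP i s ω, wienerVec hP j t ω⟫_ℂ ∂P =
      ∫ ω, ((W i s ω * W j t ω : ℝ) : ℂ) ∂P := by
    refine integral_congr_ae ?_
    filter_upwards [(memLp_W hP i s).coeFn_toLp, (memLp_W hP j t).coeFn_toLp] with ω h2 h3
    rw [wienerVec, wienerVec, h2, h3]
    simp [mul_comm]
  have h2 : IndepFun (W i s) (W j t) P :=
    (hP.indep.indepFun hij).comp (measurable_pi_apply s) (measurable_pi_apply t)
  rw [h1, integral_complex_ofReal, h2.integral_fun_mul_eq_mul_integral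
    (measurable_W i s).aestronglyMeasurable (measurable_W j t).aestronglyMeasurable,
    (hP.brownian i).integral_eval]
  simp

/-- For step functions this is the independence of different coordinates. Density extends it to
general integrands, first in one argument (`h1`) and then in the other (`h2`). -/
theorem orthogonalFamily_wienerIntegral :
    OrthogonalFamily ℂ (fun _ : ℕ => OneParticle ℂ (Set.Ici 0)) (fun j => wienerIntegral hP j) := by
  intro i j hij f g
  have h1 : ∀ s, (innerSL ℂ (wienerVec hP i s)).comp
      (wienerIntegral hP j).toContinuousLinearMap = 0 := fun s => by
    refine ContinuousLinearMap.ext_on dense_span_stepVec ?_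
    rintro _ ⟨t, rfl⟩
    simp [wienerIntegral_stepVec, inner_wienerVec_of_ne hP hij]
  have h2 : (innerSL ℂ (wienerIntegral hP j g)).comp
      (wienerIntegral hP i).toContinuousLinearMap = 0 := by
    refine ContinuousLinearMap.ext_on dense_span_stepVec ?_
    rintro _ ⟨t, rfl⟩
    have h3 := DFunLike.congr_fun (h1 t) g
    simp only [ContinuousLinearMap.comp_apply, LinearIsometry.coe_toContinuousLinearMap,
      innerSL_apply_apply, zero_apply] at h3 ⊢
    rw [wienerIntegral_stepVec, ← inner_conj_symm, h3, map_zero]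
  have h3 := DFunLike.congr_fun h2 f
  simp only [ContinuousLinearMap.comp_apply, LinearIsometry.coe_toContinuousLinearMap,
      innerSL_apply_apply, zero_apply] at h3
  rw [← inner_conj_symm, h3, map_zero]

/-- The Wiener integral `f ↦ ∑_j ∫₀^∞ f_j dW_j` on `L²(ℝ₊; Z)`. -/
def wienerIsometry : OneParticle Z (Set.Ici 0) →ₗᵢ[ℂ] WienerSpace P :=
  (orthogonalFamily_wienerIntegral hP).linearIsometry.comp
    (isHilbertSum_emb e).linearIsometryEquiv.toLinearIsometry

theorem hasSum_wienerIntegral (f : OneParticle Z (Set.Ici 0)) :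
    HasSum (fun j => wienerIntegral hP j (coord e j f)) (wienerIsometry e hP f) := by
  have h := (orthogonalFamily_wienerIntegral hP).hasSum_linearIsometry
    ((isHilbertSum_emb e).linearIsometryEquiv f)
  simp only [linearIsometryEquiv_apply] at h
  exact h

theorem wienerIsometry_stepVec (j : ℕ) (t : ℝ≥0) :
    wienerIsometry e hP (stepVec (Set.Ici 0) t (e j)) = wienerVec hP j t := by
  have h := hasSum_wienerIntegral e hP (stepVec (Set.Ici 0) t (e j))
  rw [← emb_stepVec] at h ⊢
  refine h.unique ?_
  convert hasSum_ite_eq j (wienerVec hP j t) using 2 with i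
  rw [coord_emb]
  split_ifs with hij
  · rw [hij, wienerIntegral_stepVec]
  · rw [map_zero]

end WienerIsometry

/-! ### Vectors with real components -/

section RealVectors

variable {Z : Type*} [NormedAddCommGroup Z] [InnerProductSpace ℂ Z]
  (e : HilbertBasis ℕ ℂ Z)

theorem im_inner_stepFamily (p q : ℕ × ℝ≥0) :
    (⟪stepFamily e (Set.Ici 0) p, stepFamily e (Set.Ici 0) q⟫_ℂ).im = 0 := by
  rw [inner_stepFamily, Complex.ofReal_im]

/-- The real Hilbert space of the `f ∈ L²(ℝ₊; Z)` with real components. -/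
abbrev realVec : Submodule ℝ (OneParticle Z (Set.Ici 0)) := realSpan (stepFamily e (Set.Ici 0))

theorem stepVec_mem_realVec (j : ℕ) (t : ℝ≥0) : stepVec (Set.Ici 0) t (e j) ∈ realVec e :=
  mem_realSpan (stepFamily e (Set.Ici 0)) (j, t)

theorem im_inner_realVec {x y : OneParticle Z (Set.Ici 0)} (hx : x ∈ realVec e)
    (hy : y ∈ realVec e) : (⟪x, y⟫_ℂ).im = 0 :=
  im_inner_realSpan (im_inner_stepFamily e) hx hy

theorem inner_realVec {x y : OneParticle Z (Set.Ici 0)} (hx : x ∈ realVec e)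
    (hy : y ∈ realVec e) : ⟪x, y⟫_ℂ = ((⟪x, y⟫_ℂ).re : ℂ) :=
  Complex.ext rfl (by rw [im_inner_realVec e hx hy, Complex.ofReal_im])

theorem exists_realVec [CompleteSpace Z] (f : OneParticle Z (Set.Ici 0)) :
    ∃ x ∈ realVec e, ∃ y ∈ realVec e, f = x + Complex.I • y :=
  exists_add_I_smul (im_inner_stepFamily e) (dense_span_stepFamily e) f

theorem im_inner_eq_zero_of_mem_realVec {x : OneParticle Z (Set.Ici 0)} (hx : x ∈ realVec e)
    (j : ℕ) :
    ∀ᵐ t ∂(volume.restrict (Set.Ici (0 : ℝ))), (⟪e j, x t⟫_ℂ).im = 0 := by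
  have h1 : ∀ᵐ t ∂(volume.restrict (Set.Ici (0 : ℝ))), (coordL e j x t).im = 0 := by
    refine ae_im_eq_zero_of_mem_realSpan (coordL e j) (fun p => ?_) hx
    rw [coordL_apply, stepFamily, ← emb_stepVec, coord_emb]
    split_ifs
    · filter_upwards [indicatorConstLp_coeFn (p := 2) (hs := measurableSet_Icc)
        (hμs := measure_Icc_ne_top (Set.Ici 0) p.2) (c := (1 : ℂ))] with t ht
      rw [stepVec, ht]
      by_cases h : t ∈ Set.Icc 0 (p.2 : ℝ) <;> simp [h]
    · filter_upwards [Lp.coeFn_zero ℂ 2 (volume.restrict (Set.Ici (0 : ℝ)))] with t ht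
      rw [ht]; rfl
  filter_upwards [h1, coeFn_coord e j x] with t h2 h3
  rwa [← h3]

/-- The inner products of `x` with step vectors are integrals of real functions, so `⟪b, x⟫` is real
for every `b` in the closed real span. For `x = a + i b` its imaginary part is `‖b‖²`, whence `b =
0`. -/
theorem mem_realVec_of_im_inner_eq_zero [CompleteSpace Z] {x : OneParticle Z (Set.Ici 0)}
    (hx : ∀ j, ∀ᵐ t ∂(volume.restrict (Set.Ici (0 : ℝ))), (⟪e j, x t⟫_ℂ).im = 0) :
    x ∈ realVec e := by
  have h1 : ∀ p, (⟪stepFamily e (Set.Ici 0) p, x⟫_ℂ).im = 0 := by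
    intro p
    rw [stepFamily, ← emb_stepVec, inner_emb, stepVec, L2.inner_indicatorConstLp_one]
    rw [← integral_re_add_im ?_]
    · have h2 : ∫ t in Set.Icc 0 (p.2 : ℝ), RCLike.im (coord e p.1 x t)
          ∂(volume.restrict (Set.Ici (0 : ℝ))) = 0 := by
        refine integral_eq_zero_of_ae (ae_restrict_of_ae ?_)
        filter_upwards [hx p.1, coeFn_coord e p.1 x] with t h3 h4
        rw [h4]
        exact h3
      rw [h2]
      simp
    · have : IsFiniteMeasure
          ((volume.restrict (Set.Ici (0 : ℝ))).restrict (Set.Icc 0 (p.2 : ℝ))) :=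
        ⟨by rw [Measure.restrict_apply_univ]; exact (measure_Icc_ne_top _ _).lt_top⟩
      exact ((Lp.memLp (coord e p.1 x)).restrict _).integrable (by norm_num)
  obtain ⟨a, ha, b, hb, rfl⟩ := exists_realVec e x
  have h2 := im_inner_realSpan_of_right h1 hb
  rw [inner_add_right, inner_smul_right, Complex.add_im, im_inner_realVec e hb ha, zero_add,
    inner_realVec e hb hb, Complex.I_mul_im, Complex.ofReal_re] at h2
  have h3 : b = 0 := by
    rw [← inner_self_eq_zero (𝕜 := ℂ), inner_realVec e hb hb, h2, Complex.ofReal_zero]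
  rwa [h3, smul_zero, add_zero]

theorem cut_mem_realVec [CompleteSpace Z] (k : RealLocL2 e) (t : ℝ≥0) :
    k.cut (Set.Ici 0) t ∈ realVec e := by
  refine mem_realVec_of_im_inner_eq_zero e fun j => ?_
  have h := MemLp.coeFn_toLp (((memLp_indicator_iff_restrict measurableSet_Icc).2
    (k.memLp t)).mono_measure Measure.restrict_le_self : MemLp ((Set.Icc 0 (t : ℝ)).indicator
      k.toFun) 2 (volume.restrict (Set.Ici (0 : ℝ))))
  filter_upwards [h, k.real] with s h1 h2
  rw [RealLocL2.cut, h1]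
  by_cases hs : s ∈ Set.Icc 0 (t : ℝ)
  · rw [Set.indicator_of_mem hs, h2]
  · rw [Set.indicator_of_notMem hs, inner_zero_right, Complex.zero_im]

end RealVectors

/-! ### Restriction of vectors to `[0, t]` -/

section Cut

variable {Z : Type*} [NormedAddCommGroup Z] [InnerProductSpace ℂ Z] (e : HilbertBasis ℕ ℂ Z)

/-- The operator `f ↦ χ_{[0, t]} f` on `L²(ℝ₊; Z)`. -/
def cutOp (Z : Type*) [NormedAddCommGroup Z] [InnerProductSpace ℂ Z] (t : ℝ≥0) :
    OneParticle Z (Set.Ici 0) →L[ℂ] OneParticle Z (Set.Ici 0) :=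
  mulOp (indicatorConstLp ∞ measurableSet_Icc (measure_Icc_ne_top (Set.Ici 0) t) (1 : ℂ))

theorem coeFn_cutOp (t : ℝ≥0) (f : OneParticle Z (Set.Ici 0)) :
    cutOp Z t f =ᵐ[volume.restrict (Set.Ici 0)] (Set.Icc 0 (t : ℝ)).indicator f := by
  filter_upwards [coeFn_mulOp (indicatorConstLp ∞ measurableSet_Icc
    (measure_Icc_ne_top (Set.Ici 0) t) (1 : ℂ)) f, indicatorConstLp_coeFn (p := ∞)
    (hs := measurableSet_Icc) (hμs := measure_Icc_ne_top (Set.Ici 0) t) (c := (1 : ℂ))] with x h1 h2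
  rw [cutOp, h1, h2]
  by_cases hx : x ∈ Set.Icc 0 (t : ℝ) <;> simp [hx]

theorem cutOp_stepVec (s t : ℝ≥0) (z : Z) :
    cutOp Z t (stepVec (Set.Ici 0) s z) = stepVec (Set.Ici 0) (min s t) z := by
  refine Lp.ext ?_
  filter_upwards [coeFn_cutOp t (stepVec (Set.Ici 0) s z), indicatorConstLp_coeFn (p := 2)
    (hs := measurableSet_Icc) (hμs := measure_Icc_ne_top (Set.Ici 0) s) (c := z),
    indicatorConstLp_coeFn (p := 2) (hs := measurableSet_Icc)
      (hμs := measure_Icc_ne_top (Set.Ici 0) (min s t)) (c := z)] with x h1 h2 h3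
  rw [h1, Set.indicator_apply, stepVec, h2, stepVec, h3, Set.indicator_apply, Set.indicator_apply]
  simp only [Set.mem_Icc, NNReal.coe_min, le_min_iff]
  by_cases h4 : 0 ≤ x <;> by_cases h5 : x ≤ s <;> by_cases h6 : x ≤ t <;> simp [h4, h5, h6]

/-- The `f ∈ L²(ℝ₊; Z)` with real components that vanish after `t`. -/
abbrev realVecUpTo (t : ℝ≥0) : Submodule ℝ (OneParticle Z (Set.Ici 0)) :=
  realSpan fun p : ℕ × Set.Iic t => stepVec (Set.Ici 0) p.2 (e p.1)

theorem realVecUpTo_le (t : ℝ≥0) : realVecUpTo e t ≤ realVec e :=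
  realSpan_le (isClosed_realSpan _) fun p => stepVec_mem_realVec e p.1 p.2

theorem cutOp_mem_realVecUpTo (t : ℝ≥0) {x : OneParticle Z (Set.Ici 0)} (hx : x ∈ realVec e) :
    cutOp Z t x ∈ realVecUpTo e t := by
  refine realSpan_induction (p := fun x => cutOp Z t x ∈ realVecUpTo e t)
    ((isClosed_realSpan _).preimage (cutOp Z t).continuous) (fun c => ?_) hx
  rw [Finsupp.sum, map_sum]
  refine Submodule.sum_mem _ fun p _ => ?_
  rw [map_smul, stepFamily, cutOp_stepVec]
  exact smul_mem_realSpan _ (mem_realSpan (fun p : ℕ × Set.Iic t =>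
    stepVec (Set.Ici 0) p.2 (e p.1)) (p.1, ⟨min p.2 t, Set.mem_Iic.2 (min_le_right _ _)⟩))

theorem cutOp_eq_self {t : ℝ≥0} {x : OneParticle Z (Set.Ici 0)} (hx : x ∈ realVecUpTo e t) :
    cutOp Z t x = x := by
  refine realSpan_induction (p := fun x => cutOp Z t x = x)
    (isClosed_eq (cutOp Z t).continuous continuous_id) (fun c => ?_) hx
  rw [Finsupp.sum, map_sum]
  refine Finset.sum_congr rfl fun p _ => ?_
  rw [map_smul, cutOp_stepVec, min_eq_left p.2.2]

theorem coeFn_cut (k : RealLocL2 e) (S : Set ℝ) (t : ℝ≥0) :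
    k.cut S t =ᵐ[volume.restrict S] (Set.Icc 0 (t : ℝ)).indicator k.toFun :=
  MemLp.coeFn_toLp _

theorem cut_mem_realVecUpTo [CompleteSpace Z] (k : RealLocL2 e) (t : ℝ≥0) :
    k.cut (Set.Ici 0) t ∈ realVecUpTo e t := by
  have h : cutOp Z t (k.cut (Set.Ici 0) t) = k.cut (Set.Ici 0) t := by
    refine Lp.ext ?_
    filter_upwards [coeFn_cutOp t (k.cut (Set.Ici 0) t), coeFn_cut e k (Set.Ici 0) t] with x h1 h2
    rw [h1, Set.indicator_apply, h2, Set.indicator_apply]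
    split_ifs <;> rfl
  rw [← h]
  exact cutOp_mem_realVecUpTo e t (cut_mem_realVec e k t)

/-- Together with `cut_mem_realVecUpTo` this identifies the vectors `χ_{[0, t]} k`, `k ∈ ℛ`, with a
closed real subspace. The vector `x` itself serves as `k`, since cutting at `t` does not change it.
-/
theorem exists_cut_eq {t : ℝ≥0} {x : OneParticle Z (Set.Ici 0)} (hx : x ∈ realVecUpTo e t) :
    ∃ k : RealLocL2 e, k.cut (Set.Ici 0) t = x := by
  have hle : ∀ s : ℝ≥0, (volume : Measure ℝ).restrict (Set.Icc 0 (s : ℝ)) ≤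
      volume.restrict (Set.Ici 0) := fun s =>
    Measure.restrict_mono (fun y hy => hy.1) le_rfl
  refine ⟨⟨x, fun s => (Lp.memLp x).mono_measure (hle s), ?_⟩, ?_⟩
  · exact ae_all_iff.2 fun j => im_inner_eq_zero_of_mem_realVec e (realVecUpTo_le e t hx) j
  · refine Lp.ext ?_
    have h := coeFn_cutOp t x
    rw [cutOp_eq_self e hx] at h
    refine Filter.EventuallyEq.trans ?_ h.symm
    exact MemLp.coeFn_toLp _

end Cut

/-! ### Gaussian laws -/

section Gaussian

variable {Z : Type*} [NormedAddCommGroup Z] [InnerProductSpace ℂ Z] [CompleteSpace Z]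
  (e : HilbertBasis ℕ ℂ Z) {P : Measure WienerPath} (hP : IsWienerMeasure P)

theorem coeFn_wienerVec (j : ℕ) (t : ℝ≥0) : wienerVec hP j t =ᵐ[P] fun ω => (W j t ω : ℂ) :=
  (memLp_W hP j t).coeFn_toLp

theorem ae_im_wienerIsometry_eq_zero {x : OneParticle Z (Set.Ici 0)} (hx : x ∈ realVec e) :
    ∀ᵐ ω ∂P, (wienerIsometry e hP x ω).im = 0 := by
  refine ae_im_eq_zero_of_mem_realSpan (wienerIsometry e hP).toContinuousLinearMap (fun p => ?_) hx
  rw [LinearIsometry.coe_toContinuousLinearMap, stepFamily, wienerIsometry_stepVec]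
  filter_upwards [coeFn_wienerVec hP p.1 p.2] with ω h
  rw [h, Complex.ofReal_im]

/-- The real random variable `∑_j ∫₀^∞ x_j dW_j`. -/
def wienerReal (x : OneParticle Z (Set.Ici 0)) (ω : WienerPath) : ℝ := (wienerIsometry e hP x ω).re

theorem aestronglyMeasurable_wienerReal (x : OneParticle Z (Set.Ici 0)) :
    AEStronglyMeasurable (wienerReal e hP x) P :=
  (Lp.aestronglyMeasurable (wienerIsometry e hP x)).re

theorem coeFn_wienerIsometry {x : OneParticle Z (Set.Ici 0)} (hx : x ∈ realVec e) :
    wienerIsometry e hP x =ᵐ[P] fun ω => (wienerReal e hP x ω : ℂ) := by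
  filter_upwards [ae_im_wienerIsometry_eq_zero e hP hx] with ω h
  exact Complex.ext rfl (by rw [h, Complex.ofReal_im])

theorem wienerReal_add (x y : OneParticle Z (Set.Ici 0)) :
    wienerReal e hP (x + y) =ᵐ[P] fun ω => wienerReal e hP x ω + wienerReal e hP y ω := by
  filter_upwards [Lp.coeFn_add (wienerIsometry e hP x) (wienerIsometry e hP y)] with ω h
  rw [wienerReal, map_add, h, Pi.add_apply, Complex.add_re]
  rfl

theorem wienerReal_smul (r : ℝ) (x : OneParticle Z (Set.Ici 0)) :
    wienerReal e hP ((r : ℂ) • x) =ᵐ[P] fun ω => r * wienerReal e hP x ω := by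
  filter_upwards [Lp.coeFn_smul (r : ℂ) (wienerIsometry e hP x)] with ω h
  rw [wienerReal, map_smul, h]
  simp [wienerReal]

theorem wienerReal_stepVec (j : ℕ) (t : ℝ≥0) :
    wienerReal e hP (stepVec (Set.Ici 0) t (e j)) =ᵐ[P] W j t := by
  filter_upwards [coeFn_wienerVec hP j t] with ω h
  rw [wienerReal, wienerIsometry_stepVec, h, Complex.ofReal_re]

theorem wienerReal_finsupp_sum {ι : Type*} (v : ι → ℕ × ℝ≥0) (c : ι →₀ ℝ) :
    wienerReal e hP (c.sum fun i a => (a : ℂ) • stepFamily e (Set.Ici 0) (v i)) =ᵐ[P]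
      fun ω => c.sum fun i a => a * W (v i).1 (v i).2 ω := by
  classical
  simp only [Finsupp.sum]
  induction c.support using Finset.induction with
  | empty =>
    rw [Finset.sum_empty]
    filter_upwards [Lp.coeFn_zero ℂ 2 P] with ω h
    rw [wienerReal, map_zero, h]
    simp
  | insert i s hi ih =>
    rw [Finset.sum_insert hi]
    filter_upwards [ih, wienerReal_add e hP ((c i : ℂ) • stepFamily e (Set.Ici 0) (v i))
      (∑ i ∈ s, (c i : ℂ) • stepFamily e (Set.Ici 0) (v i)), wienerReal_smul e hP (c i)
      (stepFamily e (Set.Ici 0) (v i)), wienerReal_stepVec e hP (v i).1 (v i).2] with ω h1 h2 h3 h4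
    rw [h2, h3, h1, Finset.sum_insert hi, stepFamily, h4]

/-- Grouped by coordinate, the sum consists of linear functions of the Gaussian vectors
`(W_j(t))_t`, and these are independent for different `j`. The support is enlarged to a rectangle so
that the sum becomes an iterated one. -/
theorem hasGaussianLaw_finsupp_sum {P : Measure WienerPath} (hP : IsWienerMeasure P)
    (c : ℕ × ℝ≥0 →₀ ℝ) :
    HasGaussianLaw (fun ω => c.sum fun p a => a * W p.1 p.2 ω) P := by
  classical
  have hsub : c.support ⊆ c.support.image Prod.fst ×ˢ c.support.image Prod.snd := by
    intro p hp
    exact Finset.mem_product.2 ⟨Finset.mem_image_of_mem _ hp, Finset.mem_image_of_mem _ hp⟩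
  have h1 : (fun ω => c.sum fun p a => a * W p.1 p.2 ω) =
      fun ω => ∑ j : c.support.image Prod.fst, ∑ t ∈ c.support.image Prod.snd,
        c (j.1, t) * W j.1 t ω := by
    ext ω
    rw [Finset.sum_coe_sort (c.support.image Prod.fst) fun j =>
      ∑ t ∈ c.support.image Prod.snd, c (j, t) * W j t ω, ← Finset.sum_product', Finsupp.sum]
    refine Finset.sum_subset hsub fun p _ hp => ?_
    rw [Finsupp.notMem_support_iff.1 hp, zero_mul]
  rw [h1]
  refine iIndepFun.hasGaussianLaw_fun_sum (fun j => ?_) ?_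
  · have h2 := ((hP.brownian j.1).hasLaw (c.support.image Prod.snd)).hasGaussianLaw.map_fun
      (∑ t : c.support.image Prod.snd, c (j.1, t.1) • ContinuousLinearMap.proj (R := ℝ) t)
    convert! h2 using 2 with ω
    rw [← Finset.sum_coe_sort]
    simp
  · exact (hP.indep.precomp (g := fun j : c.support.image Prod.fst => j.1)
      Subtype.val_injective).comp (fun j (w : ℝ≥0 → ℝ) => ∑ t ∈ c.support.image Prod.snd,
        c (j.1, t) * w t) fun j => by fun_prop

/-- The expectation is the inner product with the constant `1`, a continuous functional that
vanishes on all `W_j(t)`, hence on all Wiener integrals. -/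
theorem integral_wienerReal (x : OneParticle Z (Set.Ici 0)) : ∫ ω, wienerReal e hP x ω ∂P = 0 := by
  have := hP.isProbabilityMeasure
  have h1 : (innerSL ℂ (Lp.const 2 P (1 : ℂ))).comp
      (wienerIsometry e hP).toContinuousLinearMap = 0 := by
    refine ContinuousLinearMap.ext_on (dense_span_stepFamily e) ?_
    rintro _ ⟨p, rfl⟩
    rw [ContinuousLinearMap.comp_apply, LinearIsometry.coe_toContinuousLinearMap, stepFamily,
      wienerIsometry_stepVec, innerSL_apply_apply, L2.inner_def, zero_apply]
    have h2 : ∫ ω, ⟪Lp.const 2 P (1 : ℂ) ω, wienerVec hP p.1 p.2 ω⟫_ℂ ∂P =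
        ∫ ω, ((W p.1 p.2 ω : ℝ) : ℂ) ∂P := by
      refine integral_congr_ae ?_
      filter_upwards [Lp.coeFn_const (p := 2) P (1 : ℂ), coeFn_wienerVec hP p.1 p.2] with ω h3 h4
      rw [h3, h4]
      simp
    rw [h2, integral_complex_ofReal, (hP.brownian p.1).integral_eval, Complex.ofReal_zero]
  have h2 := DFunLike.congr_fun h1 x
  rw [ContinuousLinearMap.comp_apply, LinearIsometry.coe_toContinuousLinearMap,
    innerSL_apply_apply, L2.inner_def, zero_apply] at h2
  have h3 : ∫ ω, wienerIsometry e hP x ω ∂P = 0 := by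
    rw [← h2]
    refine integral_congr_ae ?_
    filter_upwards [Lp.coeFn_const (p := 2) P (1 : ℂ)] with ω h3
    rw [h3]
    simp
  have h4 := integral_re ((Lp.memLp (wienerIsometry e hP x)).integrable (by norm_num))
  rw [h3] at h4
  simpa [wienerReal] using h4

theorem integral_wienerReal_mul {x y : OneParticle Z (Set.Ici 0)} (hx : x ∈ realVec e)
    (hy : y ∈ realVec e) :
    ∫ ω, wienerReal e hP x ω * wienerReal e hP y ω ∂P = (⟪x, y⟫_ℂ).re := by
  rw [← (wienerIsometry e hP).inner_map_map, L2.inner_def]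
  have h : ∫ ω, ⟪wienerIsometry e hP x ω, wienerIsometry e hP y ω⟫_ℂ ∂P =
      ∫ ω, ((wienerReal e hP x ω * wienerReal e hP y ω : ℝ) : ℂ) ∂P := by
    refine integral_congr_ae ?_
    filter_upwards [coeFn_wienerIsometry e hP hx, coeFn_wienerIsometry e hP hy] with ω h1 h2
    rw [h1, h2]
    simp [mul_comm]
  rw [h, integral_complex_ofReal, Complex.ofReal_re]

theorem variance_wienerReal {x : OneParticle Z (Set.Ici 0)} (hx : x ∈ realVec e) :
    Var[wienerReal e hP x; P] = ‖x‖ ^ 2 := by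
  rw [variance_of_integral_eq_zero (aestronglyMeasurable_wienerReal e hP x).aemeasurable
    (integral_wienerReal e hP x)]
  simp only [sq]
  rw [integral_wienerReal_mul e hP hx hx, ← sq, inner_self_eq_norm_sq_to_K]
  norm_cast

/-- The map is 1-Lipschitz, because `|exp (i a) - exp (i b)| ≤ |a - b|` and the `L¹` norm is at most
the `L²` norm. Gaussian characteristic functions can thus be passed to `L²` limits. -/
theorem continuous_integral_exp_re [IsProbabilityMeasure P] : Continuous fun g : Lp ℂ 2 P =>
    ∫ ω, Complex.exp (Complex.I * ((g ω).re : ℂ)) ∂P := by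
  have hint : ∀ g : Lp ℂ 2 P, Integrable (fun ω => Complex.exp (Complex.I * ((g ω).re : ℂ))) P := by
    intro g
    refine Integrable.of_bound (C := 1) ?_ (ae_of_all _ fun ω => ?_)
    · have := (Lp.aestronglyMeasurable g).re
      exact (by fun_prop : Continuous fun r : ℝ => Complex.exp (Complex.I * (r : ℂ))
        ).comp_aestronglyMeasurable this
    · rw [mul_comm, Complex.norm_exp_ofReal_mul_I]
  refine (LipschitzWith.of_dist_le_mul (K := 1) fun g g' => ?_).continuous
  rw [dist_eq_norm, dist_eq_norm, ← integral_sub (hint g) (hint g'), NNReal.coe_one, one_mul]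
  have h1 : ∀ᵐ ω ∂P, ‖Complex.exp (Complex.I * ((g ω).re : ℂ)) -
      Complex.exp (Complex.I * ((g' ω).re : ℂ))‖ ≤ ‖(g - g') ω‖ := by
    filter_upwards [Lp.coeFn_sub g g'] with ω h
    have h2 : Complex.exp (Complex.I * ((g ω).re : ℂ)) - Complex.exp (Complex.I * ((g' ω).re : ℂ)) =
        Complex.exp (((g' ω).re : ℂ) * Complex.I) *
          (Complex.exp (Complex.I * ((g ω - g' ω).re : ℝ)) - 1) := by
      rw [mul_sub, mul_one, ← Complex.exp_add]
      congr 2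
      · simp; ring
      · ring
    rw [h2, norm_mul, Complex.norm_exp_ofReal_mul_I, one_mul, h, Pi.sub_apply]
    exact Real.norm_exp_I_mul_ofReal_sub_one_le.trans (Complex.abs_re_le_norm _)
  refine (norm_integral_le_integral_norm _).trans ((integral_mono_of_nonneg
    (ae_of_all _ fun _ => norm_nonneg _)
    ((Lp.memLp (g - g')).integrable (by norm_num)).norm h1).trans ?_)
  rw [integral_norm_eq_lintegral_enorm (Lp.aestronglyMeasurable _),
    ← eLpNorm_one_eq_lintegral_enorm,
    Lp.norm_def]
  exact ENNReal.toReal_mono (Lp.eLpNorm_ne_top _)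
    (eLpNorm_le_eLpNorm_of_exponent_le (by norm_num) (Lp.aestronglyMeasurable _))

/-- Both sides are continuous in `x`. For finite real combinations of step vectors the variable is
Gaussian with mean `0` and variance `‖x‖²`. -/
theorem integral_exp_wienerReal {x : OneParticle Z (Set.Ici 0)} (hx : x ∈ realVec e) :
    ∫ ω, Complex.exp (Complex.I * (wienerReal e hP x ω : ℂ)) ∂P =
      Complex.exp (-((‖x‖ ^ 2 / 2 : ℝ) : ℂ)) := by
  have := hP.isProbabilityMeasure
  refine realSpan_induction (p := fun x =>
    ∫ ω, Complex.exp (Complex.I * (wienerReal e hP x ω : ℂ)) ∂P =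
      Complex.exp (-((‖x‖ ^ 2 / 2 : ℝ) : ℂ))) (isClosed_eq ?_ (by fun_prop)) (fun c => ?_) hx
  · exact continuous_integral_exp_re.comp (wienerIsometry e hP).continuous
  · have h1 := wienerReal_finsupp_sum e hP (fun p => p) c
    have hg := (hasGaussianLaw_finsupp_sum hP c).congr h1.symm
    have h2 := hg.charFun_map_eq (1 : ℝ)
    rw [charFun_apply, integral_map hg.aemeasurable (by fun_prop)] at h2
    have hmem : (c.sum fun i a => (a : ℂ) • stepFamily e (Set.Ici 0) i) ∈ realVec e :=
      Submodule.sum_mem _ fun p _ => smul_mem_realSpan _ (mem_realSpan _ p)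
    simp only [RCLike.inner_apply, map_one, one_mul, mul_one, conj_trivial] at h2
    rw [integral_wienerReal] at h2
    rw [show (fun ω => wienerReal e hP (c.sum fun i a => (a : ℂ) • stepFamily e (Set.Ici 0) i) ω) =
      wienerReal e hP (c.sum fun i a => (a : ℂ) • stepFamily e (Set.Ici 0) i) from rfl,
      variance_wienerReal e hP hmem] at h2
    simp only [mul_comm Complex.I]
    rw [h2]
    congr 1
    push_cast
    ring

end Gaussian

/-! ### Exponential moments of Wiener integrals -/

section ExpMoments

variable {Z : Type*} [NormedAddCommGroup Z] [InnerProductSpace ℂ Z] [CompleteSpace Z]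
  (e : HilbertBasis ℕ ℂ Z) {P : Measure WienerPath} (hP : IsWienerMeasure P)

/-- The characteristic function at `t` is `integral_exp_wienerReal` for the vector `t x`. -/
theorem map_wienerReal {x : OneParticle Z (Set.Ici 0)} (hx : x ∈ realVec e) :
    P.map (wienerReal e hP x) = gaussianReal 0 (‖x‖₊ ^ 2) := by
  have := hP.isProbabilityMeasure
  have hm := (aestronglyMeasurable_wienerReal e hP x).aemeasurable
  have := Measure.isProbabilityMeasure_map hm
  refine Measure.ext_of_charFun ?_
  funext t
  rw [charFun_gaussianReal, charFun_apply, integral_map hm (by fun_prop)]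
  have h := integral_exp_wienerReal e hP (smul_mem_realSpan t hx)
  have h1 : ∫ ω, Complex.exp (((⟪wienerReal e hP x ω, t⟫_ℝ : ℝ) : ℂ) * Complex.I) ∂P =
      ∫ ω, Complex.exp (Complex.I * (wienerReal e hP ((t : ℂ) • x) ω : ℂ)) ∂P := by
    refine integral_congr_ae ?_
    filter_upwards [wienerReal_smul e hP t x] with ω h2
    rw [h2, mul_comm]
    simp
  rw [h1, h, norm_smul, Complex.norm_real, mul_pow, Real.norm_eq_abs, sq_abs]
  congr 1
  push_cast
  simp
  ring

theorem integrable_exp_mul_wienerReal (r : ℝ) {x : OneParticle Z (Set.Ici 0)}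
    (hx : x ∈ realVec e) : Integrable (fun ω => Real.exp (r * wienerReal e hP x ω)) P := by
  have h := integrable_exp_mul_gaussianReal (μ := 0) (v := ‖x‖₊ ^ 2) r
  rw [← map_wienerReal e hP hx] at h
  exact h.comp_aemeasurable (aestronglyMeasurable_wienerReal e hP x).aemeasurable

theorem integral_exp_mul_wienerReal (z : ℂ) {x : OneParticle Z (Set.Ici 0)} (hx : x ∈ realVec e) :
    ∫ ω, Complex.exp (z * wienerReal e hP x ω) ∂P = Complex.exp (z ^ 2 * (‖x‖ : ℂ) ^ 2 / 2) := by
  have h := complexMGF_gaussianReal (map_wienerReal e hP hx) z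
  rw [complexMGF] at h
  rw [h]
  congr 1
  push_cast
  simp
  ring

/-- The joint characteristic function at `(a, b)` belongs to the vector `a x + b y`. It factors
since `‖a x + b y‖² = a² ‖x‖² + b² ‖y‖²`. -/
theorem indepFun_wienerReal {x y : OneParticle Z (Set.Ici 0)} (hx : x ∈ realVec e)
    (hy : y ∈ realVec e) (hxy : ⟪x, y⟫_ℂ = 0) :
    IndepFun (wienerReal e hP x) (wienerReal e hP y) P := by
  have := hP.isProbabilityMeasure
  have mx := (aestronglyMeasurable_wienerReal e hP x).aemeasurable
  have my := (aestronglyMeasurable_wienerReal e hP y).aemeasurable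
  rw [indepFun_iff_charFun_prod mx my]
  intro t
  have mxy : AEMeasurable (fun ω => WithLp.toLp 2 (wienerReal e hP x ω, wienerReal e hP y ω)) P :=
    (WithLp.measurable_toLp 2 (ℝ × ℝ)).comp_aemeasurable (mx.prodMk my)
  rw [map_wienerReal e hP hx, map_wienerReal e hP hy, charFun_gaussianReal, charFun_gaussianReal,
    charFun_apply, integral_map mxy (by fun_prop)]
  set a := t.ofLp.1
  set b := t.ofLp.2
  have hax := smul_mem_realSpan a hx
  have hby := smul_mem_realSpan b hy
  have h := integral_exp_wienerReal e hP (Submodule.add_mem _ hax hby)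
  have h1 : ∫ ω, Complex.exp (((⟪WithLp.toLp 2 (wienerReal e hP x ω, wienerReal e hP y ω), t⟫_ℝ : ℝ)
      : ℂ) * Complex.I) ∂P =
      ∫ ω, Complex.exp (Complex.I * (wienerReal e hP ((a : ℂ) • x + (b : ℂ) • y) ω : ℂ)) ∂P := by
    refine integral_congr_ae ?_
    filter_upwards [wienerReal_smul e hP a x, wienerReal_smul e hP b y,
      wienerReal_add e hP ((a : ℂ) • x) ((b : ℂ) • y)] with ω h2 h3 h4
    rw [h4, h2, h3, mul_comm, WithLp.prod_inner_apply]
    simp [a, b]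
  have h5 : ‖(a : ℂ) • x + (b : ℂ) • y‖ ^ 2 = a ^ 2 * ‖x‖ ^ 2 + b ^ 2 * ‖y‖ ^ 2 := by
    rw [@norm_add_sq ℂ, inner_smul_left, inner_smul_right, hxy, norm_smul, norm_smul]
    simp [mul_pow]
  rw [h1, h, h5, ← Complex.exp_add]
  congr 1
  push_cast
  simp
  ring

/-- Decompose `y = a x + r` with `r` real and orthogonal to `x`. The integrand becomes `exp ((1 + i
a) X) exp (i R)`, whose factors are independent Gaussian exponentials. -/
theorem integral_exp_wienerReal_add {x y : OneParticle Z (Set.Ici 0)} (hx : x ∈ realVec e)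
    (hy : y ∈ realVec e) :
    ∫ ω, Complex.exp (wienerReal e hP x ω + Complex.I * wienerReal e hP y ω) ∂P =
      Complex.exp (((‖x‖ : ℂ) ^ 2 - (‖y‖ : ℂ) ^ 2) / 2 + Complex.I * ⟪x, y⟫_ℂ) := by
  -- The coefficient of the projection of `y` onto `x`. For `x = 0` the division returns `0`, and
  -- the formula `hxy` still holds.
  set a : ℝ := (⟪x, y⟫_ℂ).re / ‖x‖ ^ 2 with ha
  have hxy : ⟪x, y⟫_ℂ = a * (‖x‖ : ℂ) ^ 2 := by
    rw [inner_realVec e hx hy, ha]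
    by_cases h0 : x = 0
    · simp [h0]
    · have : (‖x‖ : ℂ) ≠ 0 := by simpa using h0
      push_cast
      field_simp
  set r := y + ((-a : ℝ) : ℂ) • x with hr
  have hrm : r ∈ realVec e := Submodule.add_mem _ hy (smul_mem_realSpan _ hx)
  have hxr : ⟪x, r⟫_ℂ = 0 := by
    rw [hr, inner_add_right, inner_smul_right, hxy, inner_self_eq_norm_sq_to_K]
    push_cast
    simp
  have hyr : y = (a : ℂ) • x + r := by
    rw [hr]; push_cast; module
  have hy2 : (‖y‖ : ℂ) ^ 2 = a ^ 2 * (‖x‖ : ℂ) ^ 2 + (‖r‖ : ℂ) ^ 2 := by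
    have h5 : ‖(a : ℂ) • x + r‖ ^ 2 = a ^ 2 * ‖x‖ ^ 2 + ‖r‖ ^ 2 := by
      rw [@norm_add_sq ℂ, inner_smul_left, hxr, norm_smul]
      simp [mul_pow]
    rw [← hyr] at h5
    exact_mod_cast h5
  have h1 : ∫ ω, Complex.exp (wienerReal e hP x ω + Complex.I * wienerReal e hP y ω) ∂P =
      ∫ ω, Complex.exp ((1 + a * Complex.I) * wienerReal e hP x ω) *
        Complex.exp (Complex.I * wienerReal e hP r ω) ∂P := by
    refine integral_congr_ae ?_
    filter_upwards [wienerReal_smul e hP a x, wienerReal_add e hP ((a : ℂ) • x) r] with ω h2 h3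
    rw [← hyr] at h3
    rw [h3, h2, ← Complex.exp_add]
    congr 1
    push_cast
    ring
  rw [h1, (indepFun_wienerReal e hP hx hrm hxr).integral_fun_comp_mul_comp
    (f := fun s : ℝ => Complex.exp ((1 + a * Complex.I) * s))
    (g := fun s : ℝ => Complex.exp (Complex.I * s))
    (aestronglyMeasurable_wienerReal e hP x).aemeasurable
    (aestronglyMeasurable_wienerReal e hP r).aemeasurable (by fun_prop) (by fun_prop),
    integral_exp_mul_wienerReal e hP _ hx, integral_exp_mul_wienerReal e hP _ hrm,
    ← Complex.exp_add, hy2, hxy]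
  congr 1
  linear_combination (norm := (ring_nf))
    ((a : ℂ) ^ 2 * (‖x‖ : ℂ) ^ 2 + (‖r‖ : ℂ) ^ 2) / 2 * Complex.I_sq

theorem memLp_exp_wienerReal {x : OneParticle Z (Set.Ici 0)} (hx : x ∈ realVec e) :
    MemLp (fun ω => Real.exp (wienerReal e hP x ω)) 2 P := by
  have hm : AEStronglyMeasurable (fun ω => Real.exp (wienerReal e hP x ω)) P :=
    Real.continuous_exp.comp_aestronglyMeasurable (aestronglyMeasurable_wienerReal e hP x)
  rw [memLp_two_iff_integrable_sq hm]
  refine (integrable_exp_mul_wienerReal e hP 2 hx).congr (ae_of_all _ fun ω => ?_)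
  change _ = Real.exp _ ^ 2
  rw [← Real.exp_nat_mul]
  norm_num

theorem coeFn_wienerIsometry_add_I_smul {x y : OneParticle Z (Set.Ici 0)} (hx : x ∈ realVec e)
    (hy : y ∈ realVec e) : wienerIsometry e hP (x + Complex.I • y) =ᵐ[P]
      fun ω => (wienerReal e hP x ω : ℂ) + Complex.I * wienerReal e hP y ω := by
  rw [map_add, map_smul]
  filter_upwards [coeFn_wienerIsometry e hP hx, coeFn_wienerIsometry e hP hy,
    Lp.coeFn_add (wienerIsometry e hP x) (Complex.I • wienerIsometry e hP y),
    Lp.coeFn_smul Complex.I (wienerIsometry e hP y)] with ω h1 h2 h3 h4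
  rw [h3, Pi.add_apply, h4, Pi.smul_apply, h1, h2, smul_eq_mul]

/-- The modulus of `exp (X + i Y)` is `exp X`. -/
theorem memLp_exp_wienerIsometry (f : OneParticle Z (Set.Ici 0)) :
    MemLp (fun ω => Complex.exp (wienerIsometry e hP f ω)) 2 P := by
  obtain ⟨x, hx, y, hy, rfl⟩ := exists_realVec e f
  refine (memLp_exp_wienerReal e hP hx).of_le
    (Complex.continuous_exp.comp_aestronglyMeasurable (Lp.aestronglyMeasurable _)) ?_
  filter_upwards [coeFn_wienerIsometry_add_I_smul e hP hx hy] with ω h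
  rw [Complex.norm_exp, h, Real.norm_eq_abs, Real.abs_exp]
  simp

end ExpMoments

/-! ### Stochastic exponentials -/

section StochExp

variable {Z : Type*} [NormedAddCommGroup Z] [InnerProductSpace ℂ Z] [CompleteSpace Z]
  (e : HilbertBasis ℕ ℂ Z) {P : Measure WienerPath} (hP : IsWienerMeasure P)

/-- As `x` and `y` have real components, the conjugate of `(x - i y)_j` is `(x + i y)_j`. The
integral of the square is therefore an inner product, and the series is Parseval's identity for `⟪x
- i y, x + i y⟫`. -/
theorem hasSum_integral_sq {x y : OneParticle Z (Set.Ici 0)} (hx : x ∈ realVec e)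
    (hy : y ∈ realVec e) :
    HasSum (fun j => ∫ t in Set.Ici (0 : ℝ), (⟪e j, (x + Complex.I • y) t⟫_ℂ) ^ 2)
      ((‖x‖ : ℂ) ^ 2 - (‖y‖ : ℂ) ^ 2 + 2 * Complex.I * ⟪x, y⟫_ℂ) := by
  have h := hasSum_inner_coord e (x - Complex.I • y) (x + Complex.I • y)
  have hyx : ⟪y, x⟫_ℂ = ⟪x, y⟫_ℂ := by
    rw [← inner_conj_symm, inner_realVec e hx hy, Complex.conj_ofReal]
  have h1 : ⟪x - Complex.I • y, x + Complex.I • y⟫_ℂ =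
      (‖x‖ : ℂ) ^ 2 - (‖y‖ : ℂ) ^ 2 + 2 * Complex.I * ⟪x, y⟫_ℂ := by
    simp only [inner_add_right, inner_sub_left, inner_smul_left, inner_smul_right, hyx,
      inner_self_eq_norm_sq_to_K, Complex.conj_I, RCLike.ofReal_eq_complex_ofReal]
    linear_combination (‖y‖ : ℂ) ^ 2 * Complex.I_sq
  rw [← h1]
  convert h using 2 with j
  rw [L2.inner_def]
  refine integral_congr_ae ?_
  filter_upwards [coeFn_coord e j (x - Complex.I • y), coeFn_coord e j (x + Complex.I • y),
    Lp.coeFn_sub x (Complex.I • y), Lp.coeFn_add x (Complex.I • y), Lp.coeFn_smul Complex.I y,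
    im_inner_eq_zero_of_mem_realVec e hx j, im_inner_eq_zero_of_mem_realVec e hy j]
    with t h2 h3 h4 h5 h6 h7 h8
  rw [h2, h3, h4, h5, Pi.add_apply, Pi.sub_apply, h6, Pi.smul_apply, inner_add_right,
    inner_sub_right, inner_smul_right, RCLike.inner_apply, map_sub, map_mul, Complex.conj_I,
    Complex.conj_eq_iff_im.2 h7, Complex.conj_eq_iff_im.2 h8]
  ring

/-- The sum `∑_j ∫₀^∞ f_j² dt`. -/
def sqSum (f : OneParticle Z (Set.Ici 0)) : ℂ :=
  ∑' j, ∫ t in Set.Ici (0 : ℝ), (⟪e j, f t⟫_ℂ) ^ 2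

theorem sqSum_add_I_smul {x y : OneParticle Z (Set.Ici 0)} (hx : x ∈ realVec e)
    (hy : y ∈ realVec e) : sqSum e (x + Complex.I • y) =
      (‖x‖ : ℂ) ^ 2 - (‖y‖ : ℂ) ^ 2 + 2 * Complex.I * ⟪x, y⟫_ℂ :=
  (hasSum_integral_sq e hx hy).tsum_eq

theorem hasSum_sqSum (f : OneParticle Z (Set.Ici 0)) :
    HasSum (fun j => ∫ t in Set.Ici (0 : ℝ), (⟪e j, f t⟫_ℂ) ^ 2) (sqSum e f) := by
  obtain ⟨x, hx, y, hy, rfl⟩ := exists_realVec e f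
  exact (hasSum_integral_sq e hx hy).summable.hasSum

theorem hasSum_expTerm [IsProbabilityMeasure P] (f : OneParticle Z (Set.Ici 0)) :
    HasSum (expTerm e hP f) (wienerIsometry e hP f - Lp.const 2 P (1 / 2 * sqSum e f)) := by
  have h := (Lp.constL 2 P ℂ).hasSum ((hasSum_sqSum e f).mul_left (1 / 2))
  exact (hasSum_wienerIntegral e hP f).sub h

theorem stochExp_ae_eq (f : OneParticle Z (Set.Ici 0)) : stochExp e hP f =ᵐ[P] fun ω =>
    Complex.exp (-(1 / 2) * sqSum e f) * Complex.exp (wienerIsometry e hP f ω) := by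
  have := hP.isProbabilityMeasure
  filter_upwards [Lp.coeFn_sub (wienerIsometry e hP f) (Lp.const 2 P (1 / 2 * sqSum e f)),
    Lp.coeFn_const (p := 2) P (1 / 2 * sqSum e f)] with ω h1 h2
  rw [stochExp, (hasSum_expTerm e hP f).tsum_eq, h1, Pi.sub_apply, h2, ← Complex.exp_add]
  congr 1
  simp only [Function.const_apply]
  ring

theorem memLp_stochExp (f : OneParticle Z (Set.Ici 0)) : MemLp (stochExp e hP f) 2 P :=
  ((memLp_exp_wienerIsometry e hP f).const_mul _).ae_eq (stochExp_ae_eq e hP f).symm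

/-- The stochastic exponential as an element of Wiener space. -/
def stochVec (f : OneParticle Z (Set.Ici 0)) : WienerSpace P := (memLp_stochExp e hP f).toLp

theorem coeFn_stochVec (f : OneParticle Z (Set.Ici 0)) : stochVec e hP f =ᵐ[P] fun ω =>
    Complex.exp (-(1 / 2) * sqSum e f) * Complex.exp (wienerIsometry e hP f ω) :=
  (memLp_stochExp e hP f).coeFn_toLp.trans (stochExp_ae_eq e hP f)

/-- With `f = x + i y` and `g = x' + i y'`, the integrand is a constant times the exponential of the
Wiener integral of `x' + x` plus `i` times that of `y - y'`. After integration the terms with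
`sqSum` cancel all but `⟪g, f⟫` in the exponent. -/
theorem inner_stochVec (g f : OneParticle Z (Set.Ici 0)) :
    ⟪stochVec e hP g, stochVec e hP f⟫_ℂ = ⟪expVec g, expVec f⟫_ℂ := by
  rw [inner_expVec, L2.inner_def]
  have h1 := coeFn_stochVec e hP g
  have h2 := coeFn_stochVec e hP f
  obtain ⟨x, hx, y, hy, rfl⟩ := exists_realVec e f
  obtain ⟨x', hx', y', hy', rfl⟩ := exists_realVec e g
  have hny : ((-1 : ℝ) : ℂ) • y' ∈ realVec e := smul_mem_realSpan _ hy'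
  have h3 : ∫ ω, ⟪stochVec e hP (x' + Complex.I • y') ω, stochVec e hP (x + Complex.I • y) ω⟫_ℂ ∂P =
      ∫ ω, Complex.exp (-(1 / 2) * conj (sqSum e (x' + Complex.I • y')) -
        1 / 2 * sqSum e (x + Complex.I • y)) * Complex.exp (wienerReal e hP (x' + x) ω +
          Complex.I * wienerReal e hP (((-1 : ℝ) : ℂ) • y' + y) ω) ∂P := by
    refine integral_congr_ae ?_
    filter_upwards [h1, h2, coeFn_wienerIsometry_add_I_smul e hP hx hy,
      coeFn_wienerIsometry_add_I_smul e hP hx' hy', wienerReal_add e hP x' x,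
      wienerReal_add e hP (((-1 : ℝ) : ℂ) • y') y, wienerReal_smul e hP (-1) y']
      with ω k1 k2 k3 k4 k5 k6 k7
    rw [k1, k2, k3, k4, k5, k6, k7, RCLike.inner_apply, map_mul, ← Complex.exp_conj,
      ← Complex.exp_conj, ← Complex.exp_add, ← Complex.exp_add, ← Complex.exp_add,
      ← Complex.exp_add]
    congr 1
    simp only [map_mul, map_add, map_neg, map_div₀, map_one, map_ofNat, Complex.conj_I,
      Complex.conj_ofReal]
    push_cast
    ring
  have hsw : ∀ {a b : OneParticle Z (Set.Ici 0)}, a ∈ realVec e → b ∈ realVec e →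
      ⟪b, a⟫_ℂ = ⟪a, b⟫_ℂ := fun ha hb => by
    rw [← inner_conj_symm, inner_realVec e ha hb, Complex.conj_ofReal]
  have hself : ∀ a : OneParticle Z (Set.Ici 0), (‖a‖ : ℂ) ^ 2 = ⟪a, a⟫_ℂ := fun a => by
    rw [inner_self_eq_norm_sq_to_K]; rfl
  rw [h3, integral_const_mul, integral_exp_wienerReal_add e hP (Submodule.add_mem _ hx' hx)
    (Submodule.add_mem _ hny hy), ← Complex.exp_add, sqSum_add_I_smul e hx hy,
    sqSum_add_I_smul e hx' hy']
  congr 1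
  have hc : conj ⟪x', y'⟫_ℂ = ⟪x', y'⟫_ℂ := by
    rw [inner_realVec e hx' hy', Complex.conj_ofReal]
  simp only [map_mul, map_add, map_sub, map_pow, map_ofNat, Complex.conj_I, Complex.conj_ofReal, hc]
  simp only [hself, inner_add_left, inner_add_right, inner_smul_left, inner_smul_right,
    Complex.conj_ofReal, hsw hx hx', hsw hy hy', hsw hx hy', Complex.conj_I]
  rw [hsw hx' hx, hsw hy' hy]
  push_cast
  linear_combination (⟪y', y⟫_ℂ) * Complex.I_sq

end StochExp

/-! ### The unitary isomorphism of Fock space onto Wiener space -/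

section Isomorphism

variable {Z : Type*} [NormedAddCommGroup Z] [InnerProductSpace ℂ Z] [CompleteSpace Z]
  (e : HilbertBasis ℕ ℂ Z) {P : Measure WienerPath} (hP : IsWienerMeasure P)

theorem sigmaAlg_le (t : ℝ≥0) : sigmaAlg t ≤ (inferInstance : MeasurableSpace WienerPath) :=
  iSup₂_le fun j s => (measurable_W j s).comap_le

theorem setIntegral_eq_zero_of_realVec {ι : Type*} (v : ι → ℕ × ℝ≥0) {w : WienerPath → ℂ}
    (hw : Integrable w P)
    (h : ∀ x ∈ realSpan fun i => stepFamily e (Set.Ici 0) (v i),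
      ∫ ω, w ω * Complex.exp (Complex.I * wienerReal e hP x ω) ∂P = 0) {A : Set WienerPath}
    (hA : MeasurableSet[⨆ i, MeasurableSpace.comap (W (v i).1 (v i).2) inferInstance] A) :
    ∫ ω in A, w ω ∂P = 0 := by
  refine setIntegral_eq_zero_of_charFun (X := fun i => W (v i).1 (v i).2)
    (fun i => measurable_W _ _) hw (fun c => ?_) hA
  rw [← h (c.sum fun i a => (a : ℂ) • stepFamily e (Set.Ici 0) (v i))
    (Submodule.sum_mem _ fun i _ => smul_mem_realSpan _ (mem_realSpan _ i))]
  refine integral_congr_ae ?_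
  filter_upwards [wienerReal_finsupp_sum e hP v c] with ω h1
  rw [h1]

/-- An integrable function on Wiener space whose products with the exponentials
`exp (i ∑_j ∫ x_j dW_j)`, `x` real and vanishing after `t`, have expectation zero has integral zero
over all events up to time `t`. -/
theorem setIntegral_eq_zero_of_realVecUpTo {t : ℝ≥0} {w : WienerPath → ℂ} (hw : Integrable w P)
    (h : ∀ x ∈ realVecUpTo e t,
      ∫ ω, w ω * Complex.exp (Complex.I * wienerReal e hP x ω) ∂P = 0) {A : Set WienerPath}
    (hA : MeasurableSet[sigmaAlg t] A) : ∫ ω in A, w ω ∂P = 0 := by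
  refine setIntegral_eq_zero_of_realVec e hP (fun p : ℕ × Set.Iic t => (p.1, (p.2 : ℝ≥0))) hw h ?_
  rwa [iSup_prod]

/-- An integrable function on Wiener space whose products with the exponentials
`exp (i ∑_j ∫ x_j dW_j)`, `x` real, have expectation zero vanishes. -/
theorem ae_eq_zero_of_realVec {w : WienerPath → ℂ} (hw : Integrable w P)
    (h : ∀ x ∈ realVec e, ∫ ω, w ω * Complex.exp (Complex.I * wienerReal e hP x ω) ∂P = 0) :
    w =ᵐ[P] 0 := by
  refine hw.ae_eq_zero_of_forall_setIntegral_eq_zero fun A hA _ => ?_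
  refine setIntegral_eq_zero_of_realVec e hP (fun p : ℕ × ℝ≥0 => p) hw h ?_
  rwa [iSup_prod]

/-- Purely imaginary vectors supply all the characters, which is what the density proofs use. -/
theorem coeFn_stochVec_I_smul {x : OneParticle Z (Set.Ici 0)} (hx : x ∈ realVec e) :
    ∃ c : ℂ, c ≠ 0 ∧ stochVec e hP (Complex.I • x) =ᵐ[P] fun ω =>
      c * Complex.exp (Complex.I * wienerReal e hP x ω) := by
  refine ⟨_, Complex.exp_ne_zero (-(1 / 2) * sqSum e (Complex.I • x)), ?_⟩
  filter_upwards [coeFn_stochVec e hP (Complex.I • x), coeFn_wienerIsometry_add_I_smul e hP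
    (Submodule.zero_mem (realVec e)) hx, Lp.coeFn_zero ℂ 2 P] with ω h1 h2 h3
  rw [zero_add] at h2
  rw [h1, h2, wienerReal, map_zero, h3]
  simp

theorem dense_span_stochVec :
    Dense (Submodule.span ℂ (Set.range (stochVec e hP)) : Set (WienerSpace P)) := by
  have := hP.isProbabilityMeasure
  rw [Submodule.dense_iff_topologicalClosure_eq_top, Submodule.topologicalClosure_eq_top_iff,
    Submodule.eq_bot_iff]
  intro u hu
  refine Lp.eq_zero_iff_ae_eq_zero.2 (ae_eq_zero_of_realVec e hP
    ((Lp.memLp u).integrable (by norm_num)) fun x hx => ?_)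
  -- The sign compensates for the conjugation in the first argument of the inner product.
  have hx' := smul_mem_realSpan (-1) hx
  obtain ⟨c, hc, h⟩ := coeFn_stochVec_I_smul e hP hx'
  have h1 := (Submodule.mem_orthogonal _ _).1 hu _
    (Submodule.subset_span ⟨Complex.I • ((-1 : ℝ) : ℂ) • x, rfl⟩)
  rw [L2.inner_def] at h1
  have h2 : ∫ ω, ⟪stochVec e hP (Complex.I • ((-1 : ℝ) : ℂ) • x) ω, u ω⟫_ℂ ∂P =
      ∫ ω, conj c * (u ω * Complex.exp (Complex.I * wienerReal e hP x ω)) ∂P := by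
    refine integral_congr_ae ?_
    filter_upwards [h, wienerReal_smul e hP (-1) x] with ω h3 h4
    rw [h3, h4, RCLike.inner_apply, map_mul, ← Complex.exp_conj, map_mul, Complex.conj_I,
      Complex.conj_ofReal]
    push_cast
    ring_nf
  rw [h2, integral_const_mul] at h1
  exact (mul_eq_zero.1 h1).resolve_left ((map_ne_zero _).2 hc)

/-- The unitary isomorphism of Fock space onto Wiener space that maps the exponential vectors to the
stochastic exponentials. -/
def fockWiener : FockSpace (OneParticle Z (Set.Ici 0)) ≃ₗᵢ[ℂ] WienerSpace P :=
  gramUnitary expVec (stochVec e hP) dense_span_expVec (dense_span_stochVec e hP)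
    (inner_stochVec e hP)

theorem fockWiener_expVec (f : OneParticle Z (Set.Ici 0)) :
    fockWiener e hP (expVec f) = stochVec e hP f :=
  gramUnitary_apply _ _ _ _ _ f

theorem eq_fockWiener {I : FockSpace (OneParticle Z (Set.Ici 0)) ≃ₗᵢ[ℂ] WienerSpace P}
    (hI : ∀ f, I (expVec f) =ᵐ[P] stochExp e hP f) : I = fockWiener e hP := by
  have h : I.toContinuousLinearEquiv.toContinuousLinearMap =
      (fockWiener e hP).toContinuousLinearEquiv.toContinuousLinearMap := by
    refine ContinuousLinearMap.ext_on dense_span_expVec ?_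
    rintro _ ⟨f, rfl⟩
    change I (expVec f) = fockWiener e hP (expVec f)
    rw [fockWiener_expVec]
    exact Lp.ext ((hI f).trans (memLp_stochExp e hP f).coeFn_toLp.symm)
  ext1 u
  exact DFunLike.congr_fun h u

/-! ### Weyl operators as multiplication operators -/

theorem memLp_top_exp (x : OneParticle Z (Set.Ici 0)) :
    MemLp (fun ω => Complex.exp (Complex.I * wienerReal e hP x ω)) ∞ P := by
  refine memLp_top_of_bound ?_ 1 (ae_of_all _ fun ω => ?_)
  · exact (by fun_prop : Continuous fun r : ℝ => Complex.exp (Complex.I * (r : ℂ))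
      ).comp_aestronglyMeasurable (aestronglyMeasurable_wienerReal e hP x)
  · rw [mul_comm, Complex.norm_exp_ofReal_mul_I]

/-- Multiplication by `exp (i ∑_j ∫ x_j dW_j)`. -/
def expMul (x : OneParticle Z (Set.Ici 0)) : WienerSpace P →L[ℂ] WienerSpace P :=
  mulOp (memLp_top_exp e hP x).toLp

theorem coeFn_expMul (x : OneParticle Z (Set.Ici 0)) (u : WienerSpace P) :
    expMul e hP x u =ᵐ[P] fun ω => Complex.exp (Complex.I * wienerReal e hP x ω) * u ω :=
  coeFn_mulOp_toLp (memLp_top_exp e hP x) u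

/-- For `f = a + i b` the factor `exp (i X)` is absorbed by replacing `b` with `b + x`. The change
of `sqSum` produces exactly the scalar of the Weyl operator. -/
theorem expMul_stochVec {x : OneParticle Z (Set.Ici 0)} (hx : x ∈ realVec e)
    (f : OneParticle Z (Set.Ici 0)) : expMul e hP x (stochVec e hP f) =
      Complex.exp (-(1 / 2) * (‖Complex.I • x‖ : ℂ) ^ 2 - ⟪Complex.I • x, f⟫_ℂ) •
        stochVec e hP (f + Complex.I • x) := by
  have h0 := coeFn_stochVec e hP f
  have h1 := coeFn_stochVec e hP (f + Complex.I • x)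
  refine Lp.ext ?_
  refine (coeFn_expMul e hP x _).trans ?_
  obtain ⟨a, ha, b, hb, rfl⟩ := exists_realVec e f
  have e1 : a + Complex.I • b + Complex.I • x = a + Complex.I • (b + x) := by module
  rw [e1] at h1 ⊢
  have hself : ∀ a : OneParticle Z (Set.Ici 0), (‖a‖ : ℂ) ^ 2 = ⟪a, a⟫_ℂ := fun a => by
    rw [inner_self_eq_norm_sq_to_K]; rfl
  filter_upwards [h0, h1, Lp.coeFn_smul (Complex.exp (-(1 / 2) * (‖Complex.I • x‖ : ℂ) ^ 2 -
    ⟪Complex.I • x, a + Complex.I • b⟫_ℂ)) (stochVec e hP (a + Complex.I • (b + x))),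
    coeFn_wienerIsometry_add_I_smul e hP ha hb,
    coeFn_wienerIsometry_add_I_smul e hP ha (Submodule.add_mem _ hb hx),
    wienerReal_add e hP b x] with ω k1 k2 k3 k4 k5 k6
  rw [k3, Pi.smul_apply, k2, k1, k4, k5, k6, sqSum_add_I_smul e ha hb,
    sqSum_add_I_smul e ha (Submodule.add_mem _ hb hx), smul_eq_mul]
  simp only [← Complex.exp_add]
  congr 1
  have hxa : ⟪x, a⟫_ℂ = ⟪a, x⟫_ℂ := by
    rw [← inner_conj_symm, inner_realVec e ha hx, Complex.conj_ofReal]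
  have hxb : ⟪x, b⟫_ℂ = ⟪b, x⟫_ℂ := by
    rw [← inner_conj_symm, inner_realVec e hb hx, Complex.conj_ofReal]
  simp only [norm_smul, Complex.norm_I, one_mul, hself, inner_add_left, inner_add_right,
    inner_smul_left, inner_smul_right, Complex.conj_I, hxa, hxb]
  push_cast
  linear_combination (-⟪b, x⟫_ℂ) * Complex.I_sq

theorem conjBy_weyl {x : OneParticle Z (Set.Ici 0)} (hx : x ∈ realVec e) :
    conjBy (fockWiener e hP) (weyl (Complex.I • x)
      (LinearIsometryEquiv.refl ℂ _)).toContinuousLinearEquiv.toContinuousLinearMap =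
      expMul e hP x := by
  refine ContinuousLinearMap.ext_on (dense_span_stochVec e hP) ?_
  rintro _ ⟨f, rfl⟩
  rw [expMul_stochVec e hP hx]
  change fockWiener e hP (weyl (Complex.I • x) (LinearIsometryEquiv.refl ℂ _)
    ((fockWiener e hP).symm (stochVec e hP f))) = _
  rw [← fockWiener_expVec, LinearIsometryEquiv.symm_apply_apply, weyl_expVec, map_smul,
    fockWiener_expVec]
  rfl

theorem fockWiener_weylAt (k : RealLocL2 e) (t : ℝ≥0) (u : WienerSpace P) :
    fockWiener e hP (weylAt (Set.Ici 0) k t ((fockWiener e hP).symm u)) =ᵐ[P] fun ω =>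
      Complex.exp (Complex.I *
        (∑' j, wienerIntegral hP j (coord e j (k.cut (Set.Ici 0) t)) : WienerSpace P) ω) * u ω := by
  have h := DFunLike.congr_fun (conjBy_weyl e hP (cut_mem_realVec e k t)) u
  change fockWiener e hP (weylAt (Set.Ici 0) k t ((fockWiener e hP).symm u)) = _ at h
  rw [h, (hasSum_wienerIntegral e hP _).tsum_eq]
  filter_upwards [coeFn_expMul e hP (k.cut (Set.Ici 0) t) u,
    coeFn_wienerIsometry e hP (cut_mem_realVec e k t)] with ω h1 h2
  rw [h1, h2]

end Isomorphism

/-! ### Field operators as multiplication operators -/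

section Field

variable {Z : Type*} [NormedAddCommGroup Z] [InnerProductSpace ℂ Z] [CompleteSpace Z]
  (e : HilbertBasis ℕ ℂ Z) {P : Measure WienerPath} (hP : IsWienerMeasure P)

/-- The function `sqSum` is the quadratic form of a complex bilinear form, which for real `g` takes
the value `⟪g, f⟫` at `(g, f)`. -/
theorem sqSum_add_smul {g : OneParticle Z (Set.Ici 0)} (hg : g ∈ realVec e)
    (f : OneParticle Z (Set.Ici 0)) (z : ℂ) :
    sqSum e (f + z • g) = sqSum e f + 2 * z * ⟪g, f⟫_ℂ + z ^ 2 * (‖g‖ : ℂ) ^ 2 := by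
  obtain ⟨x, hx, y, hy, rfl⟩ := exists_realVec e f
  obtain ⟨a, b, rfl⟩ : ∃ a b : ℝ, z = a + b * Complex.I := ⟨_, _, (Complex.re_add_im z).symm⟩
  have e1 : x + Complex.I • y + ((a : ℂ) + b * Complex.I) • g =
      (x + (a : ℂ) • g) + Complex.I • (y + (b : ℂ) • g) := by module
  have hself : ∀ a : OneParticle Z (Set.Ici 0), (‖a‖ : ℂ) ^ 2 = ⟪a, a⟫_ℂ := fun a => by
    rw [inner_self_eq_norm_sq_to_K]; rfl
  have hgx : ⟪x, g⟫_ℂ = ⟪g, x⟫_ℂ := by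
    rw [← inner_conj_symm, inner_realVec e hg hx, Complex.conj_ofReal]
  have hgy : ⟪y, g⟫_ℂ = ⟪g, y⟫_ℂ := by
    rw [← inner_conj_symm, inner_realVec e hg hy, Complex.conj_ofReal]
  rw [e1, sqSum_add_I_smul e hx hy, sqSum_add_I_smul e
    (Submodule.add_mem _ hx (smul_mem_realSpan a hg))
    (Submodule.add_mem _ hy (smul_mem_realSpan b hg))]
  simp only [hself, inner_add_left, inner_add_right, inner_smul_left, inner_smul_right,
    Complex.conj_ofReal, hgx, hgy]
  linear_combination (-2 * (b : ℂ) * ⟪g, y⟫_ℂ - b ^ 2 * ⟪g, g⟫_ℂ) * Complex.I_sq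

/-- The function `z ↦ exp (z ∑_j ∫ g_j dW_j) E_W(f)`. -/
def expCurve (g f : OneParticle Z (Set.Ici 0)) (z : ℂ) : WienerSpace P :=
  Complex.exp (z * ⟪g, f⟫_ℂ + z ^ 2 * (‖g‖ : ℂ) ^ 2 / 2) • stochVec e hP (f + z • g)

/-- The scalar in `expCurve` cancels the change of `sqSum` from `f` to `f + z g`. Written through
`stochVec`, the product is in `L²` without further estimates. -/
theorem coeFn_expCurve {g : OneParticle Z (Set.Ici 0)} (hg : g ∈ realVec e)
    (f : OneParticle Z (Set.Ici 0)) (z : ℂ) : expCurve e hP g f z =ᵐ[P] fun ω =>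
      Complex.exp (z * wienerReal e hP g ω) * stochVec e hP f ω := by
  filter_upwards [Lp.coeFn_smul (Complex.exp (z * ⟪g, f⟫_ℂ + z ^ 2 * (‖g‖ : ℂ) ^ 2 / 2))
      (stochVec e hP (f + z • g)), coeFn_stochVec e hP (f + z • g), coeFn_stochVec e hP f,
    coeFn_wienerIsometry e hP hg, Lp.coeFn_add (wienerIsometry e hP f) (z • wienerIsometry e hP g),
    Lp.coeFn_smul z (wienerIsometry e hP g)] with ω h1 h2 h3 h4 h5 h6
  rw [expCurve, h1, Pi.smul_apply, h2, h3, sqSum_add_smul e hg, map_add, map_smul, h5, Pi.add_apply,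
    h6, Pi.smul_apply, h4, smul_eq_mul, smul_eq_mul]
  simp only [← Complex.exp_add]
  congr 1
  ring

theorem abs_le_exp_add_exp_neg (r : ℝ) : |r| ≤ Real.exp r + Real.exp (-r) := by
  have h1 := Real.add_one_le_exp r
  have h2 := Real.add_one_le_exp (-r)
  have h3 := Real.exp_pos r
  have h4 := Real.exp_pos (-r)
  rw [abs_le]
  constructor <;> linarith

/-- Since `|X| ≤ exp X + exp (-X)`, the product is dominated by the moduli of `expCurve` at `1` and
`-1`. -/
theorem memLp_mul_stochVec {g : OneParticle Z (Set.Ici 0)} (hg : g ∈ realVec e)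
    (f : OneParticle Z (Set.Ici 0)) :
    MemLp (fun ω => (wienerReal e hP g ω : ℂ) * stochVec e hP f ω) 2 P := by
  refine MemLp.of_le ((Lp.memLp (expCurve e hP g f 1)).norm.add
    (Lp.memLp (expCurve e hP g f (-1))).norm) ?_ ?_
  · exact (Complex.continuous_ofReal.comp_aestronglyMeasurable
      (aestronglyMeasurable_wienerReal e hP g)).mul (Lp.aestronglyMeasurable _)
  · filter_upwards [coeFn_expCurve e hP hg f 1, coeFn_expCurve e hP hg f (-1)] with ω h1 h2
    rw [Pi.add_apply, h1, h2, norm_mul, norm_mul, norm_mul, Complex.norm_exp, Complex.norm_exp,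
      Complex.norm_real, ← add_mul, Real.norm_eq_abs, Real.norm_of_nonneg (by positivity)]
    refine mul_le_mul_of_nonneg_right ?_ (norm_nonneg _)
    simpa using abs_le_exp_add_exp_neg (wienerReal e hP g ω)

/-- The product of `∑_j ∫ g_j dW_j` and `E_W(f)`. -/
def mulStochVec {g : OneParticle Z (Set.Ici 0)} (hg : g ∈ realVec e)
    (f : OneParticle Z (Set.Ici 0)) : WienerSpace P := (memLp_mul_stochVec e hP hg f).toLp

theorem coeFn_mulStochVec {g : OneParticle Z (Set.Ici 0)} (hg : g ∈ realVec e)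
    (f : OneParticle Z (Set.Ici 0)) : mulStochVec e hP hg f =ᵐ[P]
      fun ω => (wienerReal e hP g ω : ℂ) * stochVec e hP f ω :=
  (memLp_mul_stochVec e hP hg f).coeFn_toLp

/-- A Taylor remainder whose dependence on `r` does not involve `z`: multiplied by the modulus of
`E_W(f)`, the weights become the moduli of `expCurve` at `2` and `-2`, which are in `L²`. -/
theorem norm_exp_sub_one_sub_le {z : ℂ} (hz : ‖z‖ ≤ 1) (r : ℝ) :
    ‖Complex.exp (z * r) - 1 - z * r‖ ≤ 2 * ‖z‖ ^ 2 * (Real.exp (2 * r) + Real.exp (-(2 * r))) := by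
  have h1 := Complex.norm_exp_sub_sum_le_norm_mul_exp (z * r) 2
  simp only [Finset.sum_range_succ, Finset.sum_range_zero, zero_add, pow_zero, pow_one,
    Nat.factorial_zero, Nat.factorial_one, Nat.cast_one, div_one, norm_mul, Complex.norm_real,
    Real.norm_eq_abs] at h1
  rw [sub_sub]
  refine h1.trans ?_
  have h2 : ‖z‖ * |r| ≤ |r| := mul_le_of_le_one_left (abs_nonneg r) hz
  have h3 : |r| ^ 2 ≤ 2 * Real.exp |r| := by
    have := Real.quadratic_le_exp_of_nonneg (abs_nonneg r)
    nlinarith [abs_nonneg r]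
  have h4 : Real.exp (‖z‖ * |r|) ≤ Real.exp |r| := Real.exp_le_exp.2 h2
  have h5 : Real.exp |r| * Real.exp |r| ≤ Real.exp (2 * r) + Real.exp (-(2 * r)) := by
    rw [← Real.exp_add, ← two_mul]
    rcases abs_cases r with ⟨h, _⟩ | ⟨h, _⟩ <;> rw [h]
    · linarith [Real.exp_pos (-(2 * r))]
    · rw [mul_neg]; linarith [Real.exp_pos (2 * r)]
  calc (‖z‖ * |r|) ^ 2 * Real.exp (‖z‖ * |r|)
      = ‖z‖ ^ 2 * (|r| ^ 2 * Real.exp (‖z‖ * |r|)) := by ring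
    _ ≤ ‖z‖ ^ 2 * (2 * Real.exp |r| * Real.exp |r|) := by gcongr
    _ = 2 * ‖z‖ ^ 2 * (Real.exp |r| * Real.exp |r|) := by ring
    _ ≤ _ := by gcongr

/-- The pointwise second-order bound, with a fixed dominating function in `L²`, makes the remainder
`O(‖z‖²)` in norm. -/
theorem hasDerivAt_expCurve {g : OneParticle Z (Set.Ici 0)} (hg : g ∈ realVec e)
    (f : OneParticle Z (Set.Ici 0)) :
    HasDerivAt (expCurve e hP g f) (mulStochVec e hP hg f) 0 := by
  set D := mulStochVec e hP hg f
  have h0 : expCurve e hP g f 0 = stochVec e hP f := by simp [expCurve]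
  have hO : (fun z => expCurve e hP g f z - expCurve e hP g f 0 - z • D) =O[nhds 0]
      fun z => ‖z - 0‖ ^ 2 := by
    refine Asymptotics.IsBigO.of_bound
      (2 * ‖(Lp.memLp (expCurve e hP g f 2)).norm.toLp +
        (Lp.memLp (expCurve e hP g f (-2))).norm.toLp‖) ?_
    filter_upwards [Metric.closedBall_mem_nhds (0 : ℂ) one_pos] with z hz
    rw [Metric.mem_closedBall, dist_zero_right] at hz
    rw [sub_zero, norm_pow, norm_norm, mul_right_comm]
    refine Lp.norm_le_mul_norm_of_ae_le_mul ?_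
    filter_upwards [Lp.coeFn_sub (expCurve e hP g f z - expCurve e hP g f 0) (z • D),
      Lp.coeFn_sub (expCurve e hP g f z) (expCurve e hP g f 0), Lp.coeFn_smul z D,
      coeFn_mulStochVec e hP hg f, coeFn_expCurve e hP hg f z, coeFn_expCurve e hP hg f 2,
      coeFn_expCurve e hP hg f (-2), (Lp.memLp (expCurve e hP g f 2)).norm.coeFn_toLp,
      (Lp.memLp (expCurve e hP g f (-2))).norm.coeFn_toLp,
      Lp.coeFn_add (Lp.memLp (expCurve e hP g f 2)).norm.toLp
        (Lp.memLp (expCurve e hP g f (-2))).norm.toLp]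
      with ω k1 k2 k3 k4 k5 k6 k7 k8 k9 k10
    rw [k1, Pi.sub_apply, k2, Pi.sub_apply, k3, Pi.smul_apply, k4, k5, h0, k10, Pi.add_apply, k8,
      k9,
      k6, k7, norm_mul, norm_mul, ← add_mul, Complex.norm_exp, Complex.norm_exp,
      Real.norm_of_nonneg (by positivity), smul_eq_mul]
    have k11 : Complex.exp (z * wienerReal e hP g ω) * stochVec e hP f ω - stochVec e hP f ω -
        z * (wienerReal e hP g ω * stochVec e hP f ω) =
        (Complex.exp (z * wienerReal e hP g ω) - 1 - z * wienerReal e hP g ω) *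
          stochVec e hP f ω := by ring
    rw [k11, norm_mul, ← mul_assoc]
    refine mul_le_mul_of_nonneg_right ?_ (norm_nonneg _)
    simpa using norm_exp_sub_one_sub_le hz (wienerReal e hP g ω)
  have h1 : HasDerivAt (fun z => expCurve e hP g f z - expCurve e hP g f 0 - z • D) 0 0 := by
    simpa using (hO.hasFDerivAt (𝕜 := ℂ) one_lt_two).hasDerivAt
  have h2 := (h1.add ((hasDerivAt_id (0 : ℂ)).smul_const D)).add_const (expCurve e hP g f 0)
  refine (h2.congr_deriv (by simp)).congr_of_eventuallyEq (Filter.Eventually.of_forall fun z => ?_)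
  simp

/-- Product rule, after division of `expCurve` by its scalar factor; that factor contributes `-⟪g,
f⟫`. -/
theorem hasDerivAt_stochVec {g : OneParticle Z (Set.Ici 0)} (hg : g ∈ realVec e)
    (f : OneParticle Z (Set.Ici 0)) : HasDerivAt (fun z : ℂ => stochVec e hP (f + z • g))
      (mulStochVec e hP hg f - ⟪g, f⟫_ℂ • stochVec e hP f) 0 := by
  have h1 : HasDerivAt (fun z : ℂ => Complex.exp (-(z * ⟪g, f⟫_ℂ + z ^ 2 * (‖g‖ : ℂ) ^ 2 / 2)))
      (-⟪g, f⟫_ℂ) 0 := by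
    have h2 : HasDerivAt (fun z : ℂ => -(z * ⟪g, f⟫_ℂ + z ^ 2 * (‖g‖ : ℂ) ^ 2 / 2))
        (-⟪g, f⟫_ℂ) 0 := by
      have := (((hasDerivAt_id (0 : ℂ)).mul_const ⟪g, f⟫_ℂ).add
        ((((hasDerivAt_id (0 : ℂ)).pow 2).mul_const ((‖g‖ : ℂ) ^ 2)).div_const 2)).neg
      refine (this.congr_deriv (by simp)).congr_of_eventuallyEq
        (Filter.Eventually.of_forall fun z => ?_)
      simp
    simpa using h2.cexp
  have h3 := h1.smul (hasDerivAt_expCurve e hP hg f)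
  refine (h3.congr_deriv ?_).congr_of_eventuallyEq (Filter.Eventually.of_forall fun z => ?_)
  · simp [expCurve, sub_eq_add_neg]
  · simp only [Pi.smul_apply', expCurve, smul_smul, ← Complex.exp_add, neg_add_cancel,
      Complex.exp_zero, one_smul]

/-- The complex derivative is pulled back to Fock space and restricted to real `ε`. The subtracted
term is `a(g) E(f)`, so the sum `a(g) + a†(g)` is pure multiplication. -/
theorem deriv_expVec {g : OneParticle Z (Set.Ici 0)} (hg : g ∈ realVec e)
    (f : OneParticle Z (Set.Ici 0)) : deriv (fun ε : ℝ => expVec (f + (ε : ℂ) • g)) 0 =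
      (fockWiener e hP).symm (mulStochVec e hP hg f) - ⟪g, f⟫_ℂ • expVec f := by
  have h1 := ((fockWiener e hP).symm.toContinuousLinearEquiv.toContinuousLinearMap.hasFDerivAt
    ).comp_hasDerivAt (0 : ℂ) (hasDerivAt_stochVec e hP hg f)
  have h2 : HasDerivAt (fun z : ℂ => expVec (f + z • g)) ((fockWiener e hP).symm
      (mulStochVec e hP hg f) - ⟪g, f⟫_ℂ • expVec f) 0 := by
    refine (h1.congr_deriv ?_).congr_of_eventuallyEq (Filter.Eventually.of_forall fun z => ?_)
    · change (fockWiener e hP).symm _ = _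
      rw [map_sub, map_smul, ← fockWiener_expVec, LinearIsometryEquiv.symm_apply_apply]
    · change _ = (fockWiener e hP).symm (stochVec e hP (f + z • g))
      rw [← fockWiener_expVec, LinearIsometryEquiv.symm_apply_apply]
  have h3 : HasDerivAt (fun ε : ℝ => (ε : ℂ)) 1 0 := Complex.ofRealCLM.hasDerivAt
  have h4 := HasDerivAt.scomp (0 : ℝ) (by simpa using h2) h3
  rw [one_smul] at h4
  exact h4.deriv

end Field

/-! ### The closure of the field operator and its graph -/

section FieldGraph

variable {Z : Type*} [NormedAddCommGroup Z] [InnerProductSpace ℂ Z] [CompleteSpace Z]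
  (e : HilbertBasis ℕ ℂ Z) {P : Measure WienerPath} (hP : IsWienerMeasure P)

theorem ofReal_add_I_ne_zero (r : ℝ) : (r : ℂ) + Complex.I ≠ 0 := fun h => by
  simpa using congrArg Complex.im h

theorem one_le_norm_ofReal_add_I (r : ℝ) : 1 ≤ ‖(r : ℂ) + Complex.I‖ := by
  simpa using Complex.abs_im_le_norm ((r : ℂ) + Complex.I)

theorem memLp_top_resolvent (g : OneParticle Z (Set.Ici 0)) :
    MemLp (fun ω => ((wienerReal e hP g ω : ℂ) + Complex.I)⁻¹) ∞ P := by
  refine memLp_top_of_bound ?_ 1 (ae_of_all _ fun ω => ?_)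
  · exact (Continuous.inv₀ (by fun_prop) ofReal_add_I_ne_zero).comp_aestronglyMeasurable
      (aestronglyMeasurable_wienerReal e hP g)
  · rw [norm_inv]
    exact inv_le_one_of_one_le₀ (one_le_norm_ofReal_add_I _)

theorem memLp_top_mul_resolvent (g : OneParticle Z (Set.Ici 0)) :
    MemLp (fun ω => (wienerReal e hP g ω : ℂ) * ((wienerReal e hP g ω : ℂ) + Complex.I)⁻¹) ∞ P := by
  refine memLp_top_of_bound ?_ 1 (ae_of_all _ fun ω => ?_)
  · exact (Continuous.mul (by fun_prop) (Continuous.inv₀ (by fun_prop)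
      ofReal_add_I_ne_zero)).comp_aestronglyMeasurable (aestronglyMeasurable_wienerReal e hP g)
  · rw [norm_mul, norm_inv, ← div_eq_mul_inv, div_le_one
      (zero_lt_one.trans_le (one_le_norm_ofReal_add_I _)), Complex.norm_real, Real.norm_eq_abs]
    simpa using Complex.abs_re_le_norm ((wienerReal e hP g ω : ℂ) + Complex.I)

/-- Multiplication by `(X + i)⁻¹`, where `X = ∑_j ∫ g_j dW_j`. -/
def resolventMul (g : OneParticle Z (Set.Ici 0)) : WienerSpace P →L[ℂ] WienerSpace P :=
  mulOp (memLp_top_resolvent e hP g).toLp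

/-- Multiplication by `X (X + i)⁻¹`, where `X = ∑_j ∫ g_j dW_j`. -/
def mulResolventMul (g : OneParticle Z (Set.Ici 0)) : WienerSpace P →L[ℂ] WienerSpace P :=
  mulOp (memLp_top_mul_resolvent e hP g).toLp

/-- The unbounded relation `v = X u` is expressed by bounded operators, after division by the
nowhere vanishing `X + i`; this makes the graph of multiplication closed. -/
theorem resolventMul_eq_iff {g : OneParticle Z (Set.Ici 0)} (u v : WienerSpace P) :
    resolventMul e hP g v = mulResolventMul e hP g u ↔
      v =ᵐ[P] fun ω => (wienerReal e hP g ω : ℂ) * u ω := by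
  have h1 := coeFn_mulOp_toLp (memLp_top_resolvent e hP g) v
  have h2 := coeFn_mulOp_toLp (memLp_top_mul_resolvent e hP g) u
  constructor
  · intro h
    rw [resolventMul, mulResolventMul] at h
    rw [h] at h1
    filter_upwards [h1, h2] with ω k1 k2
    rw [k1, smul_eq_mul, smul_eq_mul, mul_right_comm, mul_comm] at k2
    exact mul_right_cancel₀ (inv_ne_zero (ofReal_add_I_ne_zero (wienerReal e hP g ω))) k2
  · intro h
    refine Lp.ext ?_
    filter_upwards [h, h1, h2] with ω k1 k2 k3
    rw [resolventMul, mulResolventMul, k2, k3, k1, smul_eq_mul, smul_eq_mul]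
    ring

theorem resolventMul_mul_add {g : OneParticle Z (Set.Ici 0)} {u v : WienerSpace P}
    (h : v =ᵐ[P] fun ω => (wienerReal e hP g ω : ℂ) * u ω) :
    resolventMul e hP g (v + Complex.I • u) = u ∧
      mulResolventMul e hP g (v + Complex.I • u) = v := by
  have h1 := coeFn_mulOp_toLp (memLp_top_resolvent e hP g) (v + Complex.I • u)
  have h2 := coeFn_mulOp_toLp (memLp_top_mul_resolvent e hP g) (v + Complex.I • u)
  constructor <;> refine Lp.ext ?_
  · filter_upwards [h, h1, Lp.coeFn_add v (Complex.I • u), Lp.coeFn_smul Complex.I u]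
      with ω k1 k2 k3 k4
    rw [resolventMul, k2, k3, Pi.add_apply, k4, Pi.smul_apply, k1, smul_eq_mul, smul_eq_mul,
      ← add_mul, inv_mul_cancel_left₀ (ofReal_add_I_ne_zero _)]
  · filter_upwards [h, h2, Lp.coeFn_add v (Complex.I • u), Lp.coeFn_smul Complex.I u]
      with ω k1 k2 k3 k4
    rw [mulResolventMul, k2, k3, Pi.add_apply, k4, Pi.smul_apply, k1, smul_eq_mul, smul_eq_mul,
      ← add_mul, mul_assoc, inv_mul_cancel_left₀ (ofReal_add_I_ne_zero _)]

/-- This is the range condition behind essential selfadjointness. If `u` is orthogonal to these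
vectors, then `(X - i) u` integrates to zero against all characters, so it vanishes, and `X - i` has
no zeros. As a product of two `L²` functions it is only known to be integrable, which is all that
Fourier uniqueness asks. -/
theorem dense_span_mulStochVec_add {g : OneParticle Z (Set.Ici 0)} (hg : g ∈ realVec e) :
    Dense (Submodule.span ℂ (Set.range fun f => mulStochVec e hP hg f +
      Complex.I • stochVec e hP f) : Set (WienerSpace P)) := by
  rw [Submodule.dense_iff_topologicalClosure_eq_top, Submodule.topologicalClosure_eq_top_iff,
    Submodule.eq_bot_iff]
  intro u hu
  have hX : MemLp (fun ω => (wienerReal e hP g ω : ℂ) - Complex.I) 2 P := by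
    have := hP.isProbabilityMeasure
    have h1 : MemLp (fun ω => (wienerReal e hP g ω : ℂ)) 2 P :=
      (Lp.memLp (wienerIsometry e hP g)).ae_eq (coeFn_wienerIsometry e hP hg)
    exact h1.sub (memLp_const _)
  have h0 := ae_eq_zero_of_realVec e hP (w := fun ω =>
    ((wienerReal e hP g ω : ℂ) - Complex.I) * u ω)
    (hX.integrable_mul (Lp.memLp u)) fun x hx => by
      have hx' := smul_mem_realSpan (-1) hx
      obtain ⟨c, hc, h⟩ := coeFn_stochVec_I_smul e hP hx'
      have h1 := (Submodule.mem_orthogonal _ _).1 hu _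
        (Submodule.subset_span ⟨Complex.I • ((-1 : ℝ) : ℂ) • x, rfl⟩)
      rw [L2.inner_def] at h1
      have h2 : ∫ ω, ⟪(mulStochVec e hP hg (Complex.I • ((-1 : ℝ) : ℂ) • x) +
          Complex.I • stochVec e hP (Complex.I • ((-1 : ℝ) : ℂ) • x) : WienerSpace P) ω, u ω⟫_ℂ ∂P =
          ∫ ω, conj c * (((wienerReal e hP g ω : ℂ) - Complex.I) * u ω *
            Complex.exp (Complex.I * wienerReal e hP x ω)) ∂P := by
        refine integral_congr_ae ?_
        filter_upwards [h, wienerReal_smul e hP (-1) x,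
          coeFn_mulStochVec e hP hg (Complex.I • ((-1 : ℝ) : ℂ) • x),
          Lp.coeFn_add (mulStochVec e hP hg (Complex.I • ((-1 : ℝ) : ℂ) • x))
            (Complex.I • stochVec e hP (Complex.I • ((-1 : ℝ) : ℂ) • x)),
          Lp.coeFn_smul Complex.I (stochVec e hP (Complex.I • ((-1 : ℝ) : ℂ) • x))]
          with ω h3 h4 h5 h6 h7
        rw [h6, Pi.add_apply, h5, h7, Pi.smul_apply, h3, h4, RCLike.inner_apply, smul_eq_mul,
          ← add_mul, map_mul, map_mul, map_add, ← Complex.exp_conj, map_mul, Complex.conj_I,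
          Complex.conj_ofReal, Complex.conj_ofReal]
        push_cast
        ring_nf
      rw [h2, integral_const_mul] at h1
      exact (mul_eq_zero.1 h1).resolve_left ((map_ne_zero _).2 hc)
  refine Lp.eq_zero_iff_ae_eq_zero.2 ?_
  filter_upwards [h0] with ω h
  refine (mul_eq_zero.1 h).resolve_left fun h1 => ?_
  simpa using congrArg Complex.im h1

theorem graph_le_of_span {E F : Type*} [AddCommGroup E] [Module ℂ E] [AddCommGroup F] [Module ℂ F]
    (A : E →ₗ.[ℂ] F) (C : Submodule ℂ (E × F)) (s : Set E) (h1 : A.domain ≤ Submodule.span ℂ s)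
    (h2 : s ⊆ A.domain) (h3 : ∀ x ∈ s, ∀ h : x ∈ A.domain, (x, A ⟨x, h⟩) ∈ C) : A.graph ≤ C := by
  have h4 : Submodule.span ℂ s ≤ A.domain := Submodule.span_le.2 h2
  have key : ∀ y (hy : y ∈ Submodule.span ℂ s), (y, A ⟨y, h4 hy⟩) ∈ C := by
    intro y hy
    induction hy using Submodule.span_induction with
    | mem x hx => exact h3 x hx _
    | zero =>
      have : A ⟨0, h4 (Submodule.zero_mem _)⟩ = 0 := A.map_zero
      rw [this]
      exact C.zero_mem
    | add a b ha hb iha ihb =>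
      have : A ⟨a + b, h4 (Submodule.add_mem _ ha hb)⟩ = A ⟨a, h4 ha⟩ + A ⟨b, h4 hb⟩ :=
        A.map_add ⟨a, h4 ha⟩ ⟨b, h4 hb⟩
      rw [this]
      exact C.add_mem iha ihb
    | smul c a ha iha =>
      have : A ⟨c • a, h4 (Submodule.smul_mem _ c ha)⟩ = c • A ⟨a, h4 ha⟩ :=
        A.map_smul c ⟨a, h4 ha⟩
      rw [this]
      exact C.smul_mem c iha
  rintro ⟨ξ, η⟩ h
  obtain ⟨⟨y, hy⟩, rfl, rfl⟩ := (LinearPMap.mem_graph_iff A).1 h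
  exact key y (h1 hy)

/-- The graph of multiplication by `∑_j ∫ g_j dW_j`, transported to Fock space. -/
def mulGraph (g : OneParticle Z (Set.Ici 0)) : Submodule ℂ
    (FockSpace (OneParticle Z (Set.Ici 0)) × FockSpace (OneParticle Z (Set.Ici 0))) :=
  LinearMap.ker ((resolventMul e hP g ∘L
      (fockWiener e hP).toContinuousLinearEquiv.toContinuousLinearMap ∘L
        ContinuousLinearMap.snd ℂ _ _ -
    mulResolventMul e hP g ∘L (fockWiener e hP).toContinuousLinearEquiv.toContinuousLinearMap ∘L
        ContinuousLinearMap.fst ℂ _ _).toLinearMap)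

theorem isClosed_mulGraph (g : OneParticle Z (Set.Ici 0)) :
    IsClosed (mulGraph e hP g : Set (FockSpace (OneParticle Z (Set.Ici 0)) ×
      FockSpace (OneParticle Z (Set.Ici 0)))) :=
  ContinuousLinearMap.isClosed_ker _

theorem mem_mulGraph (g : OneParticle Z (Set.Ici 0))
    (ξ η : FockSpace (OneParticle Z (Set.Ici 0))) : (ξ, η) ∈ mulGraph e hP g ↔
      fockWiener e hP η =ᵐ[P] fun ω => (wienerReal e hP g ω : ℂ) * fockWiener e hP ξ ω := by
  rw [← resolventMul_eq_iff, mulGraph, LinearMap.mem_ker]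
  exact sub_eq_zero

theorem annihilation_add_creation_apply {g : OneParticle Z (Set.Ici 0)} (hg : g ∈ realVec e)
    (f : OneParticle Z (Set.Ici 0)) (h : expVec f ∈ (annihilation g + creation g).domain) :
    (annihilation g + creation g) ⟨expVec f, h⟩ =
      (fockWiener e hP).symm (mulStochVec e hP hg f) := by
  rw [LinearPMap.add_apply]
  have h1 : annihilation g ⟨expVec f, h.1⟩ = ⟪g, f⟫_ℂ • expVec f := onExpVec_apply _ f
  have h2 : creation g ⟨expVec f, h.2⟩ = deriv (fun ε : ℝ => expVec (f + (ε : ℂ) • g)) 0 :=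
    onExpVec_apply _ f
  change annihilation g ⟨expVec f, h.1⟩ + creation g ⟨expVec f, h.2⟩ = _
  rw [h1, h2, deriv_expVec e hP hg, add_sub_cancel]

theorem graph_le_mulGraph {g : OneParticle Z (Set.Ici 0)} (hg : g ∈ realVec e) :
    (annihilation g + creation g).graph ≤ mulGraph e hP g := by
  refine graph_le_of_span _ _ (Set.range expVec) (fun y hy => hy.1)
    (fun y hy => ⟨Submodule.subset_span hy, Submodule.subset_span hy⟩) ?_
  rintro _ ⟨f, rfl⟩ h
  rw [annihilation_add_creation_apply e hP hg, mem_mulGraph, fockWiener_expVec,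
    LinearIsometryEquiv.apply_symm_apply]
  exact coeFn_mulStochVec e hP hg f

/-- The bounded map `Φ` sends `(X + i) u` to the pair `(u, X u)` on Fock space. It takes the dense
vectors `(X + i) E_W(f)` into the graph on exponential vectors, so by continuity it takes everything
into the closure. -/
theorem mulGraph_le_closure {g : OneParticle Z (Set.Ici 0)} (hg : g ∈ realVec e) :
    mulGraph e hP g ≤ (annihilation g + creation g).graph.topologicalClosure := by
  rintro ⟨ξ, η⟩ h
  rw [mem_mulGraph] at h
  obtain ⟨h1, h2⟩ := resolventMul_mul_add e hP h
  let Φ : WienerSpace P →L[ℂ] FockSpace (OneParticle Z (Set.Ici 0)) ×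
      FockSpace (OneParticle Z (Set.Ici 0)) :=
    ((fockWiener e hP).symm.toContinuousLinearEquiv.toContinuousLinearMap ∘L
      resolventMul e hP g).prod
    ((fockWiener e hP).symm.toContinuousLinearEquiv.toContinuousLinearMap ∘L
      mulResolventMul e hP g)
  have hΦ : ∀ u v : WienerSpace P, (v =ᵐ[P] fun ω => (wienerReal e hP g ω : ℂ) * u ω) →
      Φ (v + Complex.I • u) = ((fockWiener e hP).symm u, (fockWiener e hP).symm v) := by
    intro u v huv
    obtain ⟨k1, k2⟩ := resolventMul_mul_add e hP huv
    change ((fockWiener e hP).symm (resolventMul e hP g _),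
      (fockWiener e hP).symm (mulResolventMul e hP g _)) = _
    rw [k1, k2]
  have h3 := hΦ _ _ h
  rw [LinearIsometryEquiv.symm_apply_apply, LinearIsometryEquiv.symm_apply_apply] at h3
  rw [← h3]
  have hle : Submodule.span ℂ (Set.range fun f => mulStochVec e hP hg f +
      Complex.I • stochVec e hP f) ≤ (annihilation g + creation g).graph.comap Φ.toLinearMap := by
    refine Submodule.span_le.2 ?_
    rintro _ ⟨f, rfl⟩
    change Φ (mulStochVec e hP hg f + Complex.I • stochVec e hP f) ∈
      (annihilation g + creation g).graph
    rw [hΦ _ _ (coeFn_mulStochVec e hP hg f), ← fockWiener_expVec,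
      LinearIsometryEquiv.symm_apply_apply]
    have hd : expVec f ∈ (annihilation g + creation g).domain :=
      ⟨Submodule.subset_span ⟨f, rfl⟩, Submodule.subset_span ⟨f, rfl⟩⟩
    rw [← annihilation_add_creation_apply e hP hg f hd]
    exact LinearPMap.mem_graph _ ⟨expVec f, hd⟩
  have hcl : Φ (fockWiener e hP η + Complex.I • fockWiener e hP ξ) ∈
      closure ((annihilation g + creation g).graph : Set (FockSpace (OneParticle Z (Set.Ici 0)) ×
        FockSpace (OneParticle Z (Set.Ici 0)))) :=
    map_mem_closure Φ.continuous (dense_span_mulStochVec_add e hP hg _) fun x hx => hle hx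
  exact hcl

/-- The closure of `a(g) + a†(g)`, `g` real, becomes multiplication by `∑_j ∫ g_j dW_j`. -/
theorem mem_graph_fieldOp {g : OneParticle Z (Set.Ici 0)} (hg : g ∈ realVec e)
    (u v : WienerSpace P) :
    ((fockWiener e hP).symm u, (fockWiener e hP).symm v) ∈ (fieldOp g).graph ↔
      v =ᵐ[P] fun ω => (wienerReal e hP g ω : ℂ) * u ω := by
  have heq : (annihilation g + creation g).graph.topologicalClosure = mulGraph e hP g :=
    le_antisymm (Submodule.topologicalClosure_minimal _ (graph_le_mulGraph e hP hg)
      (isClosed_mulGraph e hP g)) (mulGraph_le_closure e hP hg)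
  -- Closability must be shown, as `LinearPMap.closure` otherwise returns the operator unchanged.
  -- The closed graph is single-valued because `X · 0 = 0`.
  have hclos : (annihilation g + creation g).IsClosable := by
    refine ⟨(mulGraph e hP g).toLinearPMap, ?_⟩
    rw [heq, Submodule.toLinearPMap_graph_eq]
    rintro ⟨ξ, η⟩ h rfl
    rw [mem_mulGraph, map_zero] at h
    refine (fockWiener e hP).injective (Lp.ext ?_)
    rw [map_zero]
    filter_upwards [h, Lp.coeFn_zero ℂ 2 P] with ω h1 h2
    rw [h1, h2]
    simp
  rw [fieldOp, ← hclos.graph_closure_eq_closure_graph, heq, mem_mulGraph]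
  simp only [LinearIsometryEquiv.apply_symm_apply]

theorem mem_graph_quadrature (j : ℕ) (t : ℝ≥0) (u v : WienerSpace P) :
    ((fockWiener e hP).symm u, (fockWiener e hP).symm v) ∈ (quadrature e (Set.Ici 0) j t).graph ↔
      v =ᵐ[P] fun ω => (W j t ω : ℂ) * u ω := by
  rw [quadrature, mem_graph_fieldOp e hP (stepVec_mem_realVec e j t)]
  have h : (fun ω => (wienerReal e hP (stepVec (Set.Ici 0) t (e j)) ω : ℂ) * u ω) =ᵐ[P]
      fun ω => (W j t ω : ℂ) * u ω := by
    filter_upwards [wienerReal_stepVec e hP j t] with ω h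
    rw [h]
  exact ⟨fun h1 => h1.trans h, fun h1 => h1.trans h.symm⟩

end FieldGraph

/-! ### Operators that commute with multiplication operators -/

section Commutants

variable {α : Type*} {m m0 : MeasurableSpace α} {μ : Measure α}

theorem mulOp_mul_comm (φ ψ : Lp ℂ ∞ μ) :
    (mulOp φ * mulOp ψ : Lp ℂ 2 μ →L[ℂ] Lp ℂ 2 μ) = mulOp ψ * mulOp φ := by
  ext1 u
  refine Lp.ext ?_
  rw [mul_apply_eq_comp, mul_apply_eq_comp]
  filter_upwards [coeFn_mulOp φ (mulOp ψ u), coeFn_mulOp ψ (mulOp φ u), coeFn_mulOp φ u,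
    coeFn_mulOp ψ u] with x h1 h2 h3 h4
  rw [h1, h2, h3, h4, smul_comm]

theorem integrable_mul_inner {φ : α → ℂ} (hφ : MemLp φ ∞ μ) (a b : Lp ℂ 2 μ) :
    Integrable (fun x => φ x * ⟪b x, a x⟫_ℂ) μ := by
  refine (L2.integrable_inner b (mulOp hφ.toLp a)).congr ?_
  filter_upwards [coeFn_mulOp_toLp hφ a] with x h
  rw [h, inner_smul_right]

theorem inner_mulOp {φ : α → ℂ} (hφ : MemLp φ ∞ μ) (a b : Lp ℂ 2 μ) :
    ⟪b, mulOp hφ.toLp a⟫_ℂ = ∫ x, φ x * ⟪b x, a x⟫_ℂ ∂μ := by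
  rw [L2.inner_def]
  refine integral_congr_ae ?_
  filter_upwards [coeFn_mulOp_toLp hφ a] with x h
  rw [h, inner_smul_right]

theorem inner_mulOp_conj {φ : α → ℂ} (hφ : MemLp φ ∞ μ) (a b : Lp ℂ 2 μ) :
    ⟪b, mulOp hφ.toLp a⟫_ℂ = ⟪mulOp hφ.star.toLp b, a⟫_ℂ := by
  rw [L2.inner_def, L2.inner_def]
  refine integral_congr_ae ?_
  filter_upwards [coeFn_mulOp_toLp hφ a, coeFn_mulOp_toLp hφ.star b] with x h1 h2
  rw [h1, h2, inner_smul_right, inner_smul_left]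
  simp

/-- An integrable function whose integrals over all events of a sub-σ-algebra vanish is orthogonal
to the bounded functions that are measurable with respect to it. -/
theorem integral_mul_eq_zero [IsFiniteMeasure μ] (hm : m ≤ m0) {φ w : α → ℂ}
    (hφ : Measurable[m] φ) (hw : Integrable w μ) (hφw : Integrable (fun x => φ x * w x) μ)
    (h : ∀ A, MeasurableSet[m] A → ∫ x in A, w x ∂μ = 0) : ∫ x, φ x * w x ∂μ = 0 := by
  -- The conditional expectation of `w` vanishes, and `φ` can be pulled out of that of `φ w`.
  have h1 : (0 : α → ℂ) =ᵐ[μ] μ[w | m] :=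
    ae_eq_condExp_of_forall_setIntegral_eq hm hw (fun s _ _ => (integrable_zero _ _ _).integrableOn)
      (fun s hs _ => by simp [h s hs]) aestronglyMeasurable_const
  have h2 := condExp_bilin_of_stronglyMeasurable_left (ContinuousLinearMap.mul ℝ ℂ) (m := m)
    hφ.stronglyMeasurable hφw hw
  have h3 := integral_condExp hm (μ := μ) (f := fun x => φ x * w x)
  rw [← h3]
  refine (integral_congr_ae ?_).trans (integral_zero α ℂ)
  filter_upwards [h1, h2] with x h4 h5
  refine h5.trans ?_
  rw [← h4]
  simp

/-- An operator that commutes with multiplication by all bounded functions is multiplication by a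
bounded function, namely its value at `1`. -/
theorem exists_eq_mul_of_commute [IsFiniteMeasure μ] (T : Lp ℂ 2 μ →L[ℂ] Lp ℂ 2 μ)
    (hT : ∀ ψ : Lp ℂ ∞ μ, T * mulOp ψ = mulOp ψ * T) :
    MemLp (T (Lp.const 2 μ 1)) ∞ μ ∧ ∀ u, T u =ᵐ[μ] fun x => T (Lp.const 2 μ 1) x * u x := by
  set φ := T (Lp.const 2 μ 1) with hφdef
  -- An indicator is a bounded multiplication applied to `1`, and `T` commutes with that
  -- multiplication.
  have hind : ∀ (c : ℂ) {s : Set α} (hs : MeasurableSet s),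
      T (indicatorConstLp 2 hs (measure_ne_top μ s) c) =ᵐ[μ]
        fun x => φ x * s.indicator (fun _ => c) x := by
    intro c s hs
    have h1 : indicatorConstLp 2 hs (measure_ne_top μ s) c =
        mulOp (indicatorConstLp ∞ hs (measure_ne_top μ s) c) (Lp.const 2 μ (1 : ℂ)) := by
      refine Lp.ext ?_
      filter_upwards [coeFn_mulOp (indicatorConstLp ∞ hs (measure_ne_top μ s) c)
        (Lp.const 2 μ (1 : ℂ)), Lp.coeFn_const (p := 2) (μ := μ) (1 : ℂ),
        indicatorConstLp_coeFn (p := 2) (hs := hs) (hμs := measure_ne_top μ s) (c := c),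
        indicatorConstLp_coeFn (p := ∞) (hs := hs) (hμs := measure_ne_top μ s) (c := c)]
        with x h1 h2 h3 h4
      rw [h1, h2, h3, h4]
      simp
    have h2 := DFunLike.congr_fun (hT (indicatorConstLp ∞ hs (measure_ne_top μ s) c))
      (Lp.const 2 μ (1 : ℂ))
    rw [mul_apply_eq_comp, mul_apply_eq_comp, ← h1, ← hφdef] at h2
    rw [h2]
    filter_upwards [coeFn_mulOp (indicatorConstLp ∞ hs (measure_ne_top μ s) c) φ,
      indicatorConstLp_coeFn (p := ∞) (hs := hs) (hμs := measure_ne_top μ s) (c := c)] with x h3 h4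
    rw [h3, h4, smul_eq_mul, mul_comm]
  have hφ : MemLp φ ∞ μ := by
    refine memLp_top_of_bound (Lp.aestronglyMeasurable φ) ‖T‖ ?_
    obtain ⟨g, hg, hφg⟩ := Lp.aestronglyMeasurable φ
    -- On `s` the integral of `‖φ‖²` equals `‖T 1_s‖²`, which is at most `‖T‖² μ(s)`. As the
    -- integrand exceeds `‖T‖²` there, `s` is null.
    set s : Set α := {x | ‖T‖ < ‖g x‖} with hsdef
    have hs : MeasurableSet s := measurableSet_lt measurable_const hg.measurable.norm
    have h1 := T.le_opNorm (indicatorConstLp 2 hs (measure_ne_top μ s) (1 : ℂ))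
    have h2 : ‖T (indicatorConstLp 2 hs (measure_ne_top μ s) (1 : ℂ))‖ ^ 2 =
        ∫ x in s, ‖g x‖ ^ 2 ∂μ := by
      have h3 := inner_self_eq_norm_sq_to_K (𝕜 := ℂ)
        (T (indicatorConstLp 2 hs (measure_ne_top μ s) (1 : ℂ)))
      rw [L2.inner_def, ← integral_indicator hs] at *
      have h4 : ∫ x, ⟪T (indicatorConstLp 2 hs (measure_ne_top μ s) (1 : ℂ)) x,
          T (indicatorConstLp 2 hs (measure_ne_top μ s) (1 : ℂ)) x⟫_ℂ ∂μ =
          ∫ x, ((s.indicator (fun x => ‖g x‖ ^ 2) x : ℝ) : ℂ) ∂μ := by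
        refine integral_congr_ae ?_
        filter_upwards [hind 1 hs, hφg] with x h5 h6
        rw [h5, h6]
        by_cases hx : x ∈ s
        · simp [hx]
        · simp [hx]
      rw [h4, integral_complex_ofReal] at h3
      exact Complex.ofReal_injective (by rw [Complex.ofReal_pow]; exact h3.symm)
    have hgi : Integrable (fun x => ‖g x‖ ^ 2) μ :=
      (((Lp.memLp φ).ae_eq hφg).integrable_norm_pow (by norm_num))
    have h3 : ∫ x in s, ‖g x‖ ^ 2 ∂μ ≤ ∫ x in s, ‖T‖ ^ 2 ∂μ := by
      rw [← h2, setIntegral_const, smul_eq_mul]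
      have h4 : ‖indicatorConstLp 2 hs (measure_ne_top μ s) (1 : ℂ)‖ ^ 2 = μ.real s := by
        have h5 := inner_self_eq_norm_sq_to_K (𝕜 := ℂ)
          (indicatorConstLp 2 hs (measure_ne_top μ s) (1 : ℂ))
        rw [L2.inner_indicatorConstLp_one_indicatorConstLp_one hs hs (measure_ne_top μ s)
          (measure_ne_top μ s), Set.inter_self] at h5
        exact_mod_cast h5.symm
      calc _ ≤ (‖T‖ * ‖indicatorConstLp 2 hs (measure_ne_top μ s) (1 : ℂ)‖) ^ 2 := by gcongr
        _ = _ := by rw [mul_pow, h4, mul_comm]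
    have h4 : ∫ x in s, (‖g x‖ ^ 2 - ‖T‖ ^ 2) ∂μ = 0 := by
      refine le_antisymm ?_ (setIntegral_nonneg hs fun x hx => ?_)
      · rw [integral_sub hgi.integrableOn (integrable_const _)]
        linarith
      · have hx' : ‖T‖ < ‖g x‖ := hx
        nlinarith [norm_nonneg T]
    have h5 : μ s = 0 := by
      have hint : IntegrableOn (fun x => ‖g x‖ ^ 2 - ‖T‖ ^ 2) s μ :=
        (hgi.sub (integrable_const _)).integrableOn
      rw [setIntegral_eq_zero_iff_of_nonneg_ae ?_ hint] at h4
      · have h6 : ∀ᵐ x ∂μ.restrict s, False := by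
          filter_upwards [h4, ae_restrict_mem hs] with x h7 h8
          have hx' : ‖T‖ < ‖g x‖ := h8
          simp only [Pi.zero_apply] at h7
          nlinarith [norm_nonneg T]
        simpa using h6
      · filter_upwards [ae_restrict_mem hs] with x h8
        have hx' : ‖T‖ < ‖g x‖ := h8
        simp only [Pi.zero_apply]
        nlinarith [norm_nonneg T]
    filter_upwards [hφg, measure_eq_zero_iff_ae_notMem.1 h5] with x h6 h7
    rw [h6]
    exact not_lt.1 h7
  refine ⟨hφ, fun u => ?_⟩
  have h1 : ∀ u, T u = mulOp hφ.toLp u := by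
    refine Lp.induction (by norm_num) _ (fun c s hs hμs => ?_) (fun f g hf hg _ h1 h2 => ?_)
      (isClosed_eq T.continuous (mulOp hφ.toLp).continuous)
    · rw [Lp.simpleFunc.coe_indicatorConst]
      refine Lp.ext ((hind c hs).trans ?_)
      filter_upwards [coeFn_mulOp_toLp hφ (indicatorConstLp 2 hs hμs.ne c),
        indicatorConstLp_coeFn (p := 2) (hs := hs) (hμs := hμs.ne) (c := c)] with x h1 h2
      rw [h1, h2, smul_eq_mul]
    · rw [map_add, map_add, h1, h2]
  rw [h1]
  exact coeFn_mulOp_toLp hφ u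

/-- Multiplication by a bounded function that is measurable with respect to a sub-σ-algebra commutes
with the conditional expectation. -/
theorem starProjection_mul_mulOp [Fact (m ≤ m0)] {φ : α → ℂ} (hφ : MemLp φ ∞ μ)
    (hφm : AEStronglyMeasurable[m] φ μ) :
    (lpMeas ℂ ℂ m 2 μ).starProjection * mulOp hφ.toLp =
      mulOp hφ.toLp * (lpMeas ℂ ℂ m 2 μ).starProjection := by
  -- Multiplication by `φ`, and its adjoint, multiplication by the conjugate, both preserve the
  -- subspace of measurable classes, so they commute with its projection.
  have key : ∀ {φ : α → ℂ} (hφ : MemLp φ ∞ μ) (_ : AEStronglyMeasurable[m] φ μ)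
      {u : Lp ℂ 2 μ}, u ∈ lpMeas ℂ ℂ m 2 μ → mulOp hφ.toLp u ∈ lpMeas ℂ ℂ m 2 μ := by
    intro φ hφ hφm u hu
    rw [mem_lpMeas_iff_aestronglyMeasurable] at hu ⊢
    exact (hφm.smul hu).congr (coeFn_mulOp_toLp hφ u).symm
  ext1 u
  refine Submodule.eq_starProjection_of_mem_of_inner_eq_zero
    (key hφ hφm (Submodule.starProjection_apply_mem _ u)) fun w hw => ?_
  rw [mul_apply_eq_comp]
  change ⟪mulOp hφ.toLp u - mulOp hφ.toLp _, w⟫_ℂ = 0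
  rw [← map_sub, ← inner_conj_symm, inner_mulOp_conj, inner_conj_symm]
  exact Submodule.starProjection_inner_eq_zero u _ (key hφ.star
    (Complex.continuous_conj.comp_aestronglyMeasurable hφm) hw)

end Commutants

/-! ### The algebra generated by the Weyl operators up to time `t` -/

section WeylAlgebra

variable {Z : Type*} [NormedAddCommGroup Z] [InnerProductSpace ℂ Z] [CompleteSpace Z]
  (e : HilbertBasis ℕ ℂ Z) {P : Measure WienerPath} (hP : IsWienerMeasure P)

/-- The `𝓕_t`-measurable classes form a closed subspace that contains `W_j(s)` for `s ≤ t`. -/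
theorem aestronglyMeasurable_wienerReal_sigmaAlg {t : ℝ≥0} {x : OneParticle Z (Set.Ici 0)}
    (hx : x ∈ realVecUpTo e t) : AEStronglyMeasurable[sigmaAlg t] (wienerReal e hP x) P := by
  have : Fact (sigmaAlg t ≤ (inferInstance : MeasurableSpace WienerPath)) := ⟨sigmaAlg_le t⟩
  have h : wienerIsometry e hP x ∈ lpMeas ℂ ℂ (sigmaAlg t) 2 P := by
    refine realSpan_induction (p := fun x => wienerIsometry e hP x ∈ lpMeas ℂ ℂ (sigmaAlg t) 2 P)
      ((isClosed_aestronglyMeasurable (sigmaAlg_le t)).preimage (wienerIsometry e hP).continuous)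
      (fun c => ?_) hx
    rw [Finsupp.sum, map_sum]
    refine Submodule.sum_mem _ fun p _ => ?_
    rw [map_smul]
    refine Submodule.smul_mem _ _ ?_
    rw [wienerIsometry_stepVec, mem_lpMeas_iff_aestronglyMeasurable]
    have h1 : Measurable[sigmaAlg t] (W p.1 (p.2 : ℝ≥0)) := by
      have h2 : MeasurableSpace.comap (W p.1 (p.2 : ℝ≥0)) inferInstance ≤ sigmaAlg t :=
        le_iSup₂_of_le p.1 p.2 le_rfl
      exact (comap_measurable _).mono h2 le_rfl
    exact (Complex.measurable_ofReal.comp h1).aestronglyMeasurable.congr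
      (coeFn_wienerVec hP p.1 p.2).symm
  exact (mem_lpMeas_iff_aestronglyMeasurable.1 h).re

/-- For fixed `u` and `v`, the matrix element of the commutator of `S` with multiplication by `φ`
is, up to sign, the integral of `φ` against one integrable function `w`. It vanishes when `φ` is a
character, so `w` integrates to zero over all events of `𝓕_t`. -/
theorem mulOp_mul_of_commute_expMul {t : ℝ≥0} {S : WienerSpace P →L[ℂ] WienerSpace P}
    (hS : ∀ x ∈ realVecUpTo e t, expMul e hP x * S = S * expMul e hP x) {φ : WienerPath → ℂ}
    (hφm : Measurable[sigmaAlg t] φ) (hφ : MemLp φ ∞ P) :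
    mulOp hφ.toLp * S = S * mulOp hφ.toLp := by
  have := hP.isProbabilityMeasure
  ext1 u
  refine ext_inner_left ℂ fun v => ?_
  rw [mul_apply_eq_comp, mul_apply_eq_comp,
    ← ContinuousLinearMap.adjoint_inner_left S]
  let w : WienerPath → ℂ := fun ω =>
    ⟪v ω, S u ω⟫_ℂ - ⟪ContinuousLinearMap.adjoint S v ω, u ω⟫_ℂ
  have hw : Integrable w P := (L2.integrable_inner v (S u)).sub (L2.integrable_inner _ u)
  have key : ∀ {φ : WienerPath → ℂ} (hφ : MemLp φ ∞ P), Integrable (fun ω => φ ω * w ω) P ∧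
      ∫ ω, φ ω * w ω ∂P = ⟪v, mulOp hφ.toLp (S u)⟫_ℂ -
        ⟪ContinuousLinearMap.adjoint S v, mulOp hφ.toLp u⟫_ℂ := by
    intro φ hφ
    have i1 := integrable_mul_inner hφ (S u) v
    have i2 := integrable_mul_inner hφ u (ContinuousLinearMap.adjoint S v)
    rw [inner_mulOp, inner_mulOp, ← integral_sub i1 i2]
    simp only [w, mul_sub]
    exact ⟨i1.sub i2, trivial⟩
  have h0 := integral_mul_eq_zero (sigmaAlg_le t) hφm hw (key hφ).1 fun A hA =>
    setIntegral_eq_zero_of_realVecUpTo e hP hw (fun x hx => by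
      have h1 := (key (memLp_top_exp e hP x)).2
      have h2 := DFunLike.congr_fun (hS x hx) u
      rw [mul_apply_eq_comp, mul_apply_eq_comp] at h2
      rw [ContinuousLinearMap.adjoint_inner_left] at h1
      simp only [mul_comm (w _)]
      rw [h1, sub_eq_zero]
      exact congrArg _ h2) hA
  rw [(key hφ).2, sub_eq_zero] at h0
  exact h0

theorem centralizer_centralizer_expMul (t : ℝ≥0) :
    Set.centralizer (Set.centralizer {T | ∃ x ∈ realVecUpTo e t, T = expMul e hP x}) =
      mulLinfty P t := by
  have := hP.isProbabilityMeasure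
  have : Fact (sigmaAlg t ≤ (inferInstance : MeasurableSpace WienerPath)) := ⟨sigmaAlg_le t⟩
  ext T
  constructor
  · intro hT
    have h1 := exists_eq_mul_of_commute T fun ψ => by
      refine (hT (mulOp ψ) ?_).symm
      rintro _ ⟨x, hx, rfl⟩
      exact mulOp_mul_comm _ _
    have h2 : T (Lp.const 2 P 1) ∈ lpMeas ℂ ℂ (sigmaAlg t) 2 P := by
      -- The conditional expectation lies in the commutant of the characters and fixes `1`, so it
      -- also fixes `T 1`.
      have h3 := hT (lpMeas ℂ ℂ (sigmaAlg t) 2 P).starProjection (by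
        rintro _ ⟨x, hx, rfl⟩
        refine (starProjection_mul_mulOp _ ?_).symm
        exact (by fun_prop : Continuous fun r : ℝ => Complex.exp (Complex.I * (r : ℂ))
          ).comp_aestronglyMeasurable (aestronglyMeasurable_wienerReal_sigmaAlg e hP hx))
      have h4 := DFunLike.congr_fun h3 (Lp.const 2 P 1)
      have h5 : (lpMeas ℂ ℂ (sigmaAlg t) 2 P).starProjection (Lp.const 2 P (1 : ℂ)) =
          Lp.const 2 P 1 := by
        rw [Submodule.starProjection_eq_self_iff, mem_lpMeas_iff_aestronglyMeasurable]
        exact aestronglyMeasurable_const.congr (Lp.coeFn_const (p := 2) (μ := P) (1 : ℂ)).symm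
      rw [mul_apply_eq_comp, mul_apply_eq_comp, h5] at h4
      rw [← h4]
      exact Submodule.starProjection_apply_mem _ _
    obtain ⟨φ, hφ, hTφ⟩ := mem_lpMeas_iff_aestronglyMeasurable.1 h2
    refine ⟨φ, hφ.measurable, h1.1.ae_eq hTφ, fun u => ?_⟩
    filter_upwards [h1.2 u, hTφ] with ω h6 h7
    rw [h6, h7]
  · rintro ⟨φ, hφm, hφ, hT⟩ S hS
    have h1 : T = mulOp hφ.toLp := by
      ext1 u
      exact Lp.ext ((hT u).trans (coeFn_mulOp_toLp hφ u).symm)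
    rw [h1]
    exact (mulOp_mul_of_commute_expMul e hP (fun x hx => hS _ ⟨x, hx, rfl⟩) hφm hφ).symm

/-- Conjugation with a unitary as an isomorphism of the multiplicative structure. -/
def conjByEquiv {H K : Type*} [NormedAddCommGroup H] [InnerProductSpace ℂ H] [NormedAddCommGroup K]
    [InnerProductSpace ℂ K] (U : H ≃ₗᵢ[ℂ] K) : (H →L[ℂ] H) ≃* (K →L[ℂ] K) where
  toFun := conjBy U
  invFun := conjBy U.symm
  left_inv B := by ext x; simp [conjBy]
  right_inv B := by ext x; simp [conjBy]
  map_mul' A B := by ext x; simp [conjBy]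

/-- Conjugation is multiplicative and hence commutes with commutants. The generators correspond
because the vectors `χ_{[0, t]} k` exhaust `realVecUpTo`. -/
theorem conjBy_image_weylAlgebra (t : ℝ≥0) :
    conjBy (fockWiener e hP) '' weylAlgebra e (Set.Ici 0) t = mulLinfty P t := by
  change conjByEquiv (fockWiener e hP) '' _ = _
  rw [← centralizer_centralizer_expMul e hP t, weylAlgebra, image_centralizer, image_centralizer]
  congr 2
  ext T
  constructor
  · rintro ⟨_, ⟨k, rfl⟩, rfl⟩
    exact ⟨_, cut_mem_realVecUpTo e k t, conjBy_weyl e hP (cut_mem_realVec e k t)⟩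
  · rintro ⟨x, hx, rfl⟩
    obtain ⟨k, rfl⟩ := exists_cut_eq e hx
    exact ⟨_, ⟨k, rfl⟩, conjBy_weyl e hP (cut_mem_realVec e k t)⟩

end WeylAlgebra

/-! ### Factorization of Fock space over a direct sum -/

section Factorization

variable {H H₁ H₀ : Type*} [NormedAddCommGroup H] [InnerProductSpace ℂ H]
  [NormedAddCommGroup H₁] [InnerProductSpace ℂ H₁] [NormedAddCommGroup H₀] [InnerProductSpace ℂ H₀]
  {p₁ : H → H₁} {p₀ : H → H₀}

theorem ext_inner_expVec {x y : FockSpace H} (h : ∀ g, ⟪expVec g, x⟫_ℂ = ⟪expVec g, y⟫_ℂ) :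
    x = y := by
  rw [← sub_eq_zero]
  refine expVec_eq_zero_of_inner _ fun f => ?_
  rw [← inner_conj_symm, inner_sub_right, h, sub_self, map_zero]

/-- If `H` is the direct sum of `H₁` and `H₀`, these are the maps `y ↦ E(a) ⊗ y`. -/
theorem exists_tensor_expVec (hinner : ∀ f g, ⟪f, g⟫_ℂ = ⟪p₁ f, p₁ g⟫_ℂ + ⟪p₀ f, p₀ g⟫_ℂ)
    (hsurj : ∀ a b, ∃ f, p₁ f = a ∧ p₀ f = b) :
    ∃ V : H₁ → FockSpace H₀ →L[ℂ] FockSpace H, ∀ a g y,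
      ⟪expVec g, V a y⟫_ℂ = ⟪expVec (p₁ g), expVec a⟫_ℂ * ⟪expVec (p₀ g), y⟫_ℂ := by
  choose j hj₁ hj₀ using hsurj
  -- The norm of `E(a)`. Dividing by it gives vectors with the Gram matrix of the exponential
  -- vectors over `H₀`, hence an isometry, which is then scaled back.
  let c : H₁ → ℝ := fun a => Real.exp (‖a‖ ^ 2 / 2)
  have hc : ∀ a, (c a : ℂ) ≠ 0 := fun a => Complex.ofReal_ne_zero.2 (Real.exp_pos _).ne'
  have hgram : ∀ a b b', ⟪((c a : ℂ))⁻¹ • expVec (j a b), ((c a : ℂ))⁻¹ • expVec (j a b')⟫_ℂ =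
      ⟪expVec b, expVec b'⟫_ℂ := by
    intro a b b'
    rw [inner_smul_left, inner_smul_right, inner_expVec, inner_expVec, hinner, hj₁, hj₁, hj₀, hj₀,
      inner_self_eq_norm_sq_to_K, Complex.exp_add, map_inv₀, Complex.conj_ofReal]
    have h1 : Complex.exp (((‖a‖ : ℝ) : ℂ) ^ 2) = c a * c a := by
      rw [← Complex.ofReal_mul, ← Real.exp_add, Complex.ofReal_exp]
      push_cast
      ring_nf
    have h2 := hc a
    simp only [RCLike.ofReal_eq_complex_ofReal]
    rw [h1]
    field_simp
  refine ⟨fun a => (c a : ℂ) • (gramIsometry expVec (fun b => ((c a : ℂ))⁻¹ • expVec (j a b))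
    dense_span_expVec (hgram a)).toContinuousLinearMap, fun a g y => ?_⟩
  have h : (innerSL ℂ (expVec g)).comp ((c a : ℂ) • (gramIsometry expVec
      (fun b => ((c a : ℂ))⁻¹ • expVec (j a b)) dense_span_expVec (hgram a)
      ).toContinuousLinearMap) =
      ⟪expVec (p₁ g), expVec a⟫_ℂ • innerSL ℂ (expVec (p₀ g)) := by
    refine ContinuousLinearMap.ext_on dense_span_expVec ?_
    rintro _ ⟨b, rfl⟩
    change ⟪expVec g, (c a : ℂ) • gramIsometry expVec _ dense_span_expVec (hgram a) (expVec b)⟫_ℂ =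
      ⟪expVec (p₁ g), expVec a⟫_ℂ * ⟪expVec (p₀ g), expVec b⟫_ℂ
    rw [gramIsometry_apply, smul_inv_smul₀ (hc a), inner_expVec, inner_expVec, inner_expVec,
      hinner, hj₁, hj₀, Complex.exp_add]
  exact DFunLike.congr_fun h y

theorem tensor_expVec (hinner : ∀ f g, ⟪f, g⟫_ℂ = ⟪p₁ f, p₁ g⟫_ℂ + ⟪p₀ f, p₀ g⟫_ℂ)
    {V : H₁ → FockSpace H₀ →L[ℂ] FockSpace H}
    (hV : ∀ a g y, ⟪expVec g, V a y⟫_ℂ = ⟪expVec (p₁ g), expVec a⟫_ℂ * ⟪expVec (p₀ g), y⟫_ℂ)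
    (f : H) : V (p₁ f) (expVec (p₀ f)) = expVec f :=
  ext_inner_expVec fun g => by
    rw [hV, inner_expVec, inner_expVec, inner_expVec, hinner, Complex.exp_add]

/-- `T` is `1 ⊗ B` if and only if it maps `E(a) ⊗ y` to `E(a) ⊗ B y`. -/
theorem tensor_iff (hinner : ∀ f g, ⟪f, g⟫_ℂ = ⟪p₁ f, p₁ g⟫_ℂ + ⟪p₀ f, p₀ g⟫_ℂ)
    (hsurj : ∀ a b, ∃ f, p₁ f = a ∧ p₀ f = b) {V : H₁ → FockSpace H₀ →L[ℂ] FockSpace H}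
    (hV : ∀ a g y, ⟪expVec g, V a y⟫_ℂ = ⟪expVec (p₁ g), expVec a⟫_ℂ * ⟪expVec (p₀ g), y⟫_ℂ)
    (B : FockSpace H₀ →L[ℂ] FockSpace H₀) (T : FockSpace H →L[ℂ] FockSpace H) :
    (∀ g f, ⟪expVec g, T (expVec f)⟫_ℂ =
      ⟪expVec (p₁ g), expVec (p₁ f)⟫_ℂ * ⟪expVec (p₀ g), B (expVec (p₀ f))⟫_ℂ) ↔
      ∀ a, T ∘L V a = V a ∘L B := by
  constructor
  · intro h a
    refine ContinuousLinearMap.ext_on dense_span_expVec ?_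
    rintro _ ⟨b, rfl⟩
    obtain ⟨f, rfl, rfl⟩ := hsurj a b
    refine ext_inner_expVec fun g => ?_
    rw [ContinuousLinearMap.comp_apply, ContinuousLinearMap.comp_apply, tensor_expVec hinner hV, h,
      hV]
  · intro h g f
    have h1 := DFunLike.congr_fun (h (p₁ f)) (expVec (p₀ f))
    rw [ContinuousLinearMap.comp_apply, ContinuousLinearMap.comp_apply,
      tensor_expVec hinner hV] at h1
    rw [h1, hV]

/-- The von Neumann algebra generated by the ampliations of a family of operators consists of the
ampliations of the operators in the von Neumann algebra generated by the family. -/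
theorem mem_centralizer_centralizer_tensor
    (hinner : ∀ f g, ⟪f, g⟫_ℂ = ⟪p₁ f, p₁ g⟫_ℂ + ⟪p₀ f, p₀ g⟫_ℂ)
    (hsurj : ∀ a b, ∃ f, p₁ f = a ∧ p₀ f = b) {κ : Type*}
    (n : κ → FockSpace H₀ →L[ℂ] FockSpace H₀) (N : κ → FockSpace H →L[ℂ] FockSpace H)
    (hn : ∀ k g f, ⟪expVec g, N k (expVec f)⟫_ℂ =
      ⟪expVec (p₁ g), expVec (p₁ f)⟫_ℂ * ⟪expVec (p₀ g), n k (expVec (p₀ f))⟫_ℂ)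
    (T : FockSpace H →L[ℂ] FockSpace H) :
    T ∈ Set.centralizer (Set.centralizer (Set.range N)) ↔
      ∃ B ∈ Set.centralizer (Set.centralizer (Set.range n)), ∀ g f, ⟪expVec g, T (expVec f)⟫_ℂ =
        ⟪expVec (p₁ g), expVec (p₁ f)⟫_ℂ * ⟪expVec (p₀ g), B (expVec (p₀ f))⟫_ℂ := by
  obtain ⟨V, hV⟩ := exists_tensor_expVec hinner hsurj
  have hN : ∀ k a, N k ∘L V a = V a ∘L n k := fun k =>
    (tensor_iff hinner hsurj hV (n k) (N k)).1 (hn k)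
  -- If `T` is `1 ⊗ B`, then its adjoint is the ampliation of the adjoint of `B`; taking adjoints of
  -- its intertwining relation gives this one.
  have hadj : ∀ (B : FockSpace H₀ →L[ℂ] FockSpace H₀) (T : FockSpace H →L[ℂ] FockSpace H),
      (∀ g f, ⟪expVec g, T (expVec f)⟫_ℂ =
        ⟪expVec (p₁ g), expVec (p₁ f)⟫_ℂ * ⟪expVec (p₀ g), B (expVec (p₀ f))⟫_ℂ) →
      ∀ a, ContinuousLinearMap.adjoint (V a) ∘L T = B ∘L ContinuousLinearMap.adjoint (V a) := by
    intro B T hBT a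
    have h := (tensor_iff hinner hsurj hV (ContinuousLinearMap.adjoint B)
      (ContinuousLinearMap.adjoint T)).1 (fun g f => by
        rw [ContinuousLinearMap.adjoint_inner_right, ContinuousLinearMap.adjoint_inner_right,
          ← inner_conj_symm, hBT f g, map_mul, inner_conj_symm, inner_conj_symm]) a
    have h2 := congrArg ContinuousLinearMap.adjoint h
    rw [ContinuousLinearMap.adjoint_comp, ContinuousLinearMap.adjoint_comp,
      ContinuousLinearMap.adjoint_adjoint, ContinuousLinearMap.adjoint_adjoint] at h2
    exact h2
  -- `E(0)` is a unit vector.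
  have hV0 : ContinuousLinearMap.adjoint (V 0) ∘L V 0 = ContinuousLinearMap.id ℂ _ := by
    ext1 y
    refine ext_inner_expVec fun b => ?_
    obtain ⟨f, hf, rfl⟩ := hsurj 0 b
    rw [ContinuousLinearMap.comp_apply, ContinuousLinearMap.adjoint_inner_right, ← hf,
      tensor_expVec hinner hV, hV, inner_expVec, hf, inner_zero_left, Complex.exp_zero, one_mul]
    rfl
  constructor
  · intro hT
    -- For `S` in the commutant of the `n k`, the operator `|E(a)⟩⟨E(b)| ⊗ S` commutes with every
    -- ampliation `N k`, hence with `T`.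
    have hcomm : ∀ (a b : H₁) (S : FockSpace H₀ →L[ℂ] FockSpace H₀),
        S ∈ Set.centralizer (Set.range n) →
          T ∘L V a ∘L S ∘L ContinuousLinearMap.adjoint (V b) =
            V a ∘L S ∘L ContinuousLinearMap.adjoint (V b) ∘L T := by
      intro a b S hS
      refine (hT (V a ∘L S ∘L ContinuousLinearMap.adjoint (V b)) ?_).symm
      rintro _ ⟨k, rfl⟩
      have h1 : n k ∘L S = S ∘L n k := hS _ ⟨k, rfl⟩
      change N k ∘L V a ∘L S ∘L ContinuousLinearMap.adjoint (V b) =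
        V a ∘L S ∘L ContinuousLinearMap.adjoint (V b) ∘L N k
      rw [hadj _ _ (hn k), ← ContinuousLinearMap.comp_assoc, hN, ContinuousLinearMap.comp_assoc,
        ← ContinuousLinearMap.comp_assoc (n k) S, h1]
      rfl
    -- `B` is the compression of `T` to `E(0) ⊗ Γ_0`. The case `a = b = 0` above shows that it
    -- commutes with each `S`; the case `b = 0`, `S = 1` gives `T V a = V a B`.
    refine ⟨ContinuousLinearMap.adjoint (V 0) ∘L T ∘L V 0, ?_, ?_⟩
    · intro S hS
      have h1 := hcomm 0 0 S hS
      have h2 : ∀ y, ContinuousLinearMap.adjoint (V 0) (V 0 y) = y := DFunLike.congr_fun hV0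
      ext1 y
      have h3 := congrArg (ContinuousLinearMap.adjoint (V 0)) (DFunLike.congr_fun h1 (V 0 y))
      simp only [ContinuousLinearMap.comp_apply, h2] at h3
      exact h3.symm
    · refine (tensor_iff hinner hsurj hV _ T).2 fun a => ?_
      have h1 := hcomm a 0 1 (by simp [Set.mem_centralizer_iff])
      have h2 : ∀ y, ContinuousLinearMap.adjoint (V 0) (V 0 y) = y := DFunLike.congr_fun hV0
      ext1 y
      have h3 := DFunLike.congr_fun h1 (V 0 y)
      simp only [ContinuousLinearMap.comp_apply, one_apply_eq_self, h2] at h3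
      exact h3
  · rintro ⟨B, hB, h⟩ S hS
    have hT := (tensor_iff hinner hsurj hV B T).1 h
    -- The blocks of `S` between `E(a) ⊗ Γ_0` and `E(b) ⊗ Γ_0` commute with the `n k`, hence with
    -- `B`. This gives `S T = T S` on matrix elements between exponential vectors.
    have hcomm : ∀ a b, ContinuousLinearMap.adjoint (V b) ∘L S ∘L V a ∘L B =
        B ∘L ContinuousLinearMap.adjoint (V b) ∘L S ∘L V a := by
      intro a b
      refine hB (ContinuousLinearMap.adjoint (V b) ∘L S ∘L V a) ?_
      rintro _ ⟨k, rfl⟩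
      have h1 : N k ∘L S = S ∘L N k := hS _ ⟨k, rfl⟩
      change n k ∘L ContinuousLinearMap.adjoint (V b) ∘L S ∘L V a =
        ContinuousLinearMap.adjoint (V b) ∘L S ∘L V a ∘L n k
      rw [← hN, ← ContinuousLinearMap.comp_assoc, ← hadj _ _ (hn k), ContinuousLinearMap.comp_assoc,
        ← ContinuousLinearMap.comp_assoc (N k) S, h1]
      rfl
    refine ContinuousLinearMap.ext_on dense_span_expVec ?_
    rintro _ ⟨f, rfl⟩
    refine ext_inner_expVec fun g => ?_
    rw [← tensor_expVec hinner hV g, ← ContinuousLinearMap.adjoint_inner_right,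
      ← ContinuousLinearMap.adjoint_inner_right, ← tensor_expVec hinner hV f]
    have h1 := DFunLike.congr_fun (hT (p₁ f)) (expVec (p₀ f))
    have h2 := DFunLike.congr_fun (hcomm (p₁ f) (p₁ g)) (expVec (p₀ f))
    have h3 := DFunLike.congr_fun (hadj B T h (p₁ g)) (S (V (p₁ f) (expVec (p₀ f))))
    simp only [ContinuousLinearMap.comp_apply] at h1 h2 h3
    rw [mul_apply_eq_comp, mul_apply_eq_comp, h1, h2, h3]

end Factorization

/-! ### Fock space over `L²(ℝ; Z)` -/

section Ampliation

variable {Z : Type*} [NormedAddCommGroup Z] [InnerProductSpace ℂ Z]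

theorem coeFn_restrictTo {Z : Type*} [NormedAddCommGroup Z] (S : Set ℝ)
    (f : OneParticle Z Set.univ) :
    restrictTo S f =ᵐ[volume.restrict S] f :=
  MemLp.coeFn_toLp _

theorem inner_eq_add_inner_restrictTo (f g : OneParticle Z Set.univ) :
    ⟪f, g⟫_ℂ = ⟪restrictTo (Set.Iio 0) f, restrictTo (Set.Iio 0) g⟫_ℂ +
      ⟪restrictTo (Set.Ici 0) f, restrictTo (Set.Ici 0) g⟫_ℂ := by
  have h : ∀ S : Set ℝ, ⟪restrictTo S f, restrictTo S g⟫_ℂ = ∫ s in S, ⟪f s, g s⟫_ℂ := by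
    intro S
    rw [L2.inner_def]
    refine integral_congr_ae ?_
    filter_upwards [coeFn_restrictTo S f, coeFn_restrictTo S g] with s h1 h2
    rw [h1, h2]
  have hint : IntegrableOn (fun s => ⟪f s, g s⟫_ℂ) Set.univ volume := L2.integrable_inner f g
  rw [h, h, L2.inner_def, ← setIntegral_union (Set.Iio_disjoint_Ici le_rfl) measurableSet_Ici
    (hint.mono_set (Set.subset_univ _)) (hint.mono_set (Set.subset_univ _)), Set.Iio_union_Ici]

theorem exists_restrictTo_eq {Z : Type*} [NormedAddCommGroup Z] (a : OneParticle Z (Set.Iio 0))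
    (b : OneParticle Z (Set.Ici 0)) :
    ∃ f, restrictTo (Set.Iio 0) f = a ∧ restrictTo (Set.Ici 0) f = b := by
  have h1 : MemLp ((Set.Iio (0 : ℝ)).indicator a) 2 volume :=
    (memLp_indicator_iff_restrict measurableSet_Iio).2 (Lp.memLp a)
  have h2 : MemLp ((Set.Ici (0 : ℝ)).indicator b) 2 volume :=
    (memLp_indicator_iff_restrict measurableSet_Ici).2 (Lp.memLp b)
  have h : MemLp ((Set.Iio (0 : ℝ)).indicator a + (Set.Ici (0 : ℝ)).indicator b) 2
      (volume.restrict Set.univ) := (h1.add h2).restrict _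
  refine ⟨h.toLp, Lp.ext ?_, Lp.ext ?_⟩
  · filter_upwards [coeFn_restrictTo (Set.Iio 0) h.toLp,
      ae_mono (Measure.restrict_mono (Set.subset_univ _) le_rfl) h.coeFn_toLp,
      ae_restrict_mem measurableSet_Iio] with s k1 k2 k3
    rw [k1, k2, Pi.add_apply, Set.indicator_of_mem k3,
      Set.indicator_of_notMem (by simpa using k3), add_zero]
  · filter_upwards [coeFn_restrictTo (Set.Ici 0) h.toLp,
      ae_mono (Measure.restrict_mono (Set.subset_univ _) le_rfl) h.coeFn_toLp,
      ae_restrict_mem measurableSet_Ici] with s k1 k2 k3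
    rw [k1, k2, Pi.add_apply, Set.indicator_of_mem k3,
      Set.indicator_of_notMem (by simpa using k3), zero_add]

theorem restrictTo_smul (S : Set ℝ) (c : ℂ) (f : OneParticle Z Set.univ) :
    restrictTo S (c • f) = c • restrictTo S f := by
  refine Lp.ext ?_
  filter_upwards [coeFn_restrictTo S (c • f), coeFn_restrictTo S f,
    Lp.coeFn_smul c (restrictTo S f),
    ae_mono (Measure.restrict_mono (Set.subset_univ S) le_rfl) (Lp.coeFn_smul c f)]
    with s h1 h2 h3 h4
  rw [h1, h3, h4, Pi.smul_apply, Pi.smul_apply, h2]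

variable (e : HilbertBasis ℕ ℂ Z)

theorem restrictTo_cut (S : Set ℝ) (k : RealLocL2 e) (t : ℝ≥0) :
    restrictTo S (k.cut Set.univ t) = k.cut S t := by
  refine Lp.ext ?_
  filter_upwards [coeFn_restrictTo S (k.cut Set.univ t), coeFn_cut e k S t,
    ae_mono (Measure.restrict_mono (Set.subset_univ S) le_rfl) (coeFn_cut e k Set.univ t)]
    with s h1 h2 h3
  rw [h1, h2, h3]

theorem cut_Iio_eq_zero (k : RealLocL2 e) (t : ℝ≥0) : k.cut (Set.Iio 0) t = 0 := by
  refine Lp.eq_zero_iff_ae_eq_zero.2 ?_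
  filter_upwards [coeFn_cut e k (Set.Iio 0) t, ae_restrict_mem measurableSet_Iio] with s h1 h2
  rw [h1, Set.indicator_of_notMem fun h3 => not_lt.2 h3.1 h2]
  rfl

/-- The vector `i χ_{[0, t]} k` vanishes on the negative half-line, so its norm and its inner
products only see the restrictions to `ℝ₊`, and the negative half-line contributes the plain factor
`exp ⟪g, f⟫`. -/
theorem isAmpliation_weylAt (k : RealLocL2 e) (t : ℝ≥0) :
    IsAmpliation (weylAt (Set.Ici 0) k t).toContinuousLinearEquiv.toContinuousLinearMap
      (weylAt Set.univ k t).toContinuousLinearEquiv.toContinuousLinearMap := by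
  intro g f
  set h := Complex.I • k.cut Set.univ t with hh
  set h₀ := Complex.I • k.cut (Set.Ici 0) t with hh₀
  have e1 : restrictTo (Set.Iio 0) h = 0 := by
    rw [hh, restrictTo_smul, restrictTo_cut, cut_Iio_eq_zero, smul_zero]
  have e0 : restrictTo (Set.Ici 0) h = h₀ := by rw [hh, restrictTo_smul, restrictTo_cut]
  have hin : ∀ f, ⟪h, f⟫_ℂ = ⟪h₀, restrictTo (Set.Ici 0) f⟫_ℂ := fun f => by
    rw [inner_eq_add_inner_restrictTo, e1, e0, inner_zero_left, zero_add]
  have hin' : ∀ f, ⟪f, h⟫_ℂ = ⟪restrictTo (Set.Ici 0) f, h₀⟫_ℂ := fun f => by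
    rw [inner_eq_add_inner_restrictTo, e1, e0, inner_zero_right, zero_add]
  have hnorm : (‖h‖ : ℂ) ^ 2 = (‖h₀‖ : ℂ) ^ 2 := by
    have h1 := hin h
    rw [e0, inner_self_eq_norm_sq_to_K, inner_self_eq_norm_sq_to_K] at h1
    exact h1
  change ⟪expVec g, weyl h (LinearIsometryEquiv.refl ℂ _) (expVec f)⟫_ℂ =
    ⟪expVec (restrictTo (Set.Iio 0) g), expVec (restrictTo (Set.Iio 0) f)⟫_ℂ *
      ⟪expVec (restrictTo (Set.Ici 0) g), weyl h₀ (LinearIsometryEquiv.refl ℂ _)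
        (expVec (restrictTo (Set.Ici 0) f))⟫_ℂ
  rw [weyl_expVec, weyl_expVec, inner_smul_right, inner_smul_right, inner_expVec, inner_expVec,
    inner_expVec, LinearIsometryEquiv.coe_refl, LinearIsometryEquiv.coe_refl, id_eq, id_eq,
    inner_add_right, inner_add_right, hin, hin', hnorm, inner_eq_add_inner_restrictTo g f]
  simp only [← Complex.exp_add]
  congr 1
  ring

theorem mem_weylAlgebra_univ (t : ℝ≥0)
    (T : FockSpace (OneParticle Z Set.univ) →L[ℂ] FockSpace (OneParticle Z Set.univ)) :
    T ∈ weylAlgebra e Set.univ t ↔ ∃ B ∈ weylAlgebra e (Set.Ici 0) t, IsAmpliation B T := by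
  have h : ∀ S : Set ℝ, weylAlgebra e S t = Set.centralizer (Set.centralizer (Set.range
      fun k : RealLocL2 e => (weylAt S k t).toContinuousLinearEquiv.toContinuousLinearMap)) := by
    intro S
    rw [weylAlgebra]
    congr 2
    ext T
    simp only [Set.mem_ofPred_eq, Set.mem_range, eq_comm]
  rw [h, h]
  exact mem_centralizer_centralizer_tensor inner_eq_add_inner_restrictTo exists_restrictTo_eq _ _
    (fun k => isAmpliation_weylAt e k t) T

end Ampliation

end FockWiener

end

/-! ### The main theorem -/

open FockWiener in
theorem theorem3 {Z : Type*} [NormedAddCommGroup Z] [InnerProductSpace ℂ Z] [CompleteSpace Z]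
    (e : HilbertBasis ℕ ℂ Z) (P : Measure WienerPath) (hP : IsWienerMeasure P) :
    -- the series of Wiener integrals that occur below converge in Wiener space
    (∀ f : OneParticle Z (Set.Ici 0),
      Summable (fun j => wienerIntegral hP j (coord e j f)) ∧ Summable (expTerm e hP f)) ∧
    ∃ I : FockSpace (OneParticle Z (Set.Ici 0)) ≃ₗᵢ[ℂ] WienerSpace P,
      -- `I E(f) = E_W(f)`, and `I` is the only unitary isomorphism with this property
      (∀ f, I (expVec f) =ᵐ[P] stochExp e hP f) ∧
      (∀ I' : FockSpace (OneParticle Z (Set.Ici 0)) ≃ₗᵢ[ℂ] WienerSpace P,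
        (∀ f, I' (expVec f) =ᵐ[P] stochExp e hP f) → I' = I) ∧
      -- `I 𝒲_t(ik; 1) I⁻¹` is the multiplication by `exp {i ∑_j ∫₀ᵗ k_j dW_j}`
      (∀ (k : RealLocL2 e) (t : ℝ≥0), 0 < t → ∀ u : WienerSpace P,
        I (weylAt (Set.Ici 0) k t (I.symm u)) =ᵐ[P] fun ω =>
          Complex.exp (Complex.I *
            (∑' j, wienerIntegral hP j (coord e j (k.cut (Set.Ici 0) t)) : WienerSpace P) ω) *
              u ω) ∧
      -- `I (A_j(t) + A_j†(t)) I⁻¹` is the multiplication by `W_j(t)`, on its maximal domain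
      (∀ (j : ℕ) (t : ℝ≥0), 0 < t → ∀ u v : WienerSpace P,
        (I.symm u, I.symm v) ∈ (quadrature e (Set.Ici 0) j t).graph ↔
          v =ᵐ[P] fun ω => (W j t ω : ℂ) * u ω) ∧
      -- `I ℳ(t) I⁻¹ = L^∞(Ω, 𝓕_t, P)`
      (∀ t : ℝ≥0, 0 < t → conjBy I '' weylAlgebra e (Set.Ici 0) t = mulLinfty P t) ∧
      -- on the Fock space over `L²(ℝ; Z)`, the operators `𝒲_t(ik; 1)` and the algebra generated by
      -- them are the ampliations of those on the Fock space over `L²(ℝ₊; Z)`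
      (∀ (k : RealLocL2 e) (t : ℝ≥0), 0 < t →
        IsAmpliation (weylAt (Set.Ici 0) k t).toContinuousLinearEquiv.toContinuousLinearMap
          (weylAt Set.univ k t).toContinuousLinearEquiv.toContinuousLinearMap) ∧
      (∀ t : ℝ≥0, 0 < t → ∀ T, T ∈ weylAlgebra e Set.univ t ↔
        ∃ B ∈ weylAlgebra e (Set.Ici 0) t, IsAmpliation B T) := by
  refine ⟨fun f => ⟨(hasSum_wienerIntegral e hP f).summable, ?_⟩, fockWiener e hP, fun f => ?_,
    fun I' hI' => eq_fockWiener e hP hI', fun k t _ u => fockWiener_weylAt e hP k t u,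
    fun j t _ u v => mem_graph_quadrature e hP j t u v,
    fun t _ => conjBy_image_weylAlgebra e hP t, fun k t _ => isAmpliation_weylAt e k t,
    fun t _ T => mem_weylAlgebra_univ e t T⟩
  · have := hP.isProbabilityMeasure
    exact (hasSum_expTerm e hP f).summable
  · rw [fockWiener_expVec]
    exact (memLp_stochExp e hP f).coeFn_toLp
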